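/- Let $q\in\mathbb C$ with $0<|q|<1$, and fix square roots $q^{1/2}$ and $(-q)^{1/2}$. Put $[n]=\frac{q^n-q^{-n}}{q-q^{-1}}$, $(x;p)_\infty=\prod_{k\ge0}(1-xp^k)$ and $\alpha_\psi(x)=\frac{(q^2x;q^4)_\infty}{(x;q^4)_\infty}$, the latter being regarded as a formal power series in $x$. For $i=0,1$ let $V(\Lambda_i)=\mathbb C[a_{-1},a_{-2},\dots]\otimes\bigoplus_{n\in\mathbb Z}\mathbb C e^{\Lambda_i+n\alpha}$, where $\Lambda_1=\Lambda_0+\alpha/2$, $(\alpha,\Lambda_i+n\alpha)=i+2n$. The operators $a_k$ ($k\ne0$) act on the first factor: $a_{-n}$ for $n>0$ is multiplication by the variable, $a_n$ for $n>0$ kills $1$, and $[a_k,a_l]=\delta_{k+l,0}\frac{[2k]}{k}\frac{q^k-q^{-k}}{q-q^{-1}}$. Further $e^{\beta'}(f\otimes e^{\beta})=f\otimes e^{\beta+\beta'}$ for $\beta'\in\frac12\mathbb Z\alpha$, and $\partial (f\otimes e^\beta)=(\alpha,\beta)f\otimes e^\beta$. Let $x_0^+$ be the coefficient of $y^{-1}$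 in $$X^+(y)=\exp\Big(\sum_{n\ge1}\frac{a_{-n}}{[n]}q^{-n/2}y^n\Big)\exp\Big(-\sum_{n\ge1}\frac{a_n}{[n]}q^{-n/2}y^{-n}\Big)e^{\alpha}y^{\partial},$$ and let $$\Psi_+(z)=\exp\Big(-\sum_{n\ge1}\frac{a_{-n}}{[2n]}q^{n/2}z^n\Big)\exp\Big(\sum_{n\ge1}\frac{a_n}{[2n]}q^{-3n/2}z^{-n}\Big)e^{-\alpha/2}(-qz)^{-\partial/2},$$ $\Psi_-(z)=\Psi_+(z)x_0^+-q\,x_0^+\Psi_+(z)$ and $\Psi^*_\varepsilon(z)=\Psi_{-\varepsilon}(q^2z)$ for $\varepsilon=\pm$. These are formal series in $z^{\pm1/2}$ whose coefficients are operators $V(\Lambda_i)\to V(\Lambda_{1-i})$; on the eigenspace $\partial=j$ one reads $(-qz)^{-\partial/2}=((-q)^{1/2})^{-j}z^{-j/2}$, and $(q^2z)^{1/2}=qz^{1/2}$. Let $v_\pm$ be a basis of $\mathbb C^2$, let $v_\pm^*$ be the dual basis, and let $R(x)$ be the operator on $\mathbb C^2\otimes\mathbb C^2$ with matrix, in the basis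 $v_+\otimes v_+,\,v_+\otimes v_-,\,v_-\otimes v_+,\,v_-\otimes v_-$, $$R(x)=\begin{pmatrix}1&0&0&0\\0&\frac{(1-x)q}{1-q^2x}&\frac{1-q^2}{1-q^2x}&0\\0&\frac{(1-q^2)x}{1-q^2x}&\frac{(1-x)q}{1-q^2x}&0\\0&0&0&1\end{pmatrix},$$ its entries being expanded as power series in $x$. Write $$\Psi^{*(1)}(z)\Psi^{*(2)}(w)=\sum_{\varepsilon_1,\varepsilon_2}\Psi^*_{\varepsilon_1}(z)\Psi^*_{\varepsilon_2}(w)\otimes v^*_{\varepsilon_1}\otimes v^*_{\varepsilon_2},\qquad \Psi^{*(2)}(w)\Psi^{*(1)}(z)=\sum_{\varepsilon_1,\varepsilon_2}\Psi^*_{\varepsilon_2}(w)\Psi^*_{\varepsilon_1}(z)\otimes v^*_{\varepsilon_1}\otimes v^*_{\varepsilon_2},$$ and let $\Psi^{*(2)}(w)\Psi^{*(1)}(z)R(z/w)$ be the product of this row vector (in the basis $v^*_{\varepsilon_1}\otimes v^*_{\varepsilon_2}$) with the matrix $R(z/w)$. On $V(\Lambda_i)$ let $$\delta(q^2z,w)=\sum_{\substack{k+l=-1\\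 k,l\in\mathbb Z+i/2}}(q^2z)^kw^l,$$ with $(q^2)^k=q^{2k}$ for half-integers $k$; for $i=0$ this is the usual formal delta function. Then for $i=0,1$ the following identity of formal series in $z^{\pm1/2},w^{\pm1/2}$ holds on $V(\Lambda_i)$, where each coefficient, applied to any vector, is a finite sum: $$z^{-1/2}\alpha_\psi(w/z)\,\Psi^{*(1)}(z)\Psi^{*(2)}(w)=w^{-1/2}\alpha_\psi(z/w)\,\Psi^{*(2)}(w)\Psi^{*(1)}(z)R(z/w)+(-1)^{\partial}(-q)^{1/2}\big(q\,v^*_-\otimes v^*_+-v^*_+\otimes v^*_-\big)\,\delta(q^2z,w).$$ -/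

import Mathlib

open scoped PowerSeries.WithPiTopology

noncomputable section

namespace AffineSl2

open PowerSeries (C X mk)

/-! ### Formal power series -/

/-- `exp f = ∑ k, f ^ k / k!` for a formal power series `f` with zero constant term, with
coefficients in a (not necessarily commutative) algebra.  Since `f` has zero constant term, only
the terms with `k ≤ n` contribute to the coefficient of degree `n`. -/
def expSeries {A : Type*} [Ring A] [Algebra ℂ A] (f : PowerSeries A) : PowerSeries A :=
  mk fun n => ∑ k ∈ Finset.range (n + 1),
    ((Nat.factorial k : ℂ)⁻¹) • PowerSeries.coeff n (f ^ k)

/-- The infinite product `(a x; p)_∞ = ∏_{k ≥ 0} (1 - a p ^ k x)` as a formal power series in `x`.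
The product converges coefficientwise for `|p| < 1`, see `multipliable_qPochhammer`. -/
def qPochhammer (a p : ℂ) : PowerSeries ℂ :=
  ∏' k : ℕ, (1 - C (a * p ^ k) * X)

theorem multipliable_qPochhammer (a p : ℂ) (hp : ‖p‖ < 1) :
    Multipliable fun k : ℕ => (1 - C (a * p ^ k) * X : PowerSeries ℂ) := by
  have h1 : Summable fun k : ℕ => ‖-(a * p ^ k)‖ := by
    simp only [norm_neg, norm_mul, norm_pow]
    exact (summable_geometric_of_lt_one (norm_nonneg _) hp).mul_left _
  have h2 := summable_finsetProd_of_summable_norm h1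
  have h3 : Summable fun S : Finset ℕ =>
      ∏ k ∈ S, (C (-(a * p ^ k)) * X : PowerSeries ℂ) := by
    rw [PowerSeries.WithPiTopology.summable_iff_summable_coeff]
    intro n
    have h4 : ∀ S : Finset ℕ, PowerSeries.coeff n
        (∏ k ∈ S, (C (-(a * p ^ k)) * X : PowerSeries ℂ)) =
        Set.indicator {S : Finset ℕ | S.card = n} (fun S => ∏ k ∈ S, -(a * p ^ k)) S := by
      intro S
      rw [Finset.prod_mul_distrib, Finset.prod_const, ← map_prod, PowerSeries.coeff_C_mul,
        PowerSeries.coeff_X_pow]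
      by_cases h : S.card = n
      · rw [Set.indicator_of_mem (by exact h), if_pos h.symm, mul_one]
      · rw [Set.indicator_of_notMem (by exact h), if_neg (Ne.symm h), mul_zero]
    simp only [h4]
    exact h2.indicator _
  have h5 := multipliable_one_add_of_summable_prod h3
  refine h5.congr fun k => ?_
  simp only [map_neg, neg_mul, sub_eq_add_neg]

/-- `α_ψ(x) = (q² x; q⁴)_∞ / (x; q⁴)_∞` as a formal power series in `x`. -/
def alphaPsi (q : ℂ) : PowerSeries ℂ :=
  qPochhammer (q ^ 2) (q ^ 4) * (qPochhammer 1 (q ^ 4))⁻¹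

/-! ### The Fock space and the Heisenberg algebra -/

/-- The `q`-integer `[n] = (q ^ n - q ^ (-n)) / (q - q ^ (-1))`. -/
def qInt (q : ℂ) (n : ℕ) : ℂ := (q ^ n - (q ^ n)⁻¹) / (q - q⁻¹)

/-- `ℂ[a_{-1}, a_{-2}, …]`; the variable `a_{-n}` is indexed by the positive integer `n`. -/
abbrev Fock : Type := MvPolynomial ℕ+ ℂ

/-- The creation operator `a_{-n}`, `n > 0`: multiplication by the variable `a_{-n}`. -/
def aNeg (n : ℕ+) : Module.End ℂ Fock := LinearMap.mulLeft ℂ (MvPolynomial.X n)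

/-- The annihilation operator `a_n`, `n > 0`: the derivation with
`[a_n, a_{-n}] = ([2n] / n) (γ ^ n - γ ^ (-n)) / (q - q ^ (-1))` at level one, `γ = q`. -/
def aPos (q : ℂ) (n : ℕ+) : Module.End ℂ Fock :=
  (qInt q (2 * n) / (n : ℂ) * ((q ^ (n : ℕ) - (q ^ (n : ℕ))⁻¹) / (q - q⁻¹))) •
    (MvPolynomial.pderiv n : Derivation ℂ Fock Fock).toLinearMap

/-- The series `∑_{n ≥ 1} c n • a n • t ^ n`. -/
def modeSeries (a : ℕ+ → Module.End ℂ Fock) (c : ℕ → ℂ) : PowerSeries (Module.End ℂ Fock) :=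
  mk fun n => if h : 0 < n then c n • a ⟨n, h⟩ else 0

/-- Coefficient of `t ^ l` in `exp (∑_{n ≥ 1} c n • a_{-n} t ^ n)`. -/
def expNeg (c : ℕ → ℂ) (l : ℕ) : Module.End ℂ Fock :=
  PowerSeries.coeff l (expSeries (modeSeries aNeg c))

/-- Coefficient of `t ^ l` in `exp (∑_{n ≥ 1} d n • a_n t ^ n)` (with `t = z ^ (-1)`). -/
def expPos (q : ℂ) (d : ℕ → ℂ) (l : ℕ) : Module.End ℂ Fock :=
  PowerSeries.coeff l (expSeries (modeSeries (aPos q) d))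

theorem aPos_homogeneous (q : ℂ) (n : ℕ+) (D : ℤ) (f : Fock)
    (hf : f.IsWeightedHomogeneous (fun k : ℕ+ => (k : ℤ)) D) :
    (aPos q n f).IsWeightedHomogeneous (fun k : ℕ+ => (k : ℤ)) (D - n) := by
  have h := MvPolynomial.IsWeightedHomogeneous.pderiv (i := n) hf (n' := D - n) (by ring)
  exact (MvPolynomial.weightedHomogeneousSubmodule ℂ (fun k : ℕ+ => (k : ℤ)) (D - n)).smul_mem _ h

theorem expPos_homogeneous (q : ℂ) (d : ℕ → ℂ) (l : ℕ) (D : ℤ) (f : Fock)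
    (hf : f.IsWeightedHomogeneous (fun k : ℕ+ => (k : ℤ)) D) :
    (expPos q d l f).IsWeightedHomogeneous (fun k : ℕ+ => (k : ℤ)) (D - l) := by
  have key : ∀ k l : ℕ, ∀ (D : ℤ) (f : Fock),
      f.IsWeightedHomogeneous (fun k : ℕ+ => (k : ℤ)) D →
      (PowerSeries.coeff l (modeSeries (aPos q) d ^ k) f).IsWeightedHomogeneous
        (fun k : ℕ+ => (k : ℤ)) (D - l) := by
    intro k
    induction k with
    | zero =>
      intro l D f hf
      rw [pow_zero, PowerSeries.coeff_one]
      split_ifs with h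
      · subst h; simpa using hf
      · exact MvPolynomial.isWeightedHomogeneous_zero _ _ _
    | succ k ih =>
      intro l D f hf
      rw [pow_succ, PowerSeries.coeff_mul, LinearMap.sum_apply]
      refine Submodule.sum_mem
        (MvPolynomial.weightedHomogeneousSubmodule ℂ (fun k : ℕ+ => (k : ℤ)) (D - l)) ?_
      rintro ⟨i, j⟩ hij
      have hij' : i + j = l := by simpa using hij
      change MvPolynomial.IsWeightedHomogeneous _
        (PowerSeries.coeff i (modeSeries (aPos q) d ^ k)
          (PowerSeries.coeff j (modeSeries (aPos q) d) f)) _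
      have e : D - (l : ℤ) = (D - j) - i := by rw [← hij']; push_cast; ring
      rw [e]
      apply ih
      rw [modeSeries, PowerSeries.coeff_mk]
      split_ifs with h
      · exact (MvPolynomial.weightedHomogeneousSubmodule ℂ (fun k : ℕ+ => (k : ℤ))
          (D - j)).smul_mem _ (aPos_homogeneous q ⟨j, h⟩ D f hf)
      · exact MvPolynomial.isWeightedHomogeneous_zero _ _ _
  rw [expPos, expSeries, PowerSeries.coeff_mk, LinearMap.sum_apply]
  refine Submodule.sum_mem
    (MvPolynomial.weightedHomogeneousSubmodule ℂ (fun k : ℕ+ => (k : ℤ)) (D - l)) fun k _ => ?_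
  exact (MvPolynomial.weightedHomogeneousSubmodule ℂ (fun k : ℕ+ => (k : ℤ)) (D - l)).smul_mem _
    (key k l D f hf)

/-- On every vector, only finitely many coefficients of the annihilation exponential are nonzero. -/
theorem expPos_eventually_zero (q : ℂ) (d : ℕ → ℂ) (f : Fock) :
    ∃ N : ℕ, ∀ l : ℕ, N < l → expPos q d l f = 0 := by
  induction f using MvPolynomial.induction_on' with
  | monomial u a =>
    have hu : (MvPolynomial.monomial u a : Fock).IsWeightedHomogeneous (fun k : ℕ+ => (k : ℤ))
        (Finsupp.weight (fun k : ℕ+ => (k : ℤ)) u) :=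
      MvPolynomial.isWeightedHomogeneous_monomial _ _ _ rfl
    refine ⟨(Finsupp.weight (fun k : ℕ+ => (k : ℤ)) u).toNat, fun l hl => ?_⟩
    have h := expPos_homogeneous q d l _ _ hu
    by_contra hne
    obtain ⟨e, he⟩ := MvPolynomial.ne_zero_iff.mp hne
    have h1 := h he
    have h2 : 0 ≤ Finsupp.weight (fun k : ℕ+ => (k : ℤ)) e := by
      rw [Finsupp.weight_apply]
      exact Finset.sum_nonneg fun k _ => by positivity
    omega
  | add f g hf hg =>
    obtain ⟨N, hN⟩ := hf
    obtain ⟨M, hM⟩ := hg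
    refine ⟨max N M, fun l hl => ?_⟩
    rw [map_add, hN l (by omega), hM l (by omega), add_zero]

theorem finite_support_normalMode (q : ℂ) (c d : ℕ → ℂ) (r : ℤ) (f : Fock) :
    (Function.support fun l : ℕ =>
      if 0 ≤ r + l then expNeg c (r + l).toNat (expPos q d l f) else 0).Finite := by
  obtain ⟨N, hN⟩ := expPos_eventually_zero q d f
  refine (Set.finite_Iic N).subset fun l hl => ?_
  by_contra hlt
  apply hl
  simp only [Set.mem_Iic, not_le] at hlt
  simp [hN l hlt]

/-- The coefficient of `z ^ r` in the normally ordered exponential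
`exp (∑_{n ≥ 1} c n • a_{-n} z ^ n) exp (∑_{n ≥ 1} d n • a_n z ^ (-n))`:
the sum over `l` of the coefficient of `z ^ (r + l)` in the first factor times the coefficient of
`z ^ (-l)` in the second one. -/
def normalMode (q : ℂ) (c d : ℕ → ℂ) (r : ℤ) : Module.End ℂ Fock where
  toFun f := ∑ᶠ l : ℕ, if 0 ≤ r + l then expNeg c (r + l).toNat (expPos q d l f) else 0
  map_add' f g := by
    rw [← finsum_add_distrib (finite_support_normalMode q c d r f)
      (finite_support_normalMode q c d r g)]
    refine finsum_congr fun l => ?_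
    split_ifs <;> simp
  map_smul' x f := by
    rw [RingHom.id_apply, smul_finsum' x (finite_support_normalMode q c d r f)]
    refine finsum_congr fun l => ?_
    split_ifs <;> simp

/-! ### The level one modules -/

/-- The space `V(Λ₀) ⊕ V(Λ₁)`.  For `j : ℤ`, `i ∈ {0, 1}`, `j ≡ i` mod `2`, the vector
`Finsupp.single j f` is `f ⊗ e ^ (Λ_i + ⌊j/2⌋ α)`.  As `(α, Λ_i + ⌊j/2⌋ α) = j`, the number `j` is
the eigenvalue of `∂` on this vector; multiplication by `e ^ (α/2)` raises `j` by `1`. -/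
abbrev VTotal : Type := ℤ →₀ Fock

/-- The summand `V(Λ_i)` of `V(Λ₀) ⊕ V(Λ₁)`, `i = 0, 1`. -/
def VLambda (i : Fin 2) : Submodule ℂ VTotal :=
  Finsupp.supported Fock ℂ {j : ℤ | j ≡ ((i : ℕ) : ℤ) [ZMOD 2]}

/-- The operator `(-1) ^ ∂`. -/
def negOnePowDel : Module.End ℂ VTotal :=
  Finsupp.lsum ℂ fun j : ℤ => ((-1 : ℂ) ^ j) • Finsupp.lsingle j

/-- A formal field: `F m` is the coefficient of `z ^ (m / 2)`, for `m : ℤ`. -/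
abbrev FormalField : Type := ℤ → Module.End ℂ VTotal

/-- `x_0^+`, the coefficient of `y ^ (-1)` in
`X^+(y) = exp (∑ a_{-n}/[n] q^{-n/2} y^n) exp (-∑ a_n/[n] q^{-n/2} y^{-n}) e^α y^∂`,
where `r = q ^ (1/2)`. -/
def xPlusZero (q r : ℂ) : Module.End ℂ VTotal :=
  Finsupp.lsum ℂ fun j : ℤ =>
    Finsupp.lsingle (j + 2) ∘ₗ
      normalMode q (fun n => (qInt q n)⁻¹ * (r ^ n)⁻¹) (fun n => -((qInt q n)⁻¹ * (r ^ n)⁻¹))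
        (-1 - j)

/-- `Ψ_+(z) = exp (-∑ a_{-n}/[2n] q^{n/2} z^n) exp (∑ a_n/[2n] q^{-3n/2} z^{-n})
e^{-α/2} (-q z)^{-∂/2}`, where `r = q ^ (1/2)` and `s = (-q) ^ (1/2)`.
On the summand with `∂ = j` the last factor is `s ^ (-j) z ^ (-j/2)`. -/
def psiPlus (q r s : ℂ) : FormalField := fun m =>
  Finsupp.lsum ℂ fun j : ℤ =>
    if Even (m + j) then
      (s ^ (-j)) • (Finsupp.lsingle (j - 1) ∘ₗ
        normalMode q (fun n => -((qInt q (2 * n))⁻¹ * r ^ n))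
          (fun n => (qInt q (2 * n))⁻¹ * (r ^ (3 * n))⁻¹) ((m + j) / 2))
    else 0

/-- `Ψ_-(z) = [Ψ_+(z), x_0^+]_q = Ψ_+(z) x_0^+ - q x_0^+ Ψ_+(z)`. -/
def psiMinus (q r s : ℂ) : FormalField := fun m =>
  psiPlus q r s m * xPlusZero q r - q • (xPlusZero q r * psiPlus q r s m)

/-- The dual vertex operators `Ψ^*_ε(z) = Ψ_{-ε}(q² z)`, with `(q² z) ^ (1/2) = q z ^ (1/2)`.
The sign `ε` is `true` for `+` and `false` for `-`. -/
def psiStar (q r s : ℂ) (ε : Bool) : FormalField := fun m =>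
  (q ^ m) • (if ε then psiMinus q r s m else psiPlus q r s m)

/-! ### Formal series in two variables -/

/-- Formal series in `z ^ (±1/2)`, `w ^ (±1/2)` with coefficients in `VTotal`:
`T m n` is the coefficient of `z ^ (m/2) w ^ (n/2)`. -/
abbrev Series2 : Type := ℤ → ℤ → VTotal

/-- Multiplication by `z ^ (-1/2)`. -/
def zInvSqrt (T : Series2) : Series2 := fun m n => T (m + 1) n

/-- Multiplication by `w ^ (-1/2)`. -/
def wInvSqrt (T : Series2) : Series2 := fun m n => T m (n + 1)

/-- Multiplication by `g(w/z)`, `g` a power series. -/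
def mulWZ (g : PowerSeries ℂ) (T : Series2) : Series2 := fun m n =>
  ∑ᶠ k : ℕ, PowerSeries.coeff k g • T (m + 2 * k) (n - 2 * k)

/-- Multiplication by `g(z/w)`, `g` a power series. -/
def mulZW (g : PowerSeries ℂ) (T : Series2) : Series2 := fun m n =>
  ∑ᶠ k : ℕ, PowerSeries.coeff k g • T (m - 2 * k) (n + 2 * k)

/-- The formal delta function `δ(q² z, w) = ∑_{k + l = -1} (q² z) ^ k w ^ l`, the sum being over
`k, l ∈ ℤ + i/2`, multiplied by the vector `u`.  With `m = 2k`, `n = 2l` the coefficient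
`(q²) ^ k` is `q ^ m`. -/
def delta (q : ℂ) (i : Fin 2) (u : VTotal) : Series2 := fun m n =>
  if m + n = -2 ∧ m ≡ ((i : ℕ) : ℤ) [ZMOD 2] then (q ^ m) • u else 0

/-! ### Row vectors and the R-matrix

An element of `Hom ⊗ (ℂ² ⊗ ℂ²)^*` is the row vector of its components along
`v^*_{ε₁} ⊗ v^*_{ε₂}`, indexed by the pair `(ε₁, ε₂)`. -/

/-- The basis vector `v^*_ε` of `(ℂ²)^*`. -/
def vStar (ε : Bool) : Bool → ℂ := Pi.single ε 1

/-- The tensor product of two vectors of `(ℂ²)^*` in coordinates. -/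
def tensor (a b : Bool → ℂ) : Bool × Bool → ℂ := fun ε => a ε.1 * b ε.2

/-- `Ψ^{*(1)}(z) Ψ^{*(2)}(w) = ∑ Ψ^*_{ε₁}(z) Ψ^*_{ε₂}(w) ⊗ v^*_{ε₁} ⊗ v^*_{ε₂}`, applied to `v`. -/
def psiStar12 (q r s : ℂ) (v : VTotal) : Bool × Bool → Series2 := fun ε m n =>
  psiStar q r s ε.1 m (psiStar q r s ε.2 n v)

/-- `Ψ^{*(2)}(w) Ψ^{*(1)}(z) = ∑ Ψ^*_{ε₂}(w) Ψ^*_{ε₁}(z) ⊗ v^*_{ε₁} ⊗ v^*_{ε₂}`, applied to `v`. -/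
def psiStar21 (q r s : ℂ) (v : VTotal) : Bool × Bool → Series2 := fun ε m n =>
  psiStar q r s ε.2 n (psiStar q r s ε.1 m v)

/-- The R-matrix `R(x)`, its entries being expanded at `x = 0`; rows and columns are labelled by
`v_{ε₁} ⊗ v_{ε₂}`. -/
def Rmatrix (q : ℂ) : Matrix (Bool × Bool) (Bool × Bool) (PowerSeries ℂ) :=
  Matrix.of fun
    | (true, true), (true, true) => 1
    | (true, false), (true, false) => (1 - X) * C q * (1 - C (q ^ 2) * X)⁻¹
    | (true, false), (false, true) => C (1 - q ^ 2) * (1 - C (q ^ 2) * X)⁻¹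
    | (false, true), (true, false) => C (1 - q ^ 2) * X * (1 - C (q ^ 2) * X)⁻¹
    | (false, true), (false, true) => (1 - X) * C q * (1 - C (q ^ 2) * X)⁻¹
    | (false, false), (false, false) => 1
    | _, _ => 0

/-- The row vector `T` multiplied on the right by the matrix `M(z/w)`. -/
def rowMul (T : Bool × Bool → Series2)
    (M : Matrix (Bool × Bool) (Bool × Bool) (PowerSeries ℂ)) : Bool × Bool → Series2 := fun ε =>
  ∑ ε' : Bool × Bool, mulZW (M ε' ε) (T ε')

/-! ### The products are well defined -/

theorem normalMode_bddBelow (q : ℂ) (c d : ℕ → ℂ) (f : Fock) :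
    ∃ N : ℤ, ∀ r < N, normalMode q c d r f = 0 := by
  obtain ⟨N, hN⟩ := expPos_eventually_zero q d f
  refine ⟨-N, fun r hr => ?_⟩
  change (∑ᶠ l : ℕ, if 0 ≤ r + l then expNeg c (r + l).toNat (expPos q d l f) else 0) = 0
  have h : ∀ l : ℕ,
      (if 0 ≤ r + l then expNeg c (r + l).toNat (expPos q d l f) else 0) = 0 := fun l => by
    split_ifs with h
    · rw [hN l (by omega), map_zero]
    · rfl
  simp only [h, finsum_zero]

theorem psiPlus_bddBelow (q r s : ℂ) (v : VTotal) : ∃ N : ℤ, ∀ m < N, psiPlus q r s m v = 0 := by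
  induction v using Finsupp.induction_linear with
  | zero => exact ⟨0, fun m _ => map_zero _⟩
  | add f g hf hg =>
    obtain ⟨N, hN⟩ := hf
    obtain ⟨M, hM⟩ := hg
    refine ⟨min N M, fun l hl => ?_⟩
    rw [map_add, hN l (by omega), hM l (by omega), add_zero]
  | single j f =>
    obtain ⟨N, hN⟩ := normalMode_bddBelow q (fun n => -((qInt q (2 * n))⁻¹ * r ^ n))
          (fun n => (qInt q (2 * n))⁻¹ * (r ^ (3 * n))⁻¹) f
    refine ⟨2 * N - j, fun m hm => ?_⟩
    rw [psiPlus, Finsupp.lsum_single]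
    split_ifs with h
    · rw [LinearMap.smul_apply, LinearMap.comp_apply, hN _ (by omega), map_zero, smul_zero]
    · rfl

/-- On every vector, the powers of `z` in `Ψ^*_ε(z)` are bounded from below. -/
theorem psiStar_bddBelow (q r s : ℂ) (ε : Bool) (v : VTotal) :
    ∃ N : ℤ, ∀ m < N, psiStar q r s ε m v = 0 := by
  obtain ⟨N, hN⟩ := psiPlus_bddBelow q r s v
  obtain ⟨M, hM⟩ := psiPlus_bddBelow q r s (xPlusZero q r v)
  refine ⟨min N M, fun m hm => ?_⟩
  cases ε
  · simp [psiStar, hN m (by omega)]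
  · simp [psiStar, psiMinus, hN m (by omega), hM m (by omega)]

/-- The sum defining a coefficient of `g(z/w) T` is finite if the powers of `z` in `T` are
bounded from below, and then the same bound holds for `g(z/w) T`. -/
theorem mulZW_wellDefined (g : PowerSeries ℂ) (T : Series2) (N : ℤ)
    (hT : ∀ m n, m < N → T m n = 0) :
    (∀ m n, (Function.support fun k : ℕ =>
      PowerSeries.coeff k g • T (m - 2 * k) (n + 2 * k)).Finite) ∧
    ∀ m n, m < N → mulZW g T m n = 0 := by
  refine ⟨fun m n => ?_, fun m n hm => ?_⟩
  · refine (Set.finite_Iic (m - N).toNat).subset fun k hk => ?_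
    by_contra hlt
    simp only [Set.mem_Iic, not_le] at hlt
    exact hk (by simp only [hT (m - 2 * k) (n + 2 * k) (by omega), smul_zero])
  · have h : ∀ k : ℕ, PowerSeries.coeff k g • T (m - 2 * k) (n + 2 * k) = 0 := fun k => by
      rw [hT _ _ (by omega), smul_zero]
    simp only [mulZW, h, finsum_zero]

/-- The sum defining a coefficient of `g(w/z) T` is finite if the powers of `w` in `T` are
bounded from below. -/
theorem mulWZ_wellDefined (g : PowerSeries ℂ) (T : Series2) (N : ℤ)
    (hT : ∀ m n, n < N → T m n = 0) (m n : ℤ) :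
    (Function.support fun k : ℕ =>
      PowerSeries.coeff k g • T (m + 2 * k) (n - 2 * k)).Finite := by
  refine (Set.finite_Iic (n - N).toNat).subset fun k hk => ?_
  by_contra hlt
  simp only [Set.mem_Iic, not_le] at hlt
  exact hk (by simp only [hT (m + 2 * k) (n - 2 * k) (by omega), smul_zero])

end AffineSl2

end

open AffineSl2

/-!
# Commutation relations of the dual vertex operators of level one

All operators are built from vertex operators `V(z) = E₋(z) E₊(z)` on the Fock space, with a
creation exponential `E₋` and an annihilation exponential `E₊`.  Moving `E₊` past `E₋` produces a
scalar series, the *contraction* (`expPos_mul_expNeg`), which is deduced from first order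
differential equations for formal exponentials.  Instead of products with two normally ordered
factors, the proof uses the normal ordering `nOrd` of one vertex operator around an arbitrary
operator; `sum_vMode_mul_nOrd` and `sum_nOrd_mul_vMode` describe how it behaves in products.  The
contractions of `Ψ₊` with `X⁺` and of `X⁺` with itself are rational, and `α_ψ` is the inverse of the
contraction of `Ψ₊` with itself (`contraction_psi_psi`).  This gives four facts, in which `G` is
the symmetric product `z ^ (-1/2) α_ψ(w/z) Ψ₊(z) Ψ₊(w)` and `x₁⁺` the coefficient of `y ^ (-2)` in
`X⁺(y)`:

* `G` is symmetric in `z` and `w` (`psiPair_comm`, `sum_alphaPsi_psiPlus`);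
* `Ψ₊(z) x₁⁺ - q² z Ψ₊(z) x₀⁺ = q (x₁⁺ Ψ₊(z) - z x₀⁺ Ψ₊(z))` (`psiPlus_exchange`);
* `Ψ₊(z)` and `x₀⁺` satisfy the `q`-Serre relation (`psiPlus_serre`);
* at `w = q² z` the normally ordered product of the two fields `Ψ₊` is the inverse of `X⁺(w)`, and
  the resulting bracket with `x₀⁺`, `x₁⁺` is a delta function (`hasFinsum_psiPairBracket`).

The relation for `Ψ₊(z) Ψ₊(w)` is the symmetry of `G`.  By the Serre relation, `Ψ₋(z) Ψ₋(w)` is a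
combination of terms in which the two fields `Ψ₊` are adjacent, so that it is symmetric as well
(`psiSeries_true_true`).  For the mixed components let
`P(z, w) = z ^ (-1/2) α_ψ(w/z) Ψ₊(z) x₀⁺ Ψ₊(w)`.  The exchange relation expresses both
`(w - q² z) P(z, w)` and `(z - q² w) P(w, z)` through `G`, `x₀⁺` and `x₁⁺`, and eliminating `x₁⁺`
yields `(1 - q² x) P(z, w) = (x - q²) P(w, z) + q (1 - x) (x₀⁺ G + G x₀⁺)` with `x = z/w`.  Dividing
by `1 - q² x` leaves an ambiguity proportional to `δ(q² z/w)`; the last fact determines it, because for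
very negative powers of `w` the left hand side vanishes and the expansion of `(1 - q² x)⁻¹` turns
into a sum over all integers (`alphaMul_psiProd_xPlusZero_swap`).  The entries of the R-matrix then
come out of identities between rational functions of `x`.
-/

noncomputable section

namespace AffineSl2

open PowerSeries (C X mk)

/-! ### Exponentials of formal power series -/

section ExpSeries

variable {A : Type*} [Ring A]

/-- The Euler operator `t d/dt` on formal power series. -/
def euler (F : PowerSeries A) : PowerSeries A := mk fun n => n • PowerSeries.coeff n F

theorem coeff_euler (F : PowerSeries A) (n : ℕ) :
    PowerSeries.coeff n (euler F) = n • PowerSeries.coeff n F := PowerSeries.coeff_mk _ _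

theorem euler_add (F G : PowerSeries A) : euler (F + G) = euler F + euler G := by
  ext n; simp only [coeff_euler, map_add, smul_add]

theorem euler_sub (F G : PowerSeries A) : euler (F - G) = euler F - euler G := by
  ext n; simp only [coeff_euler, map_sub, smul_sub]

theorem euler_C (a : A) : euler (C a) = 0 := by
  ext n
  rw [coeff_euler, PowerSeries.coeff_C]
  split_ifs with h <;> simp [h]

theorem euler_X_pow (n : ℕ) : euler (X ^ n : PowerSeries A) = n • X ^ n := by
  ext m
  rw [coeff_euler, map_nsmul, PowerSeries.coeff_X_pow]
  split_ifs with h <;> simp [h]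

theorem euler_smul [Algebra ℂ A] (x : ℂ) (F : PowerSeries A) : euler (x • F) = x • euler F := by
  ext n; simp only [coeff_euler, PowerSeries.coeff_smul, smul_comm x]

theorem euler_mul (F G : PowerSeries A) : euler (F * G) = euler F * G + F * euler G := by
  ext n
  simp only [coeff_euler, map_add, PowerSeries.coeff_mul, Finset.smul_sum,
    ← Finset.sum_add_distrib]
  refine Finset.sum_congr rfl fun p hp => ?_
  rw [← Finset.HasAntidiagonal.mem_antidiagonal.mp hp, smul_mul_assoc, mul_smul_comm, add_smul]

theorem euler_pow (F : PowerSeries A) (h : Commute F (euler F)) (k : ℕ) :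
    euler (F ^ (k + 1)) = (k + 1) • (euler F * F ^ k) := by
  induction k with
  | zero => simp
  | succ k ih =>
    rw [pow_succ, euler_mul, ih, (h.pow_left (k + 1)).eq, smul_mul_assoc, mul_assoc, ← pow_succ,
      add_smul (k + 1) 1, one_smul]

theorem coeff_pow_eq_zero_of_lt (F : PowerSeries A) (h0 : PowerSeries.coeff 0 F = 0) (k : ℕ) :
    ∀ n < k, PowerSeries.coeff n (F ^ k) = 0 := by
  induction k with
  | zero => intro n hn; omega
  | succ k ih =>
    intro n hn
    rw [pow_succ, PowerSeries.coeff_mul]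
    refine Finset.sum_eq_zero fun p hp => ?_
    have hp' := Finset.HasAntidiagonal.mem_antidiagonal.mp hp
    by_cases h : p.2 = 0
    · rw [h, h0, mul_zero]
    · rw [ih p.1 (by omega), zero_mul]

theorem commute_of_commute_coeff {F G : PowerSeries A}
    (h : ∀ i j, Commute (PowerSeries.coeff i F) (PowerSeries.coeff j G)) : Commute F G := by
  ext n
  rw [PowerSeries.coeff_mul, PowerSeries.coeff_mul, ← Finset.Nat.sum_antidiagonal_swap]
  exact Finset.sum_congr rfl fun p _ => (h _ _).eq

theorem commute_euler {F G : PowerSeries A}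
    (h : ∀ i j, Commute (PowerSeries.coeff i F) (PowerSeries.coeff j G)) :
    Commute F (euler G) :=
  commute_of_commute_coeff fun i j => by
    rw [coeff_euler]; exact (h i j).smul_right _

variable [Algebra ℂ A]

theorem coeff_expSeries_of_lt (F : PowerSeries A) (h0 : PowerSeries.coeff 0 F = 0) {n N : ℕ}
    (h : n < N) : PowerSeries.coeff n (expSeries F) =
      ∑ k ∈ Finset.range N, ((Nat.factorial k : ℂ)⁻¹) • PowerSeries.coeff n (F ^ k) := by
  rw [expSeries, PowerSeries.coeff_mk]
  refine Finset.sum_subset (Finset.range_mono h) fun k _ hk => ?_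
  rw [coeff_pow_eq_zero_of_lt F h0 k n (by simpa using hk), smul_zero]

theorem coeff_zero_expSeries (F : PowerSeries A) : PowerSeries.coeff 0 (expSeries F) = 1 := by
  simp [expSeries]

/-- The differential equation `t d/dt exp F = (t dF/dt) exp F`. -/
theorem euler_expSeries (F : PowerSeries A) (h0 : PowerSeries.coeff 0 F = 0)
    (h : Commute F (euler F)) : euler (expSeries F) = euler F * expSeries F := by
  ext n
  have h1 : PowerSeries.coeff n (euler F * expSeries F) =
      ∑ k ∈ Finset.range n, ((Nat.factorial k : ℂ)⁻¹) •
        PowerSeries.coeff n (euler F * F ^ k) := by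
    simp only [PowerSeries.coeff_mul, Finset.smul_sum]
    rw [Finset.sum_comm]
    refine Finset.sum_congr rfl fun p hp => ?_
    have hp' := Finset.HasAntidiagonal.mem_antidiagonal.mp hp
    by_cases hz : p.1 = 0
    · simp [hz, coeff_euler]
    · rw [coeff_expSeries_of_lt F h0 (show p.2 < n by omega), Finset.mul_sum]
      exact Finset.sum_congr rfl fun k _ => by rw [mul_smul_comm]
  rw [h1, coeff_euler, expSeries, PowerSeries.coeff_mk, Finset.smul_sum, Finset.sum_range_succ']
  have h2 : n • ((Nat.factorial 0 : ℂ)⁻¹ • PowerSeries.coeff n (F ^ 0)) = 0 := by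
    rw [pow_zero, PowerSeries.coeff_one]
    split_ifs with hn <;> simp [hn]
  rw [h2, add_zero]
  refine Finset.sum_congr rfl fun k _ => ?_
  rw [smul_comm, ← coeff_euler, euler_pow F h, map_nsmul, ← Nat.cast_smul_eq_nsmul ℂ, smul_smul]
  congr 1
  rw [Nat.factorial_succ]
  have : ((k + 1 : ℕ) : ℂ) ≠ 0 := by exact_mod_cast Nat.succ_ne_zero k
  have h3 : (Nat.factorial k : ℂ) ≠ 0 := by exact_mod_cast Nat.factorial_ne_zero k
  push_cast at this ⊢
  field_simp

/-- A first order linear differential equation without constant term has at most one solution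
with given initial value. -/
theorem eq_zero_of_euler_eq_mul {G D : PowerSeries A} (hG : PowerSeries.coeff 0 G = 0)
    (h0 : PowerSeries.coeff 0 D = 0) (h : euler D = G * D) : D = 0 := by
  ext n
  rw [map_zero]
  induction n using Nat.strong_induction_on with
  | _ n ih =>
    by_cases hn : n = 0
    · rw [hn, h0]
    · have h1 := congrArg (PowerSeries.coeff n) h
      rw [coeff_euler, PowerSeries.coeff_mul, Finset.sum_eq_zero,
        ← Nat.cast_smul_eq_nsmul ℂ] at h1
      · exact (smul_eq_zero.mp h1).resolve_left (by exact_mod_cast hn)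
      · intro p hp
        have hp' := Finset.HasAntidiagonal.mem_antidiagonal.mp hp
        by_cases hz : p.1 = 0
        · rw [hz, hG, zero_mul]
        · rw [ih p.2 (by omega), mul_zero]

theorem eq_of_euler_eq_mul {G D E : PowerSeries A} (hG : PowerSeries.coeff 0 G = 0)
    (h0 : PowerSeries.coeff 0 D = PowerSeries.coeff 0 E) (hD : euler D = G * D)
    (hE : euler E = G * E) : D = E :=
  sub_eq_zero.mp <| eq_zero_of_euler_eq_mul hG (by rw [map_sub, h0, sub_self])
    (by rw [euler_sub, hD, hE, mul_sub])

theorem coeff_expSeries_mem (S : Subalgebra ℂ A) {F : PowerSeries A}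
    (h : ∀ i, PowerSeries.coeff i F ∈ S) (n : ℕ) : PowerSeries.coeff n (expSeries F) ∈ S := by
  have h1 : ∀ k n, PowerSeries.coeff n (F ^ k) ∈ S := by
    intro k
    induction k with
    | zero =>
      intro n
      rw [pow_zero, PowerSeries.coeff_one]
      split_ifs
      exacts [S.one_mem, S.zero_mem]
    | succ k ih =>
      intro n
      rw [pow_succ, PowerSeries.coeff_mul]
      exact S.sum_mem fun p _ => S.mul_mem (ih _) (h _)
  rw [expSeries, PowerSeries.coeff_mk]
  exact S.sum_mem fun k _ => S.smul_mem (h1 _ _) _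

theorem commute_coeff_expSeries {F : PowerSeries A} {y : A}
    (h : ∀ i, Commute y (PowerSeries.coeff i F)) (n : ℕ) :
    Commute y (PowerSeries.coeff n (expSeries F)) := by
  have h1 := coeff_expSeries_mem (Subalgebra.centralizer ℂ {y}) (F := F)
    (fun i => (Subalgebra.mem_centralizer_iff ℂ).mpr fun g hg => by
      rw [Set.mem_singleton_iff.mp hg]; exact (h i).eq) n
  exact (Subalgebra.mem_centralizer_iff ℂ).mp h1 y rfl

/-- `exp (F + G) = exp F exp G` for commuting coefficients: both sides solve the same differential
equation. -/
theorem expSeries_add {F G : PowerSeries A} (hF : PowerSeries.coeff 0 F = 0)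
    (hG : PowerSeries.coeff 0 G = 0)
    (hFF : ∀ i j, Commute (PowerSeries.coeff i F) (PowerSeries.coeff j F))
    (hFG : ∀ i j, Commute (PowerSeries.coeff i F) (PowerSeries.coeff j G))
    (hGG : ∀ i j, Commute (PowerSeries.coeff i G) (PowerSeries.coeff j G)) :
    expSeries (F + G) = expSeries F * expSeries G := by
  refine eq_of_euler_eq_mul (G := euler (F + G)) (by simp [coeff_euler]) ?_
    (euler_expSeries _ (by rw [map_add, hF, hG, add_zero]) (commute_euler fun i j => ?_)) ?_
  · simp [PowerSeries.coeff_mul, coeff_zero_expSeries]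
  · simp only [map_add]
    exact ((hFF i j).add_right (hFG i j)).add_left ((hFG j i).symm.add_right (hGG i j))
  · have h1 : Commute (expSeries F) (euler G) := (commute_of_commute_coeff fun i j => by
      rw [coeff_euler]
      exact ((commute_coeff_expSeries (y := PowerSeries.coeff i G)
        (fun k => (hFG k i).symm) j).smul_left i)).symm
    rw [euler_mul, euler_expSeries F hF (commute_euler hFF),
      euler_expSeries G hG (commute_euler hGG), euler_add, add_mul, ← mul_assoc (expSeries F),
      h1.eq, mul_assoc, mul_assoc]

/-- Substituting `u t` for `t` in an exponential. -/
theorem coeff_expSeries_scale {F G : PowerSeries A} (u : ℂ)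
    (h : ∀ n, PowerSeries.coeff n G = u ^ n • PowerSeries.coeff n F) (n : ℕ) :
    PowerSeries.coeff n (expSeries G) = u ^ n • PowerSeries.coeff n (expSeries F) := by
  have h1 : ∀ k n, PowerSeries.coeff n (G ^ k) = u ^ n • PowerSeries.coeff n (F ^ k) := by
    intro k
    induction k with
    | zero =>
      intro n
      rw [pow_zero, pow_zero, PowerSeries.coeff_one]
      split_ifs with hn <;> simp [hn]
    | succ k ih =>
      intro n
      rw [pow_succ, pow_succ, PowerSeries.coeff_mul, PowerSeries.coeff_mul, Finset.smul_sum]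
      refine Finset.sum_congr rfl fun p hp => ?_
      rw [ih, h, smul_mul_smul_comm, ← pow_add, Finset.HasAntidiagonal.mem_antidiagonal.mp hp]
  simp only [expSeries, PowerSeries.coeff_mk, Finset.smul_sum, h1]
  exact Finset.sum_congr rfl fun k _ => smul_comm _ _ _

theorem expSeries_zero : expSeries (0 : PowerSeries A) = 1 := by
  refine eq_of_euler_eq_mul (G := 0) (map_zero _) (by simp [coeff_zero_expSeries]) ?_ ?_
  · rw [euler_expSeries _ (map_zero _) (Commute.zero_left _)]
    congr 1; ext n; simp [coeff_euler]
  · rw [zero_mul, ← map_one C, euler_C]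

end ExpSeries

/-! ### Commuting annihilation past creation exponentials -/

/-- The scalar `[a_n, a_{-n}]`. -/
def bracketCoeff (q : ℂ) (n : ℕ) : ℂ :=
  qInt q (2 * n) / (n : ℂ) * ((q ^ n - (q ^ n)⁻¹) / (q - q⁻¹))

theorem commute_aNeg (m n : ℕ+) : Commute (aNeg m) (aNeg n) := by
  refine LinearMap.ext fun f => ?_
  simp only [aNeg, Module.End.mul_apply, LinearMap.mulLeft_apply]
  ring

theorem commute_aPos (q : ℂ) (m n : ℕ+) : Commute (aPos q m) (aPos q n) := by
  refine Commute.smul_left (Commute.smul_right (LinearMap.ext fun f => ?_) _) _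
  have h : ⁅(MvPolynomial.pderiv m : Derivation ℂ Fock Fock),
      (MvPolynomial.pderiv n : Derivation ℂ Fock Fock)⁆ = 0 := by
    refine MvPolynomial.derivation_ext (R := ℂ) fun i => ?_
    rw [Derivation.commutator_apply]
    simp [MvPolynomial.pderiv_X, Pi.single_apply, apply_ite]
  have h1 := DFunLike.congr_fun h f
  rw [Derivation.commutator_apply] at h1
  exact sub_eq_zero.mp h1

theorem aPos_mul_aNeg (q : ℂ) (m n : ℕ+) :
    aPos q m * aNeg n = aNeg n * aPos q m + if m = n then bracketCoeff q n • 1 else 0 := by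
  refine LinearMap.ext fun f => ?_
  simp only [aPos, aNeg, Module.End.mul_apply, LinearMap.mulLeft_apply, LinearMap.smul_apply,
    LinearMap.add_apply, Derivation.coeFn_coe, Derivation.leibniz, MvPolynomial.pderiv_X,
    Pi.single_apply, smul_eq_mul, smul_add]
  rw [mul_smul_comm]
  congr 1
  by_cases h : m = n
  · subst h; simp [bracketCoeff]
  · rw [if_neg (fun h' => h h'.symm), if_neg h]; simp

theorem coeff_zero_modeSeries (a : ℕ+ → Module.End ℂ Fock) (c : ℕ → ℂ) :
    PowerSeries.coeff 0 (modeSeries a c) = 0 := by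
  rw [modeSeries, PowerSeries.coeff_mk, dif_neg (lt_irrefl 0)]

theorem coeff_modeSeries (a : ℕ+ → Module.End ℂ Fock) (c : ℕ → ℂ) (n : ℕ+) :
    PowerSeries.coeff (n : ℕ) (modeSeries a c) = c n • a n := by
  rw [modeSeries, PowerSeries.coeff_mk, dif_pos n.pos]; rfl

theorem commute_coeff_modeSeries {a : ℕ+ → Module.End ℂ Fock} {y : Module.End ℂ Fock}
    (h : ∀ n, Commute y (a n)) (c : ℕ → ℂ) (i : ℕ) :
    Commute y (PowerSeries.coeff i (modeSeries a c)) := by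
  rw [modeSeries, PowerSeries.coeff_mk]
  split_ifs
  exacts [(h _).smul_right _, Commute.zero_right _]

theorem commute_coeff_coeff_modeSeries {a : ℕ+ → Module.End ℂ Fock}
    (h : ∀ m n, Commute (a m) (a n)) (c d : ℕ → ℂ) (i j : ℕ) :
    Commute (PowerSeries.coeff i (modeSeries a c)) (PowerSeries.coeff j (modeSeries a d)) :=
  commute_coeff_modeSeries (fun n => (commute_coeff_modeSeries (fun m => h n m) c i).symm) d j

theorem commute_coeff_coeff_expSeries {a : ℕ+ → Module.End ℂ Fock}
    (h : ∀ m n, Commute (a m) (a n)) (c d : ℕ → ℂ) (i j : ℕ) :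
    Commute (PowerSeries.coeff i (expSeries (modeSeries a c)))
      (PowerSeries.coeff j (expSeries (modeSeries a d))) :=
  commute_coeff_expSeries (fun m => (commute_coeff_expSeries
    (fun n => commute_coeff_coeff_modeSeries h d c m n) i).symm) j

theorem modeSeries_add (a : ℕ+ → Module.End ℂ Fock) (c d : ℕ → ℂ) :
    modeSeries a (fun n => c n + d n) = modeSeries a c + modeSeries a d := by
  ext1 n
  simp only [modeSeries, map_add, PowerSeries.coeff_mk]
  split_ifs <;> simp [add_smul]

theorem expSeries_modeSeries_add {a : ℕ+ → Module.End ℂ Fock}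
    (h : ∀ m n, Commute (a m) (a n)) (c d : ℕ → ℂ) :
    expSeries (modeSeries a fun n => c n + d n) =
      expSeries (modeSeries a c) * expSeries (modeSeries a d) := by
  rw [modeSeries_add]
  exact expSeries_add (coeff_zero_modeSeries _ _) (coeff_zero_modeSeries _ _)
    (commute_coeff_coeff_modeSeries h _ _) (commute_coeff_coeff_modeSeries h _ _)
    (commute_coeff_coeff_modeSeries h _ _)

/-- A single annihilation operator commuted past a creation exponential: `a_n` acts on the
exponential as a derivation. -/
theorem C_aPos_mul_expSeries (q : ℂ) (c : ℕ → ℂ) (n : ℕ+) :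
    C (aPos q n) * expSeries (modeSeries aNeg c) =
      expSeries (modeSeries aNeg c) * C (aPos q n) +
        (bracketCoeff q n * c n) • (X ^ (n : ℕ) * expSeries (modeSeries aNeg c)) := by
  set f := modeSeries aNeg c with hf
  set E := expSeries f with hE
  have hE' : euler E = euler f * E := euler_expSeries f (coeff_zero_modeSeries _ _)
    (commute_euler (commute_coeff_coeff_modeSeries commute_aNeg c c))
  have key : C (aPos q n) * euler f =
      euler f * C (aPos q n) + (bracketCoeff q n * c n) • ((n : ℕ) • X ^ (n : ℕ)) := by
    ext1 k
    rw [PowerSeries.coeff_C_mul, map_add, PowerSeries.coeff_mul_C, PowerSeries.coeff_smul,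
      map_nsmul, PowerSeries.coeff_X_pow, coeff_euler]
    rcases Nat.eq_zero_or_pos k with rfl | hk
    · have : 0 ≠ (n : ℕ) := n.pos.ne
      simp [this]
    · lift k to ℕ+ using hk
      rw [hf, coeff_modeSeries, mul_smul_comm, mul_smul_comm, aPos_mul_aNeg, smul_add, smul_add,
        smul_mul_assoc, smul_mul_assoc]
      congr 1
      by_cases hkn : n = k
      · subst hkn
        simp only [if_true, smul_smul]
        rw [smul_comm, mul_comm]
      · have : (k : ℕ) ≠ n := fun h => hkn (PNat.eq h.symm)
        simp [this, hkn]
  have key2 : ∀ a b e g : PowerSeries (Module.End ℂ Fock), a * e = e * a + b →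
      a * (e * g) = e * (a * g) + b * g := by
    intro a b e g h
    rw [← mul_assoc, h, add_mul, mul_assoc]
  rw [← sub_eq_zero]
  refine eq_zero_of_euler_eq_mul (G := euler f) (by simp [coeff_euler]) ?_ ?_
  · have h0 : PowerSeries.coeff 0 (X ^ (n : ℕ) * E) = 0 := by
      rw [PowerSeries.coeff_X_pow_mul', if_neg (by have := n.pos; omega)]
    rw [map_sub, map_add, PowerSeries.coeff_smul, h0, PowerSeries.coeff_C_mul,
      PowerSeries.coeff_mul_C, hE, coeff_zero_expSeries]
    simp
  · rw [euler_sub, euler_add, euler_smul, euler_mul, euler_mul, euler_mul, euler_C, euler_X_pow,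
      hE', key2 _ _ _ _ key, PowerSeries.X_pow_mul, mul_assoc (euler f) E (X ^ (n : ℕ)),
      ← PowerSeries.X_pow_mul (φ := E)]
    simp only [zero_mul, mul_zero, mul_sub, mul_add, zero_add, add_zero, smul_add, mul_assoc,
      smul_mul_assoc, mul_smul_comm]
    abel

/-- The scalar series `exp (∑ [a_n, a_{-n}] c n d n t ^ n)` relating the product of the
annihilation exponential with coefficients `d` and the creation exponential with coefficients `c`
to the product in the opposite order. -/
def contraction (q : ℂ) (c d : ℕ → ℂ) : PowerSeries ℂ :=
  expSeries (mk fun n => bracketCoeff q n * c n * d n)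

theorem bracketCoeff_zero (q : ℂ) : bracketCoeff q 0 = 0 := by simp [bracketCoeff]

theorem euler_contraction (q : ℂ) (c d : ℕ → ℂ) : euler (contraction q c d) =
    (mk fun n : ℕ => (n : ℂ) * (bracketCoeff q n * c n * d n)) * contraction q c d := by
  rw [contraction, euler_expSeries _ (by simp [bracketCoeff_zero]) (Commute.all _ _)]
  congr 1
  ext n
  simp [coeff_euler]

theorem coeff_zero_contraction (q : ℂ) (c d : ℕ → ℂ) :
    PowerSeries.coeff 0 (contraction q c d) = 1 := coeff_zero_expSeries _

/-- The generating function form of `expPos_mul_expNeg`, with values in power series in two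
variables: the inner variable belongs to the creation exponential. -/
theorem map_C_expSeries_mul (q : ℂ) (c d : ℕ → ℂ) :
    PowerSeries.map C (expSeries (modeSeries (aPos q) d)) * C (expSeries (modeSeries aNeg c)) =
      (mk fun i => PowerSeries.coeff i (contraction q c d) •
          (X ^ i : PowerSeries (Module.End ℂ Fock))) *
        (C (expSeries (modeSeries aNeg c)) *
          PowerSeries.map C (expSeries (modeSeries (aPos q) d))) := by
  set E := expSeries (modeSeries aNeg c) with hE
  set g := modeSeries (aPos q) d with hg
  set T := PowerSeries.map (C (R := Module.End ℂ Fock)) (expSeries g) with hT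
  set Γ : PowerSeries (PowerSeries (Module.End ℂ Fock)) :=
    mk fun i => PowerSeries.coeff i (contraction q c d) • X ^ i with hΓ
  set δ : PowerSeries (PowerSeries (Module.End ℂ Fock)) :=
    mk fun n => ((n : ℂ) * (bracketCoeff q n * c n * d n)) • X ^ n with hδ
  set G := PowerSeries.map (C (R := Module.End ℂ Fock)) (euler g) with hG
  have hT' : euler T = G * T := by
    rw [hT, hG, ← map_mul, ← euler_expSeries g (coeff_zero_modeSeries _ _)
      (commute_euler (commute_coeff_coeff_modeSeries (commute_aPos q) d d))]
    ext1 n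
    simp only [coeff_euler, PowerSeries.coeff_map, map_nsmul]
  have hΓ' : euler Γ = δ * Γ := by
    ext1 n
    have h := congrArg (PowerSeries.coeff n) (euler_contraction q c d)
    rw [coeff_euler, PowerSeries.coeff_mul] at h
    rw [coeff_euler, PowerSeries.coeff_mul, hΓ, PowerSeries.coeff_mk, ← smul_assoc, h,
      Finset.sum_smul]
    refine Finset.sum_congr rfl fun p hp => ?_
    rw [hδ, PowerSeries.coeff_mk, PowerSeries.coeff_mk, PowerSeries.coeff_mk, smul_mul_smul_comm,
      ← pow_add, Finset.HasAntidiagonal.mem_antidiagonal.mp hp]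
  have hc : ∀ F, Commute F Γ := fun F => commute_of_commute_coeff fun i j => by
    rw [hΓ, PowerSeries.coeff_mk]
    exact (PowerSeries.commute_X_pow _ _).smul_right _
  have hEG : C E * G = G * C E - δ * C E := by
    ext1 k
    rw [PowerSeries.coeff_C_mul, map_sub, PowerSeries.coeff_mul_C, PowerSeries.coeff_mul_C, hG,
      PowerSeries.coeff_map, hδ, PowerSeries.coeff_mk, coeff_euler, hg]
    rcases Nat.eq_zero_or_pos k with rfl | hk
    · simp
    · lift k to ℕ+ using hk
      have h := C_aPos_mul_expSeries q c k
      rw [← hE] at h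
      have h2 : ∀ x : ℂ, ∀ y : Module.End ℂ Fock, C (x • y) = x • C y := fun x y => by
        ext1 n; simp only [PowerSeries.coeff_C, PowerSeries.coeff_smul]; split_ifs <;> simp
      rw [coeff_modeSeries, map_nsmul, h2, smul_mul_assoc, mul_smul_comm, smul_mul_assoc,
        mul_smul_comm, h, smul_add, smul_add, smul_mul_assoc, ← Nat.cast_smul_eq_nsmul ℂ,
        ← Nat.cast_smul_eq_nsmul ℂ, smul_smul, smul_smul, smul_smul,
        show (k : ℂ) * d k * (bracketCoeff q k * c k) =
          (k : ℂ) * (bracketCoeff q k * c k * d k) by ring]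
      abel
  refine eq_of_euler_eq_mul (G := G) ?_ ?_ ?_ ?_
  · rw [hG, PowerSeries.coeff_map, coeff_euler, zero_smul, map_zero]
  · rw [PowerSeries.coeff_mul_C, PowerSeries.coeff_mul, Finset.HasAntidiagonal.antidiagonal_zero,
      Finset.sum_singleton, PowerSeries.coeff_C_mul, hΓ, PowerSeries.coeff_mk, hT,
      PowerSeries.coeff_map, coeff_zero_contraction, coeff_zero_expSeries]
    simp
  · rw [euler_mul, hT', euler_C, mul_zero, add_zero, mul_assoc]
  · rw [euler_mul, euler_mul, euler_C, hT', hΓ', zero_mul, zero_add, ← mul_assoc (C E) G, hEG,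
      ← mul_assoc G Γ, (hc G).eq, sub_mul, mul_sub, (hc δ).eq]
    simp only [mul_assoc]
    abel

/-- Moving an annihilation exponential past a creation exponential produces the contraction, here
in terms of coefficients. -/
theorem expPos_mul_expNeg (q : ℂ) (c d : ℕ → ℂ) (l k : ℕ) :
    expPos q d l * expNeg c k = ∑ p ∈ Finset.HasAntidiagonal.antidiagonal l,
      if p.1 ≤ k then PowerSeries.coeff p.1 (contraction q c d) •
        (expNeg c (k - p.1) * expPos q d p.2) else 0 := by
  have h := congrArg (fun F => PowerSeries.coeff k (PowerSeries.coeff l F))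
    (map_C_expSeries_mul q c d)
  simp only [PowerSeries.coeff_mul_C, PowerSeries.coeff_map, PowerSeries.coeff_C_mul] at h
  rw [expPos, expNeg, h, PowerSeries.coeff_mul, map_sum]
  refine Finset.sum_congr rfl fun p _ => ?_
  rw [PowerSeries.coeff_mk, smul_mul_assoc, PowerSeries.coeff_smul, PowerSeries.coeff_C_mul,
    PowerSeries.coeff_map, ← mul_assoc, PowerSeries.coeff_mul_C, PowerSeries.coeff_X_pow_mul']
  split_ifs
  · rfl
  · simp

/-! ### Normal ordering around an operator -/

/-- `expNeg` with its index extended by zero to the integers. -/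
def crea (c : ℕ → ℂ) (k : ℤ) : Module.End ℂ Fock := if 0 ≤ k then expNeg c k.toNat else 0

/-- `expPos` with its index extended by zero to the integers. -/
def anni (q : ℂ) (d : ℕ → ℂ) (l : ℤ) : Module.End ℂ Fock :=
  if 0 ≤ l then expPos q d l.toNat else 0

theorem crea_natCast (c : ℕ → ℂ) (k : ℕ) : crea c k = expNeg c k := by simp [crea]

theorem anni_natCast (q : ℂ) (d : ℕ → ℂ) (l : ℕ) : anni q d l = expPos q d l := by simp [anni]

theorem crea_of_neg (c : ℕ → ℂ) {k : ℤ} (h : k < 0) : crea c k = 0 := if_neg (not_le.mpr h)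

theorem anni_of_neg (q : ℂ) (d : ℕ → ℂ) {l : ℤ} (h : l < 0) : anni q d l = 0 :=
  if_neg (not_le.mpr h)

theorem commute_crea (c c' : ℕ → ℂ) (k k' : ℤ) : Commute (crea c k) (crea c' k') := by
  unfold crea
  split_ifs
  exacts [commute_coeff_coeff_expSeries commute_aNeg _ _ _ _, Commute.zero_right _,
    Commute.zero_left _, Commute.zero_left _]

theorem commute_anni (q : ℂ) (d d' : ℕ → ℂ) (l l' : ℤ) :
    Commute (anni q d l) (anni q d' l') := by
  unfold anni
  split_ifs
  exacts [commute_coeff_coeff_expSeries (commute_aPos q) _ _ _ _, Commute.zero_right _,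
    Commute.zero_left _, Commute.zero_left _]

theorem crea_crea_apply (c c' : ℕ → ℂ) (k k' : ℤ) (f : Fock) :
    crea c k (crea c' k' f) = crea c' k' (crea c k f) :=
  LinearMap.congr_fun (commute_crea c c' k k').eq f

theorem anni_anni_apply (q : ℂ) (d d' : ℕ → ℂ) (l l' : ℤ) (f : Fock) :
    anni q d l (anni q d' l' f) = anni q d' l' (anni q d l f) :=
  LinearMap.congr_fun (commute_anni q d d' l l').eq f

/-- All annihilation exponentials vanish on `f` beyond degree `L`. -/
def AnniBound (q : ℂ) (L : ℕ) (f : Fock) : Prop :=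
  ∀ (d : ℕ → ℂ) (l : ℤ), L < l → anni q d l f = 0

theorem exists_anniBound (q : ℂ) (f : Fock) : ∃ L, AnniBound q L f := by
  induction f using MvPolynomial.induction_on' with
  | monomial u a =>
    have hu : (MvPolynomial.monomial u a : Fock).IsWeightedHomogeneous (fun k : ℕ+ => (k : ℤ))
        (Finsupp.weight (fun k : ℕ+ => (k : ℤ)) u) :=
      MvPolynomial.isWeightedHomogeneous_monomial _ _ _ rfl
    refine ⟨(Finsupp.weight (fun k : ℕ+ => (k : ℤ)) u).toNat, fun d l hl => ?_⟩
    lift l to ℕ using by omega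
    rw [anni_natCast]
    have h := expPos_homogeneous q d l _ _ hu
    by_contra hne
    obtain ⟨e, he⟩ := MvPolynomial.ne_zero_iff.mp hne
    have h1 := h he
    have h2 : 0 ≤ Finsupp.weight (fun k : ℕ+ => (k : ℤ)) e := by
      rw [Finsupp.weight_apply]
      exact Finset.sum_nonneg fun k _ => by positivity
    omega
  | add f g hf hg =>
    obtain ⟨N, hN⟩ := hf
    obtain ⟨M, hM⟩ := hg
    refine ⟨max N M, fun d l hl => ?_⟩
    rw [map_add, hN d l (by omega), hM d l (by omega), add_zero]

theorem AnniBound.anni {q : ℂ} {L : ℕ} {f : Fock} (h : AnniBound q L f) (d : ℕ → ℂ) (l : ℤ) :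
    AnniBound q L (anni q d l f) := fun d' l' hl => by
  rw [anni_anni_apply, h d' l' hl, map_zero]

/-- Moving an annihilation coefficient past a creation coefficient. -/
theorem anni_mul_crea (q : ℂ) (c d : ℕ → ℂ) (l k : ℤ) (K : ℕ) (hK : k < K) :
    anni q d l * crea c k = ∑ i ∈ Finset.range K, PowerSeries.coeff i (contraction q c d) •
      (crea c (k - i) * anni q d (l - i)) := by
  by_cases hl : 0 ≤ l
  swap
  · rw [anni_of_neg q d (by omega), zero_mul, Finset.sum_eq_zero]
    intro i _
    rw [anni_of_neg q d (by omega), mul_zero, smul_zero]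
  by_cases hk : 0 ≤ k
  swap
  · rw [crea_of_neg c (by omega), mul_zero, Finset.sum_eq_zero]
    intro i _
    rw [crea_of_neg c (by omega), zero_mul, smul_zero]
  lift l to ℕ using hl
  lift k to ℕ using hk
  rw [anni_natCast, crea_natCast, expPos_mul_expNeg,
    Finset.Nat.sum_antidiagonal_eq_sum_range_succ_mk]
  have h1 : ∀ i ∈ Finset.range (l + 1), (if i ≤ k then
      PowerSeries.coeff i (contraction q c d) • (expNeg c (k - i) * expPos q d (l - i)) else 0) =
      PowerSeries.coeff i (contraction q c d) •
      (crea c ((k : ℤ) - i) * anni q d ((l : ℤ) - i)) := by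
    intro i hi
    have hi' := Finset.mem_range.mp hi
    split_ifs with h
    · rw [← Nat.cast_sub h, ← Nat.cast_sub (by omega : i ≤ l), anni_natCast, crea_natCast]
    · rw [crea_of_neg c (by omega), zero_mul, smul_zero]
  rw [Finset.sum_congr rfl h1]
  have h2 : ∀ N : ℕ, (l < N ∨ k < N) → ∑ i ∈ Finset.range N,
      PowerSeries.coeff i (contraction q c d) •
        (crea c ((k : ℤ) - i) * anni q d ((l : ℤ) - i)) =
      ∑ i ∈ Finset.range (l + K + 1), PowerSeries.coeff i (contraction q c d) •
        (crea c ((k : ℤ) - i) * anni q d ((l : ℤ) - i)) := by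
    intro N hN
    have h3 : ∀ i, (l < i ∨ k < i) → PowerSeries.coeff i (contraction q c d) •
        (crea c ((k : ℤ) - i) * anni q d ((l : ℤ) - i)) = 0 := by
      rintro i (hi | hi)
      · rw [anni_of_neg q d (by omega), mul_zero, smul_zero]
      · rw [crea_of_neg c (by omega), zero_mul, smul_zero]
    rcases le_total N (l + K + 1) with h | h
    · refine Finset.sum_subset (Finset.range_mono h) fun i _ hi => h3 i ?_
      have := Finset.mem_range.not.mp hi
      omega
    · refine (Finset.sum_subset (Finset.range_mono h) fun i _ hi => h3 i ?_).symm
      have := Finset.mem_range.not.mp hi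
      omega
  rw [h2 _ (Or.inl (Nat.lt_succ_self l)), ← h2 K (Or.inr (by exact_mod_cast hK))]

/-- Multiplication by `g` turns the contraction `γ` into `g' = g γ`. -/
theorem sum_anni_mul_crea (q : ℂ) (c d : ℕ → ℂ) {g g' : PowerSeries ℂ}
    (hg : g * contraction q c d = g') (l k : ℤ) (K : ℕ) (hK : k < K) :
    ∑ i ∈ Finset.range K, PowerSeries.coeff i g • (anni q d (l - i) * crea c (k - i)) =
      ∑ i ∈ Finset.range K, PowerSeries.coeff i g' • (crea c (k - i) * anni q d (l - i)) := by
  have h1 : ∀ i ∈ Finset.range K, PowerSeries.coeff i g • (anni q d (l - i) * crea c (k - i)) =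
      ∑ a ∈ Finset.range (K - i), (PowerSeries.coeff i g *
        PowerSeries.coeff a (contraction q c d)) •
          (crea c (k - (i + a : ℕ)) * anni q d (l - (i + a : ℕ))) := by
    intro i hi
    have hi' := Finset.mem_range.mp hi
    rw [anni_mul_crea q c d _ _ (K - i) (by omega), Finset.smul_sum]
    refine Finset.sum_congr rfl fun a _ => ?_
    rw [smul_smul, Nat.cast_add, sub_sub, sub_sub]
  rw [Finset.sum_congr rfl h1, ← Finset.sum_range_diag_flip K fun i a => (PowerSeries.coeff i g *
        PowerSeries.coeff a (contraction q c d)) •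
          (crea c (k - (i + a : ℕ)) * anni q d (l - (i + a : ℕ)))]
  refine Finset.sum_congr rfl fun n _ => ?_
  rw [← hg, PowerSeries.coeff_mul, Finset.Nat.sum_antidiagonal_eq_sum_range_succ_mk,
    Finset.sum_smul]
  refine Finset.sum_congr rfl fun i hi => ?_
  rw [Nat.add_sub_cancel' (Nat.lt_succ_iff.mp (Finset.mem_range.mp hi))]

theorem finite_support_nOrd (q : ℂ) (c d : ℕ → ℂ) (r : ℤ) (O : Module.End ℂ Fock) (f : Fock) :
    (Function.support fun l : ℤ => crea c (r + l) (O (anni q d l f))).Finite := by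
  obtain ⟨L, hL⟩ := exists_anniBound q f
  refine (Set.finite_Icc 0 (L : ℤ)).subset fun l hl => ?_
  by_contra hlt
  apply hl
  rw [Set.mem_Icc, not_and_or, not_le, not_le] at hlt
  rcases hlt with h | h
  · simp [anni_of_neg q d h]
  · simp [hL d l h]

/-- The coefficient of `z ^ r` in `E₋(z) O E₊(z)`, where `E₋(z)` and `E₊(z)` are the creation and
annihilation exponentials of a vertex operator `V(z) = E₋(z) E₊(z)`.  This is the normal ordering
of `V(z)` around the operator `O`. -/
def nOrd (q : ℂ) (c d : ℕ → ℂ) (r : ℤ) : Module.End ℂ Fock →ₗ[ℂ] Module.End ℂ Fock :=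
  LinearMap.mk₂ ℂ (fun O f => ∑ᶠ l : ℤ, crea c (r + l) (O (anni q d l f)))
    (fun O O' f => by
      rw [← finsum_add_distrib (finite_support_nOrd q c d r O f)
        (finite_support_nOrd q c d r O' f)]
      exact finsum_congr fun l => by rw [LinearMap.add_apply, map_add])
    (fun x O f => by
      rw [smul_finsum' x (finite_support_nOrd q c d r O f)]
      exact finsum_congr fun l => by rw [LinearMap.smul_apply, map_smul])
    (fun O f f' => by
      rw [← finsum_add_distrib (finite_support_nOrd q c d r O f)
        (finite_support_nOrd q c d r O f')]
      exact finsum_congr fun l => by simp only [map_add])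
    (fun x O f => by
      rw [smul_finsum' x (finite_support_nOrd q c d r O f)]
      exact finsum_congr fun l => by simp only [map_smul])

theorem nOrd_apply (q : ℂ) (c d : ℕ → ℂ) (r : ℤ) (O : Module.End ℂ Fock) (f : Fock) :
    nOrd q c d r O f = ∑ᶠ l : ℤ, crea c (r + l) (O (anni q d l f)) := rfl

theorem nOrd_apply_of_bound {q : ℂ} {L : ℕ} {f : Fock} (hL : AnniBound q L f) (c d : ℕ → ℂ)
    (r : ℤ) (O : Module.End ℂ Fock) :
    nOrd q c d r O f = ∑ l ∈ Finset.range (L + 1), crea c (r + l) (O (anni q d l f)) := by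
  rw [nOrd_apply, finsum_eq_sum_of_support_subset (s := (Finset.range (L + 1)).map
    Nat.castEmbedding), Finset.sum_map]
  · rfl
  · intro l hl
    by_contra hlt
    apply hl
    by_cases h0 : 0 ≤ l
    · lift l to ℕ using h0
      have : L < l := by
        by_contra h'
        exact hlt (by simpa using (by omega : l < L + 1))
      simp only [hL d l (by exact_mod_cast this), map_zero]
    · simp [anni_of_neg q d (not_le.mp h0)]

/-- The modes of the vertex operator with coefficients `c`, `d` on the Fock space. -/
abbrev vMode (q : ℂ) (c d : ℕ → ℂ) (r : ℤ) : Module.End ℂ Fock := nOrd q c d r 1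

theorem normalMode_eq_vMode (q : ℂ) (c d : ℕ → ℂ) (r : ℤ) :
    normalMode q c d r = vMode q c d r := by
  refine LinearMap.ext fun f => ?_
  obtain ⟨L, hL⟩ := exists_anniBound q f
  rw [nOrd_apply_of_bound hL]
  change (∑ᶠ l : ℕ, if 0 ≤ r + l then expNeg c (r + l).toNat (expPos q d l f) else 0) = _
  rw [finsum_eq_sum_of_support_subset (s := Finset.range (L + 1))]
  · refine Finset.sum_congr rfl fun l _ => ?_
    rw [anni_natCast, crea]
    split_ifs <;> simp
  · intro l hl
    by_contra hlt
    apply hl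
    have h := hL d l (by simp at hlt; exact_mod_cast hlt)
    rw [anni_natCast] at h
    simp [h]

theorem nOrd_comm (q : ℂ) (c d c' d' : ℕ → ℂ) (r t : ℤ) (O : Module.End ℂ Fock) :
    nOrd q c d r (nOrd q c' d' t O) = nOrd q c' d' t (nOrd q c d r O) := by
  refine LinearMap.ext fun f => ?_
  obtain ⟨L, hL⟩ := exists_anniBound q f
  simp only [nOrd_apply_of_bound hL, nOrd_apply_of_bound (hL.anni _ _), map_sum]
  rw [Finset.sum_comm]
  refine Finset.sum_congr rfl fun k _ => Finset.sum_congr rfl fun l _ => ?_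
  rw [crea_crea_apply, anni_anni_apply]

theorem nOrd_crea_mul (q : ℂ) (c d c' : ℕ → ℂ) (r k : ℤ) (O : Module.End ℂ Fock) :
    nOrd q c d r (crea c' k * O) = crea c' k * nOrd q c d r O := by
  refine LinearMap.ext fun f => ?_
  obtain ⟨L, hL⟩ := exists_anniBound q f
  simp only [nOrd_apply_of_bound hL, Module.End.mul_apply, map_sum]
  exact Finset.sum_congr rfl fun l _ => crea_crea_apply _ _ _ _ _

/-- Below a bound depending only on the vector, normally ordered modes vanish. -/
theorem nOrd_apply_eq_zero {q : ℂ} {L : ℕ} {f : Fock} (hL : AnniBound q L f) (c d : ℕ → ℂ)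
    {r : ℤ} (hr : r < -L) (O : Module.End ℂ Fock) : nOrd q c d r O f = 0 := by
  rw [nOrd_apply_of_bound hL]
  refine Finset.sum_eq_zero fun l hl => ?_
  have := Finset.mem_range.mp hl
  rw [crea_of_neg c (by omega), LinearMap.zero_apply]

theorem sum_nOrd_mul_crea (q : ℂ) (c d c' : ℕ → ℂ) {g g' : PowerSeries ℂ}
    (hg : g * contraction q c' d = g') (m k : ℤ) (K : ℕ) (hK : k < K) (O : Module.End ℂ Fock) :
    ∑ i ∈ Finset.range K, PowerSeries.coeff i g • (nOrd q c d (m + i) O * crea c' (k - i)) =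
      ∑ i ∈ Finset.range K, PowerSeries.coeff i g' • nOrd q c d (m + i) (O * crea c' (k - i)) := by
  refine LinearMap.ext fun f => ?_
  simp only [LinearMap.sum_apply, LinearMap.smul_apply, Module.End.mul_apply]
  -- after the shift of the summation variable both sides have the same creation coefficients
  have shift : ∀ (i : ℕ) (O' : Module.End ℂ Fock) (x : Fock), nOrd q c d (m + i) O' x =
      ∑ᶠ l : ℤ, crea c (m + l) (O' (anni q d (l - i) x)) := by
    intro i O' x
    rw [nOrd_apply, ← finsum_comp_equiv (Equiv.subRight (i : ℤ))]
    refine finsum_congr fun l => ?_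
    rw [Equiv.subRight_apply, show m + i + (l - i) = m + l by ring]
  have shiftfin : ∀ (i : ℕ) (O' : Module.End ℂ Fock) (x : Fock),
      (Function.support fun l : ℤ => crea c (m + l) (O' (anni q d (l - i) x))).Finite := by
    intro i O' x
    refine ((finite_support_nOrd q c d (m + i) O' x).preimage
      (f := Equiv.subRight (i : ℤ)) (Equiv.injective _).injOn).subset fun l hl => ?_
    rw [Set.mem_preimage, Function.mem_support, Equiv.subRight_apply,
      show m + i + (l - i) = m + l by ring]
    exact hl
  have expand : ∀ (h : PowerSeries ℂ) (O' : ℕ → Module.End ℂ Fock) (x : ℕ → Fock),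
      ∑ i ∈ Finset.range K, PowerSeries.coeff i h • nOrd q c d (m + i) (O' i) (x i) =
      ∑ᶠ l : ℤ, ∑ i ∈ Finset.range K, PowerSeries.coeff i h •
        crea c (m + l) (O' i (anni q d (l - i) (x i))) := by
    intro h O' x
    rw [finsum_sum_comm]
    · refine Finset.sum_congr rfl fun i _ => ?_
      rw [shift, smul_finsum' _ (shiftfin i _ _)]
    · intro i _
      refine (shiftfin i (O' i) (x i)).subset fun l hl h0 => hl ?_
      exact (congrArg _ h0).trans (smul_zero _)
  rw [expand g (fun _ => O) fun i => crea c' (k - i) f,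
    expand g' (fun i => O * crea c' (k - i)) fun _ => f]
  refine finsum_congr fun l => ?_
  have h := congrArg (fun T : Module.End ℂ Fock => crea c (m + l) (O (T f)))
    (sum_anni_mul_crea q c' d hg l k K hK)
  simpa only [LinearMap.sum_apply, LinearMap.smul_apply, Module.End.mul_apply, map_sum,
    map_smul] using h

/-- The product of `V(z)` and a normal ordering around `W(w)`: if `g γ = g'`, where `γ` is the
contraction of `V` and `W`, then `g(w/z) V(z) :W(w) O: = g'(w/z) :W(w) V(z) O:`. -/
theorem sum_vMode_mul_nOrd (q : ℂ) (c d c' d' : ℕ → ℂ) {g g' : PowerSeries ℂ}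
    (hg : g * contraction q c' d = g') (m n : ℤ) (O : Module.End ℂ Fock) (f : Fock) :
    ∃ K₀ : ℕ, ∀ K ≥ K₀,
      ∑ i ∈ Finset.range K, PowerSeries.coeff i g •
        vMode q c d (m + i) (nOrd q c' d' (n - i) O f) =
      ∑ i ∈ Finset.range K, PowerSeries.coeff i g' •
        nOrd q c' d' (n - i) (vMode q c d (m + i) * O) f := by
  obtain ⟨L, hL⟩ := exists_anniBound q f
  refine ⟨(n + L + 1).toNat, fun K hK => ?_⟩
  simp only [nOrd_apply_of_bound hL, map_sum, Finset.smul_sum]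
  rw [Finset.sum_comm, Finset.sum_comm (s := Finset.range K)]
  refine Finset.sum_congr rfl fun k hk => ?_
  have hk' := Finset.mem_range.mp hk
  have h := LinearMap.congr_fun (sum_nOrd_mul_crea q c d c' hg m (n + k) K (by omega) 1)
    (O (anni q d' k f))
  simp only [LinearMap.sum_apply, LinearMap.smul_apply, Module.End.mul_apply] at h
  have e : ∀ i : ℕ, n - i + k = n + k - i := fun i => by ring
  simp only [e, Module.End.mul_apply, h]
  refine Finset.sum_congr rfl fun i _ => ?_
  rw [one_mul, ← mul_one (crea c' (n + k - i)), nOrd_crea_mul, mul_one, Module.End.mul_apply]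

/-- The product of a normal ordering around `V(z)` with `W(w)`: if `g γ = g'`, where `γ` is the
contraction of `V` and `W`, then `g(w/z) :V(z) O: W(w) = g'(w/z) :V(z) O W(w):`. -/
theorem sum_nOrd_mul_vMode (q : ℂ) (c d c' d' : ℕ → ℂ) {g g' : PowerSeries ℂ}
    (hg : g * contraction q c' d = g') (m n : ℤ) (O : Module.End ℂ Fock) (f : Fock) :
    ∃ K₀ : ℕ, ∀ K ≥ K₀,
      ∑ i ∈ Finset.range K, PowerSeries.coeff i g •
        nOrd q c d (m + i) O (vMode q c' d' (n - i) f) =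
      ∑ i ∈ Finset.range K, PowerSeries.coeff i g' •
        nOrd q c d (m + i) (O * vMode q c' d' (n - i)) f := by
  obtain ⟨L, hL⟩ := exists_anniBound q f
  refine ⟨(n + L + 1).toNat, fun K hK => ?_⟩
  have h1 : ∀ i : ℕ, nOrd q c d (m + i) (O * vMode q c' d' (n - i)) f =
      ∑ k ∈ Finset.range (L + 1),
        nOrd q c d (m + i) (O * crea c' (n + k - i)) (anni q d' k f) := by
    intro i
    simp only [nOrd_apply_of_bound hL, nOrd_apply_of_bound (hL.anni _ _), Module.End.mul_apply,
      map_sum, Module.End.one_apply]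
    rw [Finset.sum_comm]
    refine Finset.sum_congr rfl fun k _ => Finset.sum_congr rfl fun l _ => ?_
    rw [anni_anni_apply, show n - i + k = n + k - i by ring]
  simp only [h1]
  simp only [vMode, nOrd_apply_of_bound hL, map_sum, Finset.smul_sum]
  rw [Finset.sum_comm, Finset.sum_comm (s := Finset.range K)]
  refine Finset.sum_congr rfl fun k hk => ?_
  have hk' := Finset.mem_range.mp hk
  have h := LinearMap.congr_fun (sum_nOrd_mul_crea q c d c' hg m (n + k) K (by omega) O)
    (anni q d' k f)
  simp only [LinearMap.sum_apply, LinearMap.smul_apply, Module.End.mul_apply] at h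
  have e : ∀ i : ℕ, n - i + k = n + k - i := fun i => by ring
  simp only [e, Module.End.one_apply, h]

/-! ### Rational contractions -/

theorem sum_range_coeff_one (K : ℕ) (hK : 1 ≤ K) (F : ℕ → Fock) :
    ∑ i ∈ Finset.range K, PowerSeries.coeff i (1 : PowerSeries ℂ) • F i = F 0 := by
  rw [Finset.sum_eq_single_of_mem 0 (Finset.mem_range.mpr hK)]
  · simp
  · intro i _ hi
    rw [PowerSeries.coeff_one, if_neg hi, zero_smul]

theorem sum_range_coeff_linear (u : ℂ) (K : ℕ) (hK : 2 ≤ K) (F : ℕ → Fock) :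
    ∑ i ∈ Finset.range K, PowerSeries.coeff i (1 - C u * X) • F i = F 0 - u • F 1 := by
  rw [← Finset.sum_subset (Finset.range_mono hK) (fun i _ hi => ?_)]
  · simp [Finset.sum_range_succ, PowerSeries.coeff_X, PowerSeries.coeff_one,
      PowerSeries.coeff_C_mul, sub_eq_add_neg]
  · have := Finset.mem_range.not.mp hi
    rw [map_sub, PowerSeries.coeff_one, PowerSeries.coeff_C_mul, PowerSeries.coeff_X,
      if_neg (by omega), if_neg (by omega), mul_zero, sub_zero, zero_smul]

theorem sum_range_coeff_quadratic (u : ℂ) (K : ℕ) (hK : 3 ≤ K) (F : ℕ → Fock) :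
    ∑ i ∈ Finset.range K, PowerSeries.coeff i ((1 - C u * X) * (1 - X)) • F i =
      F 0 - (1 + u) • F 1 + u • F 2 := by
  have e : ((1 - C u * X) * (1 - X) : PowerSeries ℂ) = 1 - C (1 + u) * X + C u * X ^ 2 := by
    rw [map_add, map_one]; ring
  rw [e, ← Finset.sum_subset (Finset.range_mono hK) (fun i _ hi => ?_)]
  · simp [Finset.sum_range_succ, PowerSeries.coeff_one, PowerSeries.coeff_C_mul,
      PowerSeries.coeff_X_pow, sub_eq_add_neg]
    module
  · have := Finset.mem_range.not.mp hi
    rw [map_add, map_sub, PowerSeries.coeff_one, PowerSeries.coeff_C_mul, PowerSeries.coeff_X,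
      PowerSeries.coeff_C_mul, PowerSeries.coeff_X_pow, if_neg (by omega), if_neg (by omega),
      if_neg (by omega), mul_zero, mul_zero, sub_zero, add_zero, zero_smul]

variable (q : ℂ) (c d c' d' : ℕ → ℂ) (u : ℂ) (m n : ℤ) (O : Module.End ℂ Fock)

/-- If the contraction is `(1 - u w/z)⁻¹`, then `(1 - u w/z) V(z) :W(w) O: = :W(w) V(z) O:`. -/
theorem vMode_mul_nOrd_of_simplePole (h : (1 - C u * X) * contraction q c' d = 1) :
    vMode q c d m * nOrd q c' d' n O - u • (vMode q c d (m + 1) * nOrd q c' d' (n - 1) O) =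
      nOrd q c' d' n (vMode q c d m * O) := by
  refine LinearMap.ext fun f => ?_
  obtain ⟨K, hK⟩ := sum_vMode_mul_nOrd q c d c' d' h m n O f
  have := hK (K + 2) (by omega)
  rw [sum_range_coeff_linear u (K + 2) (by omega), sum_range_coeff_one (K + 2) (by omega)] at this
  simpa using this

/-- If the contraction is `(1 - u w/z)⁻¹`, then `(1 - u w/z) :V(z) O: W(w) = :V(z) O W(w):`. -/
theorem nOrd_mul_vMode_of_simplePole (h : (1 - C u * X) * contraction q c' d = 1) :
    nOrd q c d m O * vMode q c' d' n - u • (nOrd q c d (m + 1) O * vMode q c' d' (n - 1)) =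
      nOrd q c d m (O * vMode q c' d' n) := by
  refine LinearMap.ext fun f => ?_
  obtain ⟨K, hK⟩ := sum_nOrd_mul_vMode q c d c' d' h m n O f
  have := hK (K + 2) (by omega)
  rw [sum_range_coeff_linear u (K + 2) (by omega), sum_range_coeff_one (K + 2) (by omega)] at this
  simpa using this

/-- If the contraction is `(1 - u w/z) (1 - w/z)`, then
`V(z) :W(w) O: = (1 - u w/z) (1 - w/z) :W(w) V(z) O:`. -/
theorem vMode_mul_nOrd_of_doubleZero (h : contraction q c' d = (1 - C u * X) * (1 - X)) :
    vMode q c d m * nOrd q c' d' n O = nOrd q c' d' n (vMode q c d m * O) -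
      (1 + u) • nOrd q c' d' (n - 1) (vMode q c d (m + 1) * O) +
      u • nOrd q c' d' (n - 2) (vMode q c d (m + 2) * O) := by
  refine LinearMap.ext fun f => ?_
  obtain ⟨K, hK⟩ := sum_vMode_mul_nOrd q c d c' d' (g := 1) (by rw [one_mul, h]) m n O f
  have := hK (K + 3) (by omega)
  rw [sum_range_coeff_quadratic u (K + 3) (by omega),
    sum_range_coeff_one (K + 3) (by omega)] at this
  simpa using this

/-- If the contraction is `((1 - u w/z) (1 - w/z))⁻¹`, then
`(1 - u w/z) (1 - w/z) V(z) W(w) = :W(w) V(z):`. -/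
theorem vMode_mul_vMode_of_doublePole
    (h : (1 - C u * X) * (1 - X) * contraction q c' d = 1) :
    vMode q c d m * vMode q c' d' n - (1 + u) • (vMode q c d (m + 1) * vMode q c' d' (n - 1)) +
      u • (vMode q c d (m + 2) * vMode q c' d' (n - 2)) = nOrd q c' d' n (vMode q c d m) := by
  refine LinearMap.ext fun f => ?_
  obtain ⟨K, hK⟩ := sum_vMode_mul_nOrd q c d c' d' h m n 1 f
  have := hK (K + 3) (by omega)
  rw [sum_range_coeff_quadratic u (K + 3) (by omega),
    sum_range_coeff_one (K + 3) (by omega)] at this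
  simpa using this

/-! ### The contractions of the vertex operators -/

theorem expSeries_mul_mk (p p' : ℕ → ℂ) (hp : p 0 = 0) (hp' : p' 0 = 0) :
    expSeries (mk p) * expSeries (mk p') = expSeries (mk fun n => p n + p' n) := by
  rw [← expSeries_add (by simpa using hp) (by simpa using hp') (fun _ _ => Commute.all _ _)
    (fun _ _ => Commute.all _ _) (fun _ _ => Commute.all _ _)]
  rfl

/-- `exp (∑ u ^ n t ^ n / n) = (1 - u t) ^ (-1)`. -/
theorem one_sub_mul_expSeries_log (u : ℂ) :
    (1 - C u * X) * expSeries (mk fun n : ℕ => u ^ n / (n : ℂ)) = 1 := by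
  set E := expSeries (mk fun n : ℕ => u ^ n / (n : ℂ)) with hE
  have hE' := euler_expSeries (mk fun n : ℕ => u ^ n / (n : ℂ)) (by simp) (Commute.all _ _)
  rw [← hE] at hE'
  have h1 : (1 - C u * X) * euler (mk fun n : ℕ => u ^ n / (n : ℂ)) = C u * X := by
    ext n
    rw [sub_mul, one_mul, map_sub, mul_assoc, PowerSeries.coeff_C_mul, PowerSeries.coeff_C_mul]
    rcases n with _ | n
    · simp [coeff_euler]
    · rw [PowerSeries.coeff_succ_X_mul, coeff_euler, coeff_euler, PowerSeries.coeff_mk,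
        PowerSeries.coeff_mk, PowerSeries.coeff_X]
      have : ((n : ℂ) + 1) ≠ 0 := by exact_mod_cast Nat.succ_ne_zero n
      rcases n with _ | n
      · simp
      · have h2 : ((n : ℂ) + 1) ≠ 0 := by exact_mod_cast Nat.succ_ne_zero n
        simp only [nsmul_eq_mul]
        push_cast at this ⊢
        simp only [mul_zero]
        field_simp
        ring
  have h3 : euler (C u * X : PowerSeries ℂ) = C u * X := by
    have := euler_X_pow (A := ℂ) 1
    rw [pow_one, one_smul] at this
    rw [euler_mul, euler_C, this, zero_mul, zero_add]
  have h4 : euler (1 : PowerSeries ℂ) = 0 := by rw [← map_one C, euler_C]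
  refine eq_of_euler_eq_mul (G := 0) (map_zero _) (by simp [PowerSeries.coeff_mul, hE,
    coeff_zero_expSeries]) ?_ (by rw [h4, zero_mul])
  rw [euler_mul, euler_sub, h3, h4, hE', ← mul_assoc, h1]
  ring

theorem expSeries_neg_log (u : ℂ) :
    expSeries (mk fun n : ℕ => -(u ^ n / (n : ℂ))) = 1 - C u * X := by
  have h := expSeries_mul_mk (fun n : ℕ => u ^ n / (n : ℂ)) (fun n : ℕ => -(u ^ n / (n : ℂ)))
    (by simp) (by simp)
  have h0 : (mk fun n : ℕ => u ^ n / (n : ℂ) + -(u ^ n / (n : ℂ))) = 0 := by ext n; simp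
  rw [h0, expSeries_zero] at h
  calc _ = (1 - C u * X) * expSeries (mk fun n : ℕ => u ^ n / (n : ℂ)) *
        expSeries (mk fun n : ℕ => -(u ^ n / (n : ℂ))) := by
          rw [one_sub_mul_expSeries_log, one_mul]
    _ = _ := by rw [mul_assoc, h, mul_one]

/-! ### The function `α_ψ` -/

theorem qPochhammer_eq (a p : ℂ) (hp : ‖p‖ < 1) :
    qPochhammer a p = (1 - C a * X) * qPochhammer (a * p) p := by
  have h : ∀ k : ℕ, (1 - C (a * p ^ (k + 1)) * X : PowerSeries ℂ) =
      1 - C (a * p * p ^ k) * X := fun k => by rw [pow_succ']; ring_nf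
  rw [qPochhammer, qPochhammer, tprod_eq_zero_mul', pow_zero, mul_one,
    tprod_congr h]
  exact (multipliable_qPochhammer (a * p) p hp).congr fun k => (h k).symm

theorem continuous_rescale (u : ℂ) :
    Continuous (PowerSeries.rescale u : PowerSeries ℂ →+* PowerSeries ℂ) := by
  refine continuous_iff_continuousAt.mpr fun f => ?_
  refine (PowerSeries.WithPiTopology.tendsto_iff_coeff_tendsto _ _ _ _).mpr fun n => ?_
  simp only [PowerSeries.coeff_rescale]
  exact (continuous_const.mul (PowerSeries.WithPiTopology.continuous_coeff ℂ n)).continuousAt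

theorem rescale_qPochhammer (u a p : ℂ) (hp : ‖p‖ < 1) :
    PowerSeries.rescale u (qPochhammer a p) = qPochhammer (a * u) p := by
  rw [qPochhammer, (multipliable_qPochhammer a p hp).map_tprod _ (continuous_rescale u),
    qPochhammer]
  refine tprod_congr fun k => ?_
  rw [map_sub, map_one, map_mul, PowerSeries.rescale_X]
  have : PowerSeries.rescale u (C (a * p ^ k)) = C (a * p ^ k) := by
    ext n
    rw [PowerSeries.coeff_rescale, PowerSeries.coeff_C]
    split_ifs with h <;> simp [h]
  rw [this, ← mul_assoc, ← map_mul]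
  ring_nf

theorem constantCoeff_qPochhammer (a p : ℂ) (hp : ‖p‖ < 1) :
    PowerSeries.constantCoeff (qPochhammer a p) = 1 := by
  rw [qPochhammer, (multipliable_qPochhammer a p hp).map_tprod _
    (PowerSeries.WithPiTopology.continuous_constantCoeff ℂ)]
  simp

variable {q : ℂ}

theorem pow_ne_one_of_norm_lt_one (hq1 : ‖q‖ < 1) {n : ℕ} (hn : n ≠ 0) : q ^ n ≠ 1 := fun h => by
  have h1 := congrArg norm h
  rw [norm_pow, norm_one] at h1
  exact (pow_lt_one₀ (norm_nonneg q) hq1 hn).ne h1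

theorem one_add_pow_ne_zero (hq1 : ‖q‖ < 1) {n : ℕ} (hn : n ≠ 0) : 1 + q ^ n ≠ 0 := fun h => by
  refine pow_ne_one_of_norm_lt_one hq1 (n := n * 2) (by omega) ?_
  rw [pow_mul, show q ^ n = -1 by linear_combination h]
  norm_num

/-- The functional equation `α_ψ(x) α_ψ(q² x) = (1 - x) ^ (-1)`. -/
theorem alphaPsi_mul_rescale (hq1 : ‖q‖ < 1) :
    alphaPsi q * PowerSeries.rescale (q ^ 2) (alphaPsi q) * (1 - X) = 1 := by
  have hp : ‖q ^ 4‖ < 1 := by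
    rw [norm_pow]; exact pow_lt_one₀ (norm_nonneg q) hq1 (by norm_num)
  have h1 : alphaPsi q * qPochhammer 1 (q ^ 4) = qPochhammer (q ^ 2) (q ^ 4) := by
    rw [alphaPsi, mul_assoc, PowerSeries.inv_mul_cancel _ (by
      rw [constantCoeff_qPochhammer _ _ hp]; exact one_ne_zero), mul_one]
  have h2 := congrArg (PowerSeries.rescale (q ^ 2)) h1
  rw [map_mul, rescale_qPochhammer _ _ _ hp, rescale_qPochhammer _ _ _ hp, one_mul,
    ← pow_add] at h2
  have h3 := qPochhammer_eq 1 (q ^ 4) hp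
  rw [map_one, one_mul, one_mul] at h3
  have h4 : qPochhammer (q ^ 4) (q ^ 4) ≠ 0 := fun h => by
    have := constantCoeff_qPochhammer (q ^ 4) (q ^ 4) hp
    rw [h, map_zero] at this
    exact zero_ne_one this
  refine mul_right_cancel₀ h4 ?_
  rw [mul_assoc, ← h3, mul_right_comm, h1, mul_comm, h2, one_mul]

/-- `α_ψ(x) exp (-∑ x ^ n / (n (1 + q ^ (2 n)))) = 1`. -/
theorem alphaPsi_mul_expSeries (hq1 : ‖q‖ < 1) :
    alphaPsi q * expSeries (mk fun n : ℕ => -(1 / ((n : ℂ) * (1 + q ^ (2 * n))))) = 1 := by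
  set p : ℕ → ℂ := fun n => -(1 / ((n : ℂ) * (1 + q ^ (2 * n)))) with hpdef
  set Z := alphaPsi q * expSeries (mk p) with hZ
  have h1 : expSeries (mk p) * PowerSeries.rescale (q ^ 2) (expSeries (mk p)) = 1 - X := by
    have e : PowerSeries.rescale (q ^ 2) (expSeries (mk p)) =
        expSeries (mk fun n => (q ^ 2) ^ n * p n) := by
      ext n
      rw [PowerSeries.coeff_rescale]
      exact (coeff_expSeries_scale (q ^ 2) (fun n => by simp) n).symm
    rw [e, expSeries_mul_mk _ _ (by simp [hpdef]) (by simp [hpdef])]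
    have h := expSeries_neg_log 1
    rw [map_one, one_mul] at h
    rw [← h]
    congr 2
    funext n
    rcases Nat.eq_zero_or_pos n with rfl | hn
    · simp [hpdef]
    · have h2 := one_add_pow_ne_zero hq1 (n := 2 * n) (by omega)
      have h3 : (n : ℂ) ≠ 0 := by exact_mod_cast hn.ne'
      simp only [hpdef, ← pow_mul, one_pow]
      field_simp
      ring
  have h2 : Z * PowerSeries.rescale (q ^ 2) Z = 1 := by
    rw [hZ, map_mul]
    calc _ = alphaPsi q * PowerSeries.rescale (q ^ 2) (alphaPsi q) * (expSeries (mk p) *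
          PowerSeries.rescale (q ^ 2) (expSeries (mk p))) := by ring
      _ = 1 := by rw [h1, alphaPsi_mul_rescale hq1]
  -- hence `Z(x) = Z(q⁴ x)`, so that `Z` is constant
  have h3 : Z = PowerSeries.rescale (q ^ 2 * q ^ 2) Z := by
    have h := congrArg (PowerSeries.rescale (q ^ 2)) h2
    rw [map_mul, map_one, PowerSeries.rescale_rescale] at h
    calc Z = Z * (PowerSeries.rescale (q ^ 2) Z * PowerSeries.rescale (q ^ 2 * q ^ 2) Z) := by
          rw [h, mul_one]
      _ = _ := by rw [← mul_assoc, h2, one_mul]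
  have hp : ‖q ^ 4‖ < 1 := by
    rw [norm_pow]; exact pow_lt_one₀ (norm_nonneg q) hq1 (by norm_num)
  ext n
  rcases Nat.eq_zero_or_pos n with rfl | hn
  · rw [PowerSeries.coeff_zero_one, hZ, PowerSeries.coeff_zero_eq_constantCoeff_apply, map_mul,
      ← PowerSeries.coeff_zero_eq_constantCoeff_apply (expSeries _), coeff_zero_expSeries,
      alphaPsi, map_mul, PowerSeries.constantCoeff_inv, constantCoeff_qPochhammer _ _ hp,
      constantCoeff_qPochhammer _ _ hp]
    norm_num
  · have h := congrArg (PowerSeries.coeff n) h3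
    rw [PowerSeries.coeff_rescale, ← pow_add, ← pow_mul] at h
    have h4 := pow_ne_one_of_norm_lt_one hq1 (n := (2 + 2) * n) (by omega)
    have h5 : (1 - q ^ ((2 + 2) * n)) * PowerSeries.coeff n Z = 0 := by linear_combination h
    rw [PowerSeries.coeff_one, if_neg hn.ne']
    exact (mul_eq_zero.mp h5).resolve_left fun h' => h4 (by linear_combination -h')

/-! ### The coefficients of the vertex operators -/

/-- The creation coefficients of `Ψ₊(z)`, with `r = q ^ (1/2)`. -/
def psiNeg (q r : ℂ) (n : ℕ) : ℂ := -((qInt q (2 * n))⁻¹ * r ^ n)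

/-- The annihilation coefficients of `Ψ₊(z)`. -/
def psiPos (q r : ℂ) (n : ℕ) : ℂ := (qInt q (2 * n))⁻¹ * (r ^ (3 * n))⁻¹

/-- The creation coefficients of `X⁺(y)`. -/
def xNeg (q r : ℂ) (n : ℕ) : ℂ := (qInt q n)⁻¹ * (r ^ n)⁻¹

/-- The annihilation coefficients of `X⁺(y)`. -/
def xPos (q r : ℂ) (n : ℕ) : ℂ := -((qInt q n)⁻¹ * (r ^ n)⁻¹)

theorem q_sub_inv_ne_zero (hq0 : q ≠ 0) (hq1 : ‖q‖ < 1) : q - q⁻¹ ≠ 0 := fun h => by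
  refine pow_ne_one_of_norm_lt_one hq1 (n := 2) two_ne_zero ?_
  field_simp at h
  linear_combination h

theorem qInt_ne_zero (hq0 : q ≠ 0) (hq1 : ‖q‖ < 1) {n : ℕ} (hn : n ≠ 0) : qInt q n ≠ 0 := by
  refine div_ne_zero (fun h => ?_) (q_sub_inv_ne_zero hq0 hq1)
  have h1 : q ^ n ≠ 0 := pow_ne_zero _ hq0
  refine pow_ne_one_of_norm_lt_one hq1 (n := n * 2) (by omega) ?_
  field_simp at h
  rw [pow_mul]
  linear_combination h

theorem qInt_two_mul (hq0 : q ≠ 0) (n : ℕ) :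
    qInt q (2 * n) = qInt q n * ((1 + q ^ (2 * n)) / q ^ n) := by
  have h1 : q ^ n ≠ 0 := pow_ne_zero _ hq0
  rw [qInt, qInt, div_mul_eq_mul_div]
  congr 1
  rw [mul_comm 2 n, pow_mul]
  field_simp
  ring

theorem bracketCoeff_eq (q : ℂ) (n : ℕ) :
    bracketCoeff q n = qInt q (2 * n) * qInt q n / (n : ℂ) := by
  rw [bracketCoeff, qInt, qInt]; ring

theorem expSeries_mk_congr {p p' : ℕ → ℂ} (h0 : p 0 = p' 0) (h : ∀ n ≠ 0, p n = p' n) :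
    expSeries (mk p) = expSeries (mk p') := by
  congr 2
  funext n
  by_cases hn : n = 0
  · rw [hn, h0]
  · exact h n hn

variable {r : ℂ}

theorem contraction_psi_x (hq0 : q ≠ 0) (hq1 : ‖q‖ < 1) (hr : r ^ 2 = q) :
    (1 - C (q ^ 2)⁻¹ * X) * contraction q (xNeg q r) (psiPos q r) = 1 := by
  refine Eq.trans ?_ (one_sub_mul_expSeries_log (q ^ 2)⁻¹)
  rw [contraction]
  congr 1
  refine expSeries_mk_congr (by simp [bracketCoeff_zero]) fun n hn => ?_
  have h1 := qInt_ne_zero hq0 hq1 hn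
  have h2 := qInt_ne_zero hq0 hq1 (n := 2 * n) (by omega)
  have h3 : r ≠ 0 := fun h => hq0 (by rw [← hr, h]; ring)
  have h4 : (n : ℂ) ≠ 0 := by exact_mod_cast hn
  have h5 : ((q ^ 2)⁻¹) ^ n = (r ^ n)⁻¹ * (r ^ (3 * n))⁻¹ := by
    rw [← hr, inv_pow, ← mul_inv, ← pow_mul, ← pow_mul, ← pow_add]; congr 2; ring
  rw [bracketCoeff_eq, xNeg, psiPos, h5]
  field_simp

theorem contraction_x_psi (hq0 : q ≠ 0) (hq1 : ‖q‖ < 1) (hr : r ^ 2 = q) :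
    (1 - C 1 * X) * contraction q (psiNeg q r) (xPos q r) = 1 := by
  refine Eq.trans ?_ (one_sub_mul_expSeries_log 1)
  rw [contraction]
  congr 1
  refine expSeries_mk_congr (by simp [bracketCoeff_zero]) fun n hn => ?_
  have h1 := qInt_ne_zero hq0 hq1 hn
  have h2 := qInt_ne_zero hq0 hq1 (n := 2 * n) (by omega)
  have h3 : r ≠ 0 := fun h => hq0 (by rw [← hr, h]; ring)
  have h4 : (n : ℂ) ≠ 0 := by exact_mod_cast hn
  rw [bracketCoeff_eq, psiNeg, xPos, one_pow]
  field_simp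

/-- The product `[a_n, a_{-n}] c n d n` for two fields `X⁺`. -/
theorem bracketCoeff_mul_x (hq0 : q ≠ 0) (hq1 : ‖q‖ < 1) (hr : r ^ 2 = q) (n : ℕ) :
    bracketCoeff q n * xNeg q r n * xPos q r n =
      -(((q ^ 2)⁻¹) ^ n / (n : ℂ)) + -(1 ^ n / (n : ℂ)) := by
  rcases Nat.eq_zero_or_pos n with rfl | hn
  · simp [bracketCoeff_zero]
  have h1 := qInt_ne_zero hq0 hq1 hn.ne'
  have h3 : r ≠ 0 := fun h => hq0 (by rw [← hr, h]; ring)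
  have h4 : (n : ℂ) ≠ 0 := by exact_mod_cast hn.ne'
  have h5 : q ^ n = r ^ n * r ^ n := by rw [← hr, ← mul_pow, sq]
  have h6 : q ^ (2 * n) = q ^ n * q ^ n := by rw [two_mul, pow_add]
  have h7 : ((q ^ 2)⁻¹) ^ n = (q ^ n * q ^ n)⁻¹ := by rw [inv_pow, ← pow_mul, h6]
  rw [bracketCoeff_eq, xNeg, xPos, one_pow, qInt_two_mul hq0, h7, h6, h5]
  field_simp
  ring

theorem contraction_x_x (hq0 : q ≠ 0) (hq1 : ‖q‖ < 1) (hr : r ^ 2 = q) :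
    contraction q (xNeg q r) (xPos q r) = (1 - C (q ^ 2)⁻¹ * X) * (1 - X) := by
  have h := expSeries_neg_log 1
  rw [map_one, one_mul] at h
  rw [← expSeries_neg_log (q ^ 2)⁻¹, ← h, expSeries_mul_mk _ _ (by simp [-inv_pow]) (by simp),
    contraction]
  simp only [bracketCoeff_mul_x hq0 hq1 hr]

/-- The creation coefficients `-xNeg` belong to the inverse of `X⁺`, so the contraction with `X⁺`
is inverse to that of two fields `X⁺`. -/
theorem contraction_x_xInv (hq0 : q ≠ 0) (hq1 : ‖q‖ < 1) (hr : r ^ 2 = q) :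
    (1 - C (q ^ 2)⁻¹ * X) * (1 - X) * contraction q (fun n => -xNeg q r n) (xPos q r) = 1 := by
  rw [← contraction_x_x hq0 hq1 hr, contraction, contraction,
    expSeries_mul_mk _ _ (by simp [bracketCoeff_zero]) (by simp [bracketCoeff_zero]),
    ← expSeries_zero]
  congr 1
  ext n
  simp

theorem contraction_xInv_x (hq0 : q ≠ 0) (hq1 : ‖q‖ < 1) (hr : r ^ 2 = q) :
    (1 - C (q ^ 2)⁻¹ * X) * (1 - X) * contraction q (xNeg q r) (fun n => -xPos q r n) = 1 := by
  rw [← contraction_x_x hq0 hq1 hr, contraction, contraction,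
    expSeries_mul_mk _ _ (by simp [bracketCoeff_zero]) (by simp [bracketCoeff_zero]),
    ← expSeries_zero]
  congr 1
  ext n
  simp

/-- The function `α_ψ` cancels the contraction of two fields `Ψ₊`. -/
theorem contraction_psi_psi (hq0 : q ≠ 0) (hq1 : ‖q‖ < 1) (hr : r ^ 2 = q) :
    alphaPsi q * contraction q (psiNeg q r) (psiPos q r) = 1 := by
  rw [← alphaPsi_mul_expSeries hq1, contraction]
  congr 1
  refine expSeries_mk_congr (by simp [bracketCoeff_zero]) fun n hn => ?_
  have h1 := qInt_ne_zero hq0 hq1 hn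
  have h2 := one_add_pow_ne_zero hq1 (n := 2 * n) (by omega)
  have h3 : r ≠ 0 := fun h => hq0 (by rw [← hr, h]; ring)
  have h4 : (n : ℂ) ≠ 0 := by exact_mod_cast hn
  have h5 : q ^ n = r ^ n * r ^ n := by rw [← hr, ← mul_pow, sq]
  have h6 : r ^ (3 * n) = r ^ n * r ^ n * r ^ n := by rw [← pow_add, ← pow_add]; congr 1; ring
  rw [bracketCoeff_eq, psiNeg, psiPos, qInt_two_mul hq0, h6, h5]
  field_simp

/-- The fusion of `Ψ₊(q⁻² z)` and `Ψ₊(z)` has the creation coefficients of the inverse of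
`X⁺(z)`. -/
theorem psiNeg_fusion (hq0 : q ≠ 0) (hq1 : ‖q‖ < 1) (hr : r ^ 2 = q) (n : ℕ) :
    ((q ^ 2)⁻¹) ^ n * psiNeg q r n + psiNeg q r n = -xNeg q r n := by
  rcases Nat.eq_zero_or_pos n with rfl | hn
  · simp [psiNeg, xNeg, qInt]
  have h1 := qInt_ne_zero hq0 hq1 hn.ne'
  have h2 := one_add_pow_ne_zero hq1 (n := 2 * n) (by omega)
  have h3 : r ≠ 0 := fun h => hq0 (by rw [← hr, h]; ring)
  have h5 : q ^ n = r ^ n * r ^ n := by rw [← hr, ← mul_pow, sq]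
  have h6 : q ^ (2 * n) = q ^ n * q ^ n := by rw [two_mul, pow_add]
  have h7 : ((q ^ 2)⁻¹) ^ n = (q ^ n * q ^ n)⁻¹ := by rw [inv_pow, ← pow_mul, h6]
  rw [h6, h5] at h2
  set t := r ^ n with ht
  have ht0 : t ≠ 0 := pow_ne_zero _ h3
  replace h2 : 1 + t ^ 4 ≠ 0 := by convert h2 using 2; ring
  rw [psiNeg, xNeg, qInt_two_mul hq0, h7, h6, h5, ← ht,
    show t * t * (t * t) = t ^ 4 by ring]
  field_simp
  ring

theorem psiPos_fusion (hq0 : q ≠ 0) (hq1 : ‖q‖ < 1) (hr : r ^ 2 = q) (n : ℕ) :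
    (q ^ 2) ^ n * psiPos q r n + psiPos q r n = -xPos q r n := by
  rcases Nat.eq_zero_or_pos n with rfl | hn
  · simp [psiPos, xPos, qInt]
  have h1 := qInt_ne_zero hq0 hq1 hn.ne'
  have h2 := one_add_pow_ne_zero hq1 (n := 2 * n) (by omega)
  have h3 : r ≠ 0 := fun h => hq0 (by rw [← hr, h]; ring)
  have h5 : q ^ n = r ^ n * r ^ n := by rw [← hr, ← mul_pow, sq]
  have h6 : q ^ (2 * n) = q ^ n * q ^ n := by rw [two_mul, pow_add]
  have h7 : (q ^ 2) ^ n = q ^ n * q ^ n := by rw [← pow_mul, h6]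
  have h8 : r ^ (3 * n) = r ^ n * r ^ n * r ^ n := by rw [← pow_add, ← pow_add]; congr 1; ring
  rw [h6, h5] at h2
  set t := r ^ n with ht
  have ht0 : t ≠ 0 := pow_ne_zero _ h3
  replace h2 : 1 + t ^ 4 ≠ 0 := by convert h2 using 2; ring
  rw [psiPos, xPos, qInt_two_mul hq0, h7, h8, h6, h5, ← ht,
    show t * t * (t * t) = t ^ 4 by ring]
  field_simp
  ring

/-! ### Finite sums over the integers -/

/-- `F` has finite support and its sum is `x`. -/
def HasFinsum {M : Type*} [AddCommMonoid M] (F : ℤ → M) (x : M) : Prop :=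
  F.support.Finite ∧ ∑ᶠ a, F a = x

namespace HasFinsum

section Monoid

variable {M N : Type*} [AddCommMonoid M] [AddCommMonoid N]
  {F G : ℤ → M} {x y : M}

theorem add (hF : HasFinsum F x) (hG : HasFinsum G y) :
    HasFinsum (fun a => F a + G a) (x + y) :=
  ⟨(hF.1.union hG.1).subset (Function.support_add F G), by
    rw [finsum_add_distrib hF.1 hG.1, hF.2, hG.2]⟩

theorem comp_equiv (hF : HasFinsum F x) (e : ℤ ≃ ℤ) : HasFinsum (fun a => F (e a)) x :=
  ⟨hF.1.preimage e.injective.injOn, (finsum_comp_equiv e).trans hF.2⟩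

theorem zero : HasFinsum (fun _ : ℤ => (0 : M)) 0 :=
  ⟨by simp [Function.support_fun_zero], finsum_zero⟩

theorem sum {ι : Type*} (s : Finset ι) {F : ι → ℤ → M} {x : ι → M}
    (h : ∀ i ∈ s, HasFinsum (F i) (x i)) :
    HasFinsum (fun a => ∑ i ∈ s, F i a) (∑ i ∈ s, x i) := by
  classical
  induction s using Finset.induction_on with
  | empty => simpa using zero
  | insert i s hi ih =>
    simp only [Finset.sum_insert hi]
    exact (h i (Finset.mem_insert_self i s)).add
      (ih fun j hj => h j (Finset.mem_insert_of_mem hj))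

theorem of_subset (s : Finset ℤ) (h : ∀ a ∉ s, F a = 0) : HasFinsum F (∑ a ∈ s, F a) := by
  have : F.support ⊆ s := fun a ha => by_contra fun h' => ha (h a h')
  exact ⟨s.finite_toSet.subset this, finsum_eq_sum_of_support_subset F this⟩

/-- The sum is that over any sufficiently large interval `[-K, K)`. -/
theorem sum_range (hF : HasFinsum F x) :
    ∃ K₀ : ℕ, ∀ K ≥ K₀, ∑ i ∈ Finset.range K, (F i + F (-1 - i)) = x := by
  have key : ∀ K : ℕ, ∑ a ∈ Finset.Ico (-K : ℤ) K, F a =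
      ∑ i ∈ Finset.range K, (F i + F (-1 - i)) := by
    intro K
    induction K with
    | zero => simp
    | succ K ih =>
      have h : Finset.Ico (-(K + 1 : ℕ) : ℤ) (K + 1 : ℕ) =
          insert (K : ℤ) (insert (-1 - K : ℤ) (Finset.Ico (-K : ℤ) K)) := by
        ext a
        simp only [Finset.mem_Ico, Finset.mem_insert]
        omega
      rw [Finset.sum_range_succ, ← ih, h, Finset.sum_insert, Finset.sum_insert]
      · rw [add_comm (∑ a ∈ _, F a), add_assoc]
      · simp
      · simp only [Finset.mem_insert, Finset.mem_Ico]
        omega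
  obtain ⟨b, hb⟩ := (hF.1.image Int.natAbs).bddAbove
  refine ⟨b + 1, fun K hK => ?_⟩
  rw [← hF.2, ← key]
  refine (finsum_eq_sum_of_support_subset F fun a ha => ?_).symm
  have := hb (Set.mem_image_of_mem _ ha)
  rw [Finset.coe_Ico, Set.mem_Ico]
  omega

variable [Module ℂ M] [Module ℂ N]

theorem map (hF : HasFinsum F x) (T : M →ₗ[ℂ] N) : HasFinsum (fun a => T (F a)) (T x) := by
  refine ⟨hF.1.subset fun a ha h0 => ha (by simp only [h0, map_zero]), ?_⟩
  have h := AddMonoidHom.map_finsum (f := F) T.toAddMonoidHom hF.1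
  rw [← hF.2]
  exact h.symm

theorem smul (hF : HasFinsum F x) (c : ℂ) : HasFinsum (fun a => c • F a) (c • x) :=
  hF.map (c • LinearMap.id)

end Monoid

theorem sub {M : Type*} [AddCommGroup M] [Module ℂ M] {F G : ℤ → M} {x y : M}
    (hF : HasFinsum F x) (hG : HasFinsum G y) : HasFinsum (fun a => F a - G a) (x - y) := by
  simpa [sub_eq_add_neg] using hF.add (hG.smul (-1))

end HasFinsum

/-- A sequence in which each term is a fixed multiple of the next one, and which is eventually zero,
vanishes.  This replaces division by `1 - u x` in a space of two-sided formal series. -/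
theorem eq_zero_of_step {M : Type*} [AddCommGroup M] [Module ℂ M] {u : ℂ}
    {F : ℕ → M} (h : ∀ k, F k = u • F (k + 1)) {N : ℕ} (hN : ∀ k ≥ N, F k = 0) : F 0 = 0 := by
  have h1 : ∀ k, F 0 = u ^ k • F k := by
    intro k
    induction k with
    | zero => simp
    | succ k ih => rw [ih, h k, smul_smul, pow_succ]
  rw [h1 N, hN N le_rfl, smul_zero]

/-! ### Fusion of vertex operators -/

theorem crea_scale (c : ℕ → ℂ) (u : ℂ) (k : ℕ) :
    crea (fun n => u ^ n * c n) k = u ^ k • crea c k := by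
  rw [crea_natCast, crea_natCast, expNeg, expNeg]
  refine coeff_expSeries_scale u (fun n => ?_) k
  simp only [modeSeries, PowerSeries.coeff_mk]
  split_ifs <;> simp [mul_smul]

theorem anni_scale (q : ℂ) (d : ℕ → ℂ) (u : ℂ) (k : ℕ) :
    anni q (fun n => u ^ n * d n) k = u ^ k • anni q d k := by
  rw [anni_natCast, anni_natCast, expPos, expPos]
  refine coeff_expSeries_scale u (fun n => ?_) k
  simp only [modeSeries, PowerSeries.coeff_mk]
  split_ifs <;> simp [mul_smul]

theorem crea_add (c c' : ℕ → ℂ) (k : ℕ) : crea (fun n => c n + c' n) k =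
    ∑ i ∈ Finset.range (k + 1), crea c i * crea c' (k - i : ℤ) := by
  rw [crea_natCast, expNeg, expSeries_modeSeries_add commute_aNeg, PowerSeries.coeff_mul,
    Finset.Nat.sum_antidiagonal_eq_sum_range_succ_mk]
  refine Finset.sum_congr rfl fun i hi => ?_
  rw [← Nat.cast_sub (Nat.lt_succ_iff.mp (Finset.mem_range.mp hi)), crea_natCast, crea_natCast]
  rfl

theorem anni_add (q : ℂ) (d d' : ℕ → ℂ) (k : ℕ) : anni q (fun n => d n + d' n) k =
    ∑ i ∈ Finset.range (k + 1), anni q d i * anni q d' (k - i : ℕ) := by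
  rw [anni_natCast, expPos, expSeries_modeSeries_add (commute_aPos q), PowerSeries.coeff_mul,
    Finset.Nat.sum_antidiagonal_eq_sum_range_succ_mk]
  refine Finset.sum_congr rfl fun i hi => ?_
  rw [anni_natCast, anni_natCast]
  rfl

/-- The case of creation exponentials in `hasFinsum_nOrd`. -/
theorem hasFinsum_crea (c c' : ℕ → ℂ) (u : ℂ) (S : ℤ) (f : Fock) :
    HasFinsum (fun a : ℤ => u ^ a • crea c a (crea c' (S - a) f))
      (crea (fun n => u ^ n * c n + c' n) S f) := by
  by_cases hS : 0 ≤ S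
  · lift S to ℕ using hS
    have h := HasFinsum.of_subset (F := fun a : ℤ => u ^ a • crea c a (crea c' (S - a) f))
      ((Finset.range (S + 1)).map Nat.castEmbedding) fun a ha => by
        by_cases h0 : 0 ≤ a
        · lift a to ℕ using h0
          have : S < a := by
            by_contra h'
            exact ha (by simpa using (by omega : a < S + 1))
          simp only [crea_of_neg c' (show (S : ℤ) - a < 0 by omega), LinearMap.zero_apply,
            map_zero, smul_zero]
        · simp only [crea_of_neg c (not_le.mp h0), LinearMap.zero_apply, smul_zero]
    rw [crea_add]
    rw [Finset.sum_map] at h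
    convert h using 1
    rw [LinearMap.sum_apply]
    refine Finset.sum_congr rfl fun i _ => ?_
    rw [crea_scale, smul_mul_assoc, LinearMap.smul_apply, Module.End.mul_apply,
      Nat.castEmbedding_apply, zpow_natCast]
  · have h : ∀ a : ℤ, u ^ a • crea c a (crea c' (S - a) f) = 0 := fun a => by
      by_cases h0 : 0 ≤ a
      · rw [crea_of_neg c' (by omega), LinearMap.zero_apply, map_zero, smul_zero]
      · rw [crea_of_neg c (not_le.mp h0), LinearMap.zero_apply, smul_zero]
    simp only [h]
    rw [crea_of_neg _ (not_le.mp hS), LinearMap.zero_apply]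
    exact HasFinsum.zero

/-- Specializing the normally ordered product of `V(z)` and `W(w)` to `z = u w` gives the vertex
operator whose coefficients are the sums of those of `V(u w)` and of `W(w)`. -/
theorem hasFinsum_nOrd (q : ℂ) (c d c' d' : ℕ → ℂ) {u : ℂ} (hu : u ≠ 0) (T : ℤ) (f : Fock) :
    HasFinsum (fun a : ℤ => u ^ a • nOrd q c d a (vMode q c' d' (T - a)) f)
      (vMode q (fun n => u ^ n * c n + c' n) (fun n => u⁻¹ ^ n * d n + d' n) T f) := by
  obtain ⟨L, hL⟩ := exists_anniBound q f
  set c'' : ℕ → ℂ := fun n => u ^ n * c n + c' n with hc''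
  have h1 : HasFinsum (fun a : ℤ => u ^ a • nOrd q c d a (vMode q c' d' (T - a)) f)
      (∑ l ∈ Finset.range (L + 1), ∑ k ∈ Finset.range (L + 1),
        crea c'' (T + (l + k : ℕ)) ((u⁻¹ ^ l) • anni q d l (anni q d' k f))) := by
    have h2 : ∀ a : ℤ, u ^ a • nOrd q c d a (vMode q c' d' (T - a)) f =
        ∑ l ∈ Finset.range (L + 1), ∑ k ∈ Finset.range (L + 1),
          u ^ a • crea c (a + l) (crea c' (T - a + k) (anni q d l (anni q d' k f))) := by
      intro a
      simp only [nOrd_apply_of_bound hL, nOrd_apply_of_bound (hL.anni _ _), map_sum,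
        Finset.smul_sum, Module.End.one_apply, anni_anni_apply q d d']
    simp only [h2]
    refine HasFinsum.sum _ fun l _ => HasFinsum.sum _ fun k _ => ?_
    have h3 := ((hasFinsum_crea c c' u (T + (l + k : ℕ)) (anni q d l (anni q d' k f))).comp_equiv
      (Equiv.addRight (l : ℤ))).smul (u⁻¹ ^ l)
    convert h3 using 1
    · funext a
      rw [Equiv.coe_addRight, smul_smul, zpow_add₀ hu, zpow_natCast, inv_pow]
      congr 1
      · field_simp
      · congr 2; push_cast; ring_nf
    · rw [map_smul]
  convert h1 using 1
  set G : ℕ → ℕ → Fock := fun l k =>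
    crea c'' (T + (l + k : ℕ)) ((u⁻¹ ^ l) • anni q d l (anni q d' k f)) with hG
  have hG0 : ∀ l k, L < l ∨ L < k → G l k = 0 := by
    rintro l k (h | h)
    · simp only [hG, hL.anni d' k d l (by exact_mod_cast h), smul_zero, map_zero]
    · simp only [hG, hL d' k (by exact_mod_cast h), smul_zero, map_zero]
  have h2 : vMode q c'' (fun n => u⁻¹ ^ n * d n + d' n) T f =
      ∑ s ∈ Finset.range (2 * L + 2), ∑ i ∈ Finset.range (s + 1), G i (s - i) := by
    rw [nOrd_apply_of_bound (L := 2 * L + 1) fun d l hl => hL d l (by push_cast at hl; omega)]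
    refine Finset.sum_congr rfl fun s _ => ?_
    rw [anni_add, Module.End.one_apply, LinearMap.sum_apply, map_sum]
    refine Finset.sum_congr rfl fun i hi => ?_
    simp only [hG]
    rw [Nat.add_sub_cancel' (Nat.lt_succ_iff.mp (Finset.mem_range.mp hi)), anni_scale,
      smul_mul_assoc, LinearMap.smul_apply, Module.End.mul_apply]
  rw [h2, Finset.sum_range_diag_flip,
    ← Finset.sum_subset (Finset.range_mono (show L + 1 ≤ 2 * L + 2 by omega))]
  · refine Finset.sum_congr rfl fun l hl => ?_
    have hl' := Finset.mem_range.mp hl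
    refine (Finset.sum_subset (Finset.range_mono (by omega)) fun k _ hk => hG0 l k ?_).symm
    have := Finset.mem_range.not.mp hk
    omega
  · intro l _ hl
    have := Finset.mem_range.not.mp hl
    exact Finset.sum_eq_zero fun k _ => hG0 l k (by omega)

theorem expSeries_modeSeries_zero (a : ℕ+ → Module.End ℂ Fock) :
    expSeries (modeSeries a fun _ => 0) = 1 := by
  rw [← expSeries_zero]
  congr 1
  ext1 n
  simp [modeSeries]

theorem vMode_zero (q : ℂ) (T : ℤ) (f : Fock) :
    vMode q (fun _ => 0) (fun _ => 0) T f = if T = 0 then f else 0 := by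
  have hc : ∀ k : ℤ, crea (fun _ => 0) k = if k = 0 then 1 else 0 := by
    intro k
    by_cases hk : 0 ≤ k
    · lift k to ℕ using hk
      rw [crea_natCast, expNeg, expSeries_modeSeries_zero, PowerSeries.coeff_one]
      simp
    · rw [crea_of_neg _ (not_le.mp hk), if_neg (by omega)]
  have ha : ∀ k : ℕ, anni q (fun _ => 0) k = if k = 0 then 1 else 0 := by
    intro k
    rw [anni_natCast, expPos, expSeries_modeSeries_zero, PowerSeries.coeff_one]
  obtain ⟨L, hL⟩ := exists_anniBound q f
  rw [nOrd_apply_of_bound hL, Finset.sum_eq_single_of_mem 0 (by simp)]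
  · have := ha 0
    rw [if_pos rfl] at this
    rw [this, hc, Nat.cast_zero, add_zero]
    split_ifs <;> simp
  · intro k _ hk
    rw [ha, if_neg hk]
    simp

/-! ### Exchange relations on the Fock space -/

section FockRelations

variable {q r : ℂ}

/-- The modes of `Ψ₊` on the Fock space. -/
abbrev psiMode (q r : ℂ) (m : ℤ) : Module.End ℂ Fock := vMode q (psiNeg q r) (psiPos q r) m

/-- The modes of `X⁺` on the Fock space. -/
abbrev xMode (q r : ℂ) (m : ℤ) : Module.End ℂ Fock := vMode q (xNeg q r) (xPos q r) m

/-- Normal ordering around `X⁺`. -/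
abbrev xOrd (q r : ℂ) (m : ℤ) : Module.End ℂ Fock →ₗ[ℂ] Module.End ℂ Fock :=
  nOrd q (xNeg q r) (xPos q r) m

/-- The modes of the normally ordered product of `Ψ₊(z)` and `Ψ₊(w)`. -/
def psiPsi (q r : ℂ) (m n : ℤ) : Module.End ℂ Fock :=
  nOrd q (psiNeg q r) (psiPos q r) m (psiMode q r n)

theorem psiPsi_comm (m n : ℤ) : psiPsi q r m n = psiPsi q r n m := nOrd_comm _ _ _ _ _ _ _ _

theorem psiMode_mul_xOrd (hq0 : q ≠ 0) (hq1 : ‖q‖ < 1) (hr : r ^ 2 = q) (m n : ℤ)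
    (O : Module.End ℂ Fock) :
    psiMode q r m * xOrd q r n O - (q ^ 2)⁻¹ • (psiMode q r (m + 1) * xOrd q r (n - 1) O) =
      xOrd q r n (psiMode q r m * O) :=
  vMode_mul_nOrd_of_simplePole q _ _ _ _ _ m n O (contraction_psi_x hq0 hq1 hr)

theorem xMode_mul_psiMode (hq0 : q ≠ 0) (hq1 : ‖q‖ < 1) (hr : r ^ 2 = q) (m n : ℤ) :
    xMode q r m * psiMode q r n - xMode q r (m + 1) * psiMode q r (n - 1) =
      xOrd q r m (psiMode q r n) := by
  have h := vMode_mul_nOrd_of_simplePole q (xNeg q r) _ _ (psiPos q r) _ m n 1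
    (contraction_x_psi hq0 hq1 hr)
  rw [one_smul, mul_one] at h
  rw [h]
  exact nOrd_comm _ _ _ _ _ _ _ 1

theorem xOrd_mul_psiMode (hq0 : q ≠ 0) (hq1 : ‖q‖ < 1) (hr : r ^ 2 = q) (m n : ℤ)
    (O : Module.End ℂ Fock) :
    xOrd q r m O * psiMode q r n - xOrd q r (m + 1) O * psiMode q r (n - 1) =
      xOrd q r m (O * psiMode q r n) := by
  have h := nOrd_mul_vMode_of_simplePole q (xNeg q r) _ _ (psiPos q r) _ m n O
    (contraction_x_psi hq0 hq1 hr)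
  rwa [one_smul] at h

theorem xMode_mul_xOrd (hq0 : q ≠ 0) (hq1 : ‖q‖ < 1) (hr : r ^ 2 = q) (m n : ℤ)
    (O : Module.End ℂ Fock) :
    xMode q r m * xOrd q r n O = xOrd q r n (xMode q r m * O) -
      (1 + (q ^ 2)⁻¹) • xOrd q r (n - 1) (xMode q r (m + 1) * O) +
      (q ^ 2)⁻¹ • xOrd q r (n - 2) (xMode q r (m + 2) * O) :=
  vMode_mul_nOrd_of_doubleZero q _ _ _ _ _ m n O (contraction_x_x hq0 hq1 hr)

/-- The exchange relation `(1 - q⁻² y/z) Ψ₊(z) X⁺(y) = (1 - z/y) X⁺(y) Ψ₊(z)` on the Fock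
space. -/
theorem psiMode_xMode_exchange (hq0 : q ≠ 0) (hq1 : ‖q‖ < 1) (hr : r ^ 2 = q) (m n : ℤ) :
    psiMode q r m * xMode q r n - (q ^ 2)⁻¹ • (psiMode q r (m + 1) * xMode q r (n - 1)) =
      xMode q r n * psiMode q r m - xMode q r (n + 1) * psiMode q r (m - 1) := by
  rw [xMode_mul_psiMode hq0 hq1 hr, psiMode_mul_xOrd hq0 hq1 hr, mul_one]

/-- `α_ψ(w/z) Ψ₊(z) Ψ₊(w)` is the normally ordered product of the two fields. -/
theorem sum_alphaPsi_psiMode (hq0 : q ≠ 0) (hq1 : ‖q‖ < 1) (hr : r ^ 2 = q) (m n : ℤ)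
    (f : Fock) : ∃ K₀ : ℕ, ∀ K ≥ K₀,
      ∑ i ∈ Finset.range K, PowerSeries.coeff i (alphaPsi q) •
        psiMode q r (m + i) (psiMode q r (n - i) f) = psiPsi q r m n f := by
  obtain ⟨K₀, hK⟩ := sum_vMode_mul_nOrd q _ _ (psiNeg q r) (psiPos q r)
    (contraction_psi_psi hq0 hq1 hr) m n 1 f
  refine ⟨K₀ + 1, fun K h => ?_⟩
  rw [hK K (by omega), sum_range_coeff_one K (by omega), psiPsi_comm, psiPsi]
  simp

end FockRelations

/-! ### The Serre relation on the Fock space -/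

section Serre

theorem partialFraction_linear_algebra {V : Type*} [AddCommGroup V] [Module ℂ V] {u : ℂ}
    {W W' J J' J₁ J₁' I I₁ I₂ I₁' I₂'' N N₁ : V}
    (e1 : W - u • W' = I - (1 + u) • I₁' + u • I₂'') (e2 : J - u • J' = N)
    (e3 : J₁ - u • J₁' = N₁) (e4 : I - I₁ = N) (e5 : I₁' - I₂ = N₁) :
    W - (J - J₁ + (I₁ - I₂)) = u • (W' - (J' - J₁' + (I₁' - I₂''))) := by
  linear_combination (norm := module) e1 - e2 + e3 + e4 - e5

theorem serre_linear_algebra {V : Type*} [AddCommGroup V] [Module ℂ V] {u : ℂ}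
    {AXX W XXA Ra Rb Rc Ta Tb Tc J₁ J₂ I₁ I₂ I₃ I₄ N₁ N₂ : V}
    (x1 : AXX = Ra - (1 + u) • Rb + u • Ra) (hW : W = J₁ - J₂ + (I₃ - I₄))
    (x2 : XXA = Ta - (1 + u) • Tb + u • Ta) (r1 : Rc - u • Ra = J₁) (r2 : Rc - u • Rb = J₂)
    (t1 : Tc - Ta = I₁) (t2 : Tc - Tb = I₂) (i1 : I₂ - I₄ = N₁) (i2 : I₁ - I₃ = N₂)
    (hNN : N₂ = N₁) : u • AXX + (1 + u) • W + XXA = 0 := by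
  linear_combination (norm := module) u • x1 + (1 + u) • hW + x2 +
    (1 + u) • (r2 - r1 + t2 - t1 + i1 - i2 - hNN)

variable {q r : ℂ}

/-- The product `X⁺(y₁) Ψ₊(z) X⁺(y₂)` in terms of the normally ordered products
`:X⁺(y₁) (Ψ₊(z) X⁺(y₂)):` and `:X⁺(y₂) (X⁺(y₁) Ψ₊(z)):`, each of which has a single pole.  This
is the partial fraction expansion
`(1 - ab) / ((1 - a) (1 - b)) = 1 / (1 - b) + a / (1 - a)` with `a = z/y₁`, `b = q⁻² y₂/z`. -/
theorem xMode_psiMode_xMode (hq0 : q ≠ 0) (hq1 : ‖q‖ < 1) (hr : r ^ 2 = q) (p₁ M p₂ : ℤ) :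
    xMode q r p₁ * (psiMode q r M * xMode q r p₂) =
      xOrd q r p₁ (psiMode q r M * xMode q r p₂) -
        xOrd q r (p₁ + 1) (psiMode q r M * xMode q r (p₂ - 1)) +
      (xOrd q r p₂ (xMode q r (p₁ + 1) * psiMode q r (M - 1)) -
        xOrd q r (p₂ - 1) (xMode q r (p₁ + 2) * psiMode q r (M - 1))) := by
  set J : ℤ → ℤ → ℤ → Module.End ℂ Fock := fun p₁ M p₂ =>
    xOrd q r p₁ (psiMode q r M * xMode q r p₂) with hJ
  set I : ℤ → ℤ → ℤ → Module.End ℂ Fock := fun p₁ M p₂ =>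
    xOrd q r p₂ (xMode q r p₁ * psiMode q r M) with hI
  set W : ℤ → ℤ → ℤ → Module.End ℂ Fock := fun p₁ M p₂ =>
    xMode q r p₁ * (psiMode q r M * xMode q r p₂) with hW
  set N : ℤ → ℤ → ℤ → Module.End ℂ Fock := fun p₁ M p₂ =>
    xOrd q r p₁ (xOrd q r p₂ (psiMode q r M)) with hN
  have hNJ : ∀ p₁ M p₂, J p₁ M p₂ - (q ^ 2)⁻¹ • J p₁ (M + 1) (p₂ - 1) = N p₁ M p₂ := by
    intro p₁ M p₂
    have h := congrArg (xOrd q r p₁) (psiMode_mul_xOrd hq0 hq1 hr M p₂ 1)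
    rwa [mul_one, map_sub, map_smul] at h
  have hNI : ∀ p₁ M p₂, I p₁ M p₂ - I (p₁ + 1) (M - 1) p₂ = N p₁ M p₂ := by
    intro p₁ M p₂
    have h := congrArg (xOrd q r p₂) (xMode_mul_psiMode hq0 hq1 hr p₁ M)
    rw [map_sub] at h
    simp only [hI, h, hN]
    exact nOrd_comm _ _ _ _ _ _ _ _
  have hWI : ∀ p₁ M p₂, W p₁ M p₂ - (q ^ 2)⁻¹ • W p₁ (M + 1) (p₂ - 1) =
      I p₁ M p₂ - (1 + (q ^ 2)⁻¹) • I (p₁ + 1) M (p₂ - 1) +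
        (q ^ 2)⁻¹ • I (p₁ + 2) M (p₂ - 2) := by
    intro p₁ M p₂
    have h := congrArg (xMode q r p₁ * ·) (psiMode_mul_xOrd hq0 hq1 hr M p₂ 1)
    simp only [mul_one, mul_sub, mul_smul_comm] at h
    simp only [hW, h, hI]
    exact xMode_mul_xOrd hq0 hq1 hr _ _ _
  -- the difference of both sides, multiplied by `1 - b`, vanishes
  set Φ : ℤ → ℤ → ℤ → Module.End ℂ Fock := fun p₁ M p₂ => W p₁ M p₂ -
    (J p₁ M p₂ - J (p₁ + 1) M (p₂ - 1) + (I (p₁ + 1) (M - 1) p₂ - I (p₁ + 2) (M - 1) (p₂ - 1)))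
    with hΦ
  have hstep : ∀ p₁ M p₂, Φ p₁ M p₂ = (q ^ 2)⁻¹ • Φ p₁ (M + 1) (p₂ - 1) := by
    intro p₁ M p₂
    have e1 := hWI p₁ M p₂
    have e2 := hNJ p₁ M p₂
    have e3 := hNJ (p₁ + 1) M (p₂ - 1)
    have e4 := hNI p₁ M p₂
    have e5 := hNI (p₁ + 1) M (p₂ - 1)
    simp only [hΦ]
    have a1 : p₁ + 1 + 1 = p₁ + 2 := by ring
    have a2 : p₂ - 1 - 1 = p₂ - 2 := by ring
    simp only [a1, a2, add_sub_cancel_right] at e1 e2 e3 e4 e5 ⊢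
    exact partialFraction_linear_algebra e1 e2 e3 e4 e5
  refine sub_eq_zero.mp (LinearMap.ext fun f => ?_)
  obtain ⟨L, hL⟩ := exists_anniBound q f
  have hvan : ∀ p₁ M p₂ : ℤ, p₂ < -L → Φ p₁ M p₂ f = 0 := by
    intro p₁ M p₂ hp
    have hx : ∀ (k : ℤ) (d : ℕ → ℂ) (l : ℕ), k < -L → xMode q r k (anni q d l f) = 0 :=
      fun k d l hk => nOrd_apply_eq_zero (hL.anni d l) _ _ hk _
    have h1 : W p₁ M p₂ f = 0 := by
      simp only [hW, Module.End.mul_apply, nOrd_apply_eq_zero hL _ _ hp, map_zero]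
    have h2 : ∀ p₁ p : ℤ, p < -L → J p₁ M p f = 0 := by
      intro p₁ p hp
      simp only [hJ]
      rw [nOrd_apply_of_bound hL]
      refine Finset.sum_eq_zero fun l _ => ?_
      rw [Module.End.mul_apply, hx p _ l hp, map_zero, map_zero]
    have h3 : ∀ p₁ M p : ℤ, p < -L → I p₁ M p f = 0 := fun p₁ M p hp =>
      nOrd_apply_eq_zero hL _ _ hp _
    simp only [hΦ, LinearMap.sub_apply, LinearMap.add_apply, h1, h2 _ _ hp,
      h2 _ _ (show p₂ - 1 < -L by omega), h3 _ _ _ hp, h3 _ _ _ (show p₂ - 1 < -L by omega)]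
    simp
  have h0 := eq_zero_of_step (u := (q ^ 2)⁻¹) (F := fun k : ℕ => Φ p₁ (M + k) (p₂ - k) f)
    (fun k => by
      rw [hstep, LinearMap.smul_apply, Nat.cast_succ, add_assoc, sub_sub])
    (N := (p₂ + L + 1).toNat) fun k hk => hvan _ _ _ (by omega)
  simp only [Nat.cast_zero, add_zero, sub_zero] at h0
  exact h0

/-- The `q`-Serre relation between `x₀⁺` and `Ψ₊(z)` on the Fock space, for the mode `p` of
`X⁺`; the shifts of the modes come from the zero modes. -/
theorem serre_fock (hq0 : q ≠ 0) (hq1 : ‖q‖ < 1) (hr : r ^ 2 = q) (M p : ℤ) :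
    (q ^ 2)⁻¹ • (psiMode q r (M + 2) * (xMode q r (p - 2) * xMode q r p)) +
      (1 + (q ^ 2)⁻¹) • (xMode q r (p - 1) * (psiMode q r (M + 1) * xMode q r p)) +
      xMode q r (p - 1) * (xMode q r (p + 1) * psiMode q r M) = 0 := by
  have hxx : ∀ m n : ℤ, xMode q r m * xMode q r n = xOrd q r n (xMode q r m) -
      (1 + (q ^ 2)⁻¹) • xOrd q r (n - 1) (xMode q r (m + 1)) +
      (q ^ 2)⁻¹ • xOrd q r (n - 2) (xMode q r (m + 2)) := fun m n => by
    have h := xMode_mul_xOrd hq0 hq1 hr m n 1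
    rwa [mul_one, mul_one, mul_one] at h
  have hsymm : ∀ m n : ℤ, xOrd q r m (xMode q r n) = xOrd q r n (xMode q r m) := fun m n =>
    nOrd_comm _ _ _ _ _ _ _ _
  have hR := fun p₁ p₂ : ℤ => psiMode_mul_xOrd hq0 hq1 hr (M + 1) p₁ (xMode q r p₂)
  have hT := fun p₁ p₂ : ℤ => xOrd_mul_psiMode hq0 hq1 hr p₂ (M + 1) (xMode q r p₁)
  have hW := xMode_psiMode_xMode hq0 hq1 hr (p - 1) (M + 1) p
  have hI : ∀ p₁ p₂ : ℤ, xOrd q r p₂ (xMode q r p₁ * psiMode q r (M + 1)) -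
      xOrd q r p₂ (xMode q r (p₁ + 1) * psiMode q r M) =
      xOrd q r p₁ (xOrd q r p₂ (psiMode q r (M + 1))) := fun p₁ p₂ => by
    have h := congrArg (xOrd q r p₂) (xMode_mul_psiMode hq0 hq1 hr p₁ (M + 1))
    rw [map_sub, add_sub_cancel_right] at h
    rw [h]
    exact nOrd_comm _ _ _ _ _ _ _ _
  have hNN : xOrd q r (p - 1) (xOrd q r p (psiMode q r (M + 1))) =
      xOrd q r p (xOrd q r (p - 1) (psiMode q r (M + 1))) := nOrd_comm _ _ _ _ _ _ _ _
  have i1 := hI p (p - 1)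
  have i2 := hI (p - 1) p
  have r1 := hR (p - 1) p
  have r2 := hR p (p - 1)
  have t1 := hT (p - 1) p
  have t2 := hT p (p - 1)
  have x1 := congrArg (psiMode q r (M + 2) * ·) (hxx (p - 2) p)
  have x2 := congrArg (· * psiMode q r M) (hxx (p - 1) (p + 1))
  simp only [mul_add, add_mul, mul_sub, sub_mul, mul_smul_comm, smul_mul_assoc] at x1 x2
  have e : ∀ a : ℤ, a + 1 + 1 = a + 2 := fun a => by ring
  have e2 : ∀ a : ℤ, a - 1 - 1 = a - 2 := fun a => by ring
  have e3 : ∀ a : ℤ, a - 1 + 2 = a + 1 := fun a => by ring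
  have e4 : ∀ a : ℤ, a + 1 - 2 = a - 1 := fun a => by ring
  have e5 : ∀ a : ℤ, a - 2 + 1 = a - 1 := fun a => by ring
  simp only [e, e2, e3, e4, e5, sub_add_cancel, add_sub_cancel_right] at i1 i2 r1 r2 t1 t2 x1 x2 hW
  rw [hsymm p (p - 2)] at x1
  rw [hsymm p (p - 1)] at r2 t1
  rw [hsymm (p + 1) (p - 1)] at t1 x2
  rw [mul_assoc] at x2
  exact serre_linear_algebra x1 hW x2 r1 r2 t1 t2 i1 i2 hNN

end Serre

/-! ### The residue of the fused vertex operator -/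

section Residue

variable {q r : ℂ}

/-- The modes of the vertex operator inverse to `X⁺`. -/
abbrev xInvMode (q r : ℂ) (m : ℤ) : Module.End ℂ Fock :=
  vMode q (fun n => -xNeg q r n) (fun n => -xPos q r n) m

/-- The normally ordered product of `Ψ₊(z)` and `Ψ₊(w)` becomes the inverse of `X⁺(w)` at
`w = q² z`. -/
theorem hasFinsum_psiPsi (hq0 : q ≠ 0) (hq1 : ‖q‖ < 1) (hr : r ^ 2 = q) (M N : ℤ) (f : Fock) :
    HasFinsum (fun k : ℤ => q ^ (2 * k) • psiPsi q r (M - k) (N + k) f)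
      (q ^ (2 * M) • xInvMode q r (M + N) f) := by
  have h := hasFinsum_nOrd q (psiNeg q r) (psiPos q r) (psiNeg q r) (psiPos q r)
    (u := (q ^ 2)⁻¹) (by positivity) (M + N) f
  rw [inv_inv] at h
  simp only [psiNeg_fusion hq0 hq1 hr, psiPos_fusion hq0 hq1 hr] at h
  convert (h.comp_equiv (Equiv.subLeft M)).smul (q ^ (2 * M)) using 1
  funext k
  rw [Equiv.subLeft_apply, smul_smul, psiPsi, inv_zpow, ← zpow_natCast, ← zpow_mul, ← zpow_neg,
    ← zpow_add₀ hq0]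
  congr 2
  · push_cast; ring
  · congr 2; ring

/-- `X⁺` and its inverse cancel in the normally ordered product at equal arguments. -/
theorem hasFinsum_xOrd (q r : ℂ) (T : ℤ) (f : Fock) :
    HasFinsum (fun a : ℤ => xOrd q r a (xInvMode q r (T - a)) f) (if T = 0 then f else 0) := by
  have h := hasFinsum_nOrd q (xNeg q r) (xPos q r) (fun n => -xNeg q r n) (fun n => -xPos q r n)
    one_ne_zero T f
  simp only [one_zpow, one_smul, inv_one, one_pow, one_mul, add_neg_cancel, vMode_zero] at h
  exact h

/-- The difference of the expansions of `X⁺(y) X⁺(w)⁻¹` in the regions `|y| > |w|` and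
`|y| < |w|`, multiplied by `1 - q⁻² w/y` and `1 - q⁻² y/w` respectively, is a delta function in
`y/w`. -/
theorem xMode_xInvMode_residue (hq0 : q ≠ 0) (hq1 : ‖q‖ < 1) (hr : r ^ 2 = q) (p T : ℤ)
    (f : Fock) :
    xMode q r p (xInvMode q r T f) - (q ^ 2)⁻¹ • xMode q r (p + 1) (xInvMode q r (T - 1) f) +
      (xInvMode q r (T + 1) (xMode q r (p - 1) f) -
        (q ^ 2)⁻¹ • xInvMode q r (T + 2) (xMode q r (p - 2) f)) =
      if T + p = 0 then f else 0 := by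
  set Y : ℤ → ℤ → Fock := fun p T => xMode q r p (xInvMode q r T f) -
    (q ^ 2)⁻¹ • xMode q r (p + 1) (xInvMode q r (T - 1) f) with hY
  set Z : ℤ → ℤ → Fock := fun p T => xInvMode q r T (xMode q r p f) -
    (q ^ 2)⁻¹ • xInvMode q r (T + 1) (xMode q r (p - 1) f) with hZ
  set N : ℤ → ℤ → Fock := fun p T => xOrd q r p (xInvMode q r T) f with hN
  have hYN : ∀ p T, Y p T = N p T + Y (p + 1) (T - 1) := by
    intro p T
    have h := LinearMap.congr_fun (vMode_mul_vMode_of_doublePole q (xNeg q r) _ _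
      (fun n => -xPos q r n)
      _ p T (contraction_x_xInv hq0 hq1 hr)) f
    simp only [LinearMap.add_apply, LinearMap.sub_apply, LinearMap.smul_apply,
      Module.End.mul_apply] at h
    have hc : nOrd q (fun n => -xNeg q r n) (fun n => -xPos q r n) T (xMode q r p) =
      xOrd q r p (xInvMode q r T) := nOrd_comm _ _ _ _ _ _ _ _
    rw [hc] at h
    simp only [hY, hN, ← h]
    rw [show p + 1 + 1 = p + 2 by ring, show T - 1 - 1 = T - 2 by ring]
    module
  have hZN : ∀ p T, Z p T = N p T + Z (p - 1) (T + 1) := by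
    intro p T
    have h := LinearMap.congr_fun (vMode_mul_vMode_of_doublePole q (fun n => -xNeg q r n) _ _
      (xPos q r) _ T p (contraction_xInv_x hq0 hq1 hr)) f
    simp only [LinearMap.add_apply, LinearMap.sub_apply, LinearMap.smul_apply,
      Module.End.mul_apply] at h
    simp only [hZ, hN, ← h]
    rw [show T + 1 + 1 = T + 2 by ring, show p - 1 - 1 = p - 2 by ring]
    module
  have hYs : ∀ K : ℕ, Y p T = ∑ i ∈ Finset.range K, N (p + i) (T - i) + Y (p + K) (T - K) := by
    intro K
    induction K with
    | zero => simp
    | succ K ih =>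
      rw [ih, Finset.sum_range_succ, hYN (p + K), ← add_assoc, Nat.cast_succ, ← add_assoc p,
        sub_sub T]
  have hZs : ∀ K : ℕ, Z (p - 1) (T + 1) =
      ∑ i ∈ Finset.range K, N (p + (-1 - i)) (T - (-1 - i)) + Z (p - 1 - K) (T + 1 + K) := by
    intro K
    induction K with
    | zero => simp
    | succ K ih =>
      rw [ih, Finset.sum_range_succ, hZN (p - 1 - K), ← add_assoc, Nat.cast_succ,
        show p + (-1 - (K : ℤ)) = p - 1 - K by ring, show T - (-1 - (K : ℤ)) = T + 1 + K by ring,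
        sub_sub (p - 1), add_assoc (T + 1)]
  have hfin := (hasFinsum_xOrd q r (T + p) f).comp_equiv (Equiv.addRight p)
  obtain ⟨K₀, hK₀⟩ := hfin.sum_range
  obtain ⟨L, hL⟩ := exists_anniBound q f
  set K := max K₀ (T.natAbs + p.natAbs + L + 3) with hK
  have h1 := hK₀ K (le_max_left _ _)
  have hbig : T.natAbs + p.natAbs + L + 3 ≤ K := le_max_right _ _
  have hY0 : Y (p + K) (T - K) = 0 := by
    simp only [hY]
    rw [nOrd_apply_eq_zero hL _ _ (show T - K < -L by omega),
      nOrd_apply_eq_zero hL _ _ (show T - K - 1 < -L by omega)]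
    simp
  have hZ0 : Z (p - 1 - K) (T + 1 + K) = 0 := by
    simp only [hZ]
    rw [nOrd_apply_eq_zero hL _ _ (show p - 1 - K < -L by omega),
      nOrd_apply_eq_zero hL _ _ (show p - 1 - K - 1 < -L by omega)]
    simp
  have h2 := congrArg₂ (· + ·) (hYs K) (hZs K)
  simp only [hY0, hZ0, add_zero, ← Finset.sum_add_distrib] at h2
  rw [← h1]
  refine Eq.trans ?_ (h2.trans ?_)
  · simp only [hY, hZ]
    rw [show T + 1 + 1 = T + 2 by ring, show p - 1 - 1 = p - 2 by ring]
  · refine Finset.sum_congr rfl fun i _ => ?_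
    simp only [hN, Equiv.coe_addRight]
    rw [show T + p - ((i : ℤ) + p) = T - i by ring, add_comm p,
      show T + p - (-1 - (i : ℤ) + p) = T - (-1 - i) by ring, add_comm p]

end Residue

/-! ### The operators on the level one modules -/

section Lift

variable {q r s : ℂ}

/-- The coefficient of `y ^ (-2)` in `X⁺(y)`. -/
def xPlusOne (q r : ℂ) : Module.End ℂ VTotal :=
  Finsupp.lsum ℂ fun j : ℤ => Finsupp.lsingle (j + 2) ∘ₗ xMode q r (-2 - j)

theorem xPlusZero_single (j : ℤ) (f : Fock) : xPlusZero q r (Finsupp.single j f) =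
    Finsupp.single (j + 2) (xMode q r (-1 - j) f) := by
  rw [xPlusZero, Finsupp.lsum_single, normalMode_eq_vMode]
  rfl

theorem xPlusOne_single (j : ℤ) (f : Fock) : xPlusOne q r (Finsupp.single j f) =
    Finsupp.single (j + 2) (xMode q r (-2 - j) f) := by
  rw [xPlusOne, Finsupp.lsum_single]
  rfl

theorem psiPlus_single_of_even {m j : ℤ} (h : Even (m + j)) (f : Fock) :
    psiPlus q r s m (Finsupp.single j f) =
      s ^ (-j) • Finsupp.single (j - 1) (psiMode q r ((m + j) / 2) f) := by
  rw [psiPlus, Finsupp.lsum_single, if_pos h, normalMode_eq_vMode]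
  rfl

theorem psiPlus_single_of_not_even {m j : ℤ} (h : ¬ Even (m + j)) (f : Fock) :
    psiPlus q r s m (Finsupp.single j f) = 0 := by
  rw [psiPlus, Finsupp.lsum_single, if_neg h]
  rfl

/-- The coefficient of `z ^ (m/2) w ^ (n/2)` in the symmetric product
`z ^ (-1/2) α_ψ(w/z) Ψ₊(z) Ψ₊(w)`. -/
def psiPair (q r s : ℂ) (m n : ℤ) : Module.End ℂ VTotal :=
  Finsupp.lsum ℂ fun j : ℤ =>
    if Even (m + j) ∧ Even (n + j) then
      s ^ (1 - 2 * j) • (Finsupp.lsingle (j - 2) ∘ₗ psiPsi q r ((m + j) / 2) ((n + j) / 2))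
    else 0

theorem psiPair_single_of_even {m n j : ℤ} (hm : Even (m + j)) (hn : Even (n + j)) (f : Fock) :
    psiPair q r s m n (Finsupp.single j f) =
      s ^ (1 - 2 * j) • Finsupp.single (j - 2) (psiPsi q r ((m + j) / 2) ((n + j) / 2) f) := by
  rw [psiPair, Finsupp.lsum_single, if_pos ⟨hm, hn⟩]
  rfl

theorem psiPair_single_of_not_even {m n j : ℤ} (h : ¬ (Even (m + j) ∧ Even (n + j))) (f : Fock) :
    psiPair q r s m n (Finsupp.single j f) = 0 := by
  rw [psiPair, Finsupp.lsum_single, if_neg h]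
  rfl

theorem psiPair_comm (m n : ℤ) : psiPair q r s m n = psiPair q r s n m := by
  simp only [psiPair, psiPsi_comm (q := q) (r := r) ((m + _) / 2), and_comm]

theorem linearMap_ext_single {T T' : Module.End ℂ VTotal}
    (h : ∀ j f, T (Finsupp.single j f) = T' (Finsupp.single j f)) : T = T' :=
  Finsupp.lhom_ext' fun j => LinearMap.ext fun f => h j f

/-- The product of two fields `Ψ₊` in terms of the symmetric product. -/
theorem sum_alphaPsi_psiPlus (hq0 : q ≠ 0) (hq1 : ‖q‖ < 1) (hr : r ^ 2 = q) (hs0 : s ≠ 0)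
    (m n : ℤ) (v : VTotal) : ∃ K₀ : ℕ, ∀ K ≥ K₀,
      ∑ k ∈ Finset.range K, PowerSeries.coeff k (alphaPsi q) •
        psiPlus q r s (m + 2 * k + 1) (psiPlus q r s (n - 2 * k) v) = psiPair q r s m n v := by
  induction v using Finsupp.induction_linear with
  | zero => exact ⟨0, fun K _ => by simp⟩
  | add f g hf hg =>
    obtain ⟨K₁, h₁⟩ := hf
    obtain ⟨K₂, h₂⟩ := hg
    refine ⟨max K₁ K₂, fun K hK => ?_⟩
    simp only [map_add, smul_add, Finset.sum_add_distrib, h₁ K (le_trans (le_max_left _ _) hK),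
      h₂ K (le_trans (le_max_right _ _) hK)]
  | single j f =>
    by_cases hn : Even (n + j)
    swap
    · refine ⟨0, fun K _ => ?_⟩
      rw [psiPair_single_of_not_even (fun h => hn h.2), Finset.sum_eq_zero]
      intro k _
      rw [psiPlus_single_of_not_even (by intro h; apply hn; rw [Int.even_iff] at h ⊢; omega),
        map_zero, smul_zero]
    by_cases hm : Even (m + j)
    swap
    · refine ⟨0, fun K _ => ?_⟩
      rw [psiPair_single_of_not_even (fun h => hm h.1), Finset.sum_eq_zero]
      intro k _
      rw [psiPlus_single_of_even (by rw [Int.even_iff] at hn ⊢; omega), map_smul,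
        psiPlus_single_of_not_even (by intro h; apply hm; rw [Int.even_iff] at h ⊢; omega),
        smul_zero, smul_zero]
    obtain ⟨K₀, hK⟩ := sum_alphaPsi_psiMode hq0 hq1 hr ((m + j) / 2) ((n + j) / 2) f
    refine ⟨K₀, fun K h => ?_⟩
    rw [psiPair_single_of_even hm hn, ← hK K h, Finsupp.single_finsetSum, Finset.smul_sum]
    refine Finset.sum_congr rfl fun k _ => ?_
    rw [psiPlus_single_of_even (by rw [Int.even_iff] at hn ⊢; omega), map_smul,
      psiPlus_single_of_even (by rw [Int.even_iff] at hm ⊢; omega), smul_smul, smul_smul,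
      mul_assoc, ← zpow_add₀ hs0, ← Finsupp.smul_single, smul_smul, mul_comm,
      show -j + -(j - 1) = 1 - 2 * j by ring, show j - 1 - 1 = j - 2 by ring,
      show (m + 2 * k + 1 + (j - 1)) / 2 = (m + j) / 2 + k by omega,
      show (n - 2 * k + j) / 2 = (n + j) / 2 - k by omega]

theorem zpow_neg_add_two (hs : s ^ 2 = -q) (hs0 : s ≠ 0) (j : ℤ) :
    s ^ (-(j + 2)) = -(q⁻¹ * s ^ (-j)) := by
  rw [neg_add, zpow_add₀ hs0, zpow_neg s 2, zpow_ofNat, hs, inv_neg]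
  ring

/-- The exchange relation `Ψ₊(z) x₁⁺ - q² z Ψ₊(z) x₀⁺ = q (x₁⁺ Ψ₊(z) - z x₀⁺ Ψ₊(z))`. -/
theorem psiPlus_exchange (hq0 : q ≠ 0) (hq1 : ‖q‖ < 1) (hr : r ^ 2 = q) (hs : s ^ 2 = -q)
    (m : ℤ) :
    psiPlus q r s m * xPlusOne q r - q ^ 2 • (psiPlus q r s (m - 2) * xPlusZero q r) =
      q • (xPlusOne q r * psiPlus q r s m - xPlusZero q r * psiPlus q r s (m - 2)) := by
  have hs0 : s ≠ 0 := fun h => hq0 (by rw [← neg_eq_zero, ← hs, h]; ring)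
  refine linearMap_ext_single fun j f => ?_
  simp only [LinearMap.sub_apply, LinearMap.smul_apply, Module.End.mul_apply, xPlusZero_single,
    xPlusOne_single]
  by_cases hm : Even (m + j)
  swap
  · rw [psiPlus_single_of_not_even hm,
      psiPlus_single_of_not_even (by intro h; apply hm; rw [Int.even_iff] at h ⊢; omega),
      psiPlus_single_of_not_even (by intro h; apply hm; rw [Int.even_iff] at h ⊢; omega),
      psiPlus_single_of_not_even (by intro h; apply hm; rw [Int.even_iff] at h ⊢; omega)]
    simp
  rw [psiPlus_single_of_even hm,
    psiPlus_single_of_even (j := j + 2) (by rw [Int.even_iff] at hm ⊢; omega),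
    psiPlus_single_of_even (j := j + 2) (by rw [Int.even_iff] at hm ⊢; omega),
    psiPlus_single_of_even (m := m - 2) (by rw [Int.even_iff] at hm ⊢; omega)]
  simp only [map_smul, xPlusZero_single, xPlusOne_single, zpow_neg_add_two hs hs0,
    show (m + (j + 2)) / 2 = (m + j) / 2 + 1 by omega,
    show (m - 2 + (j + 2)) / 2 = (m + j) / 2 by omega,
    show (m - 2 + j) / 2 = (m + j) / 2 - 1 by omega,
    show -2 - (j - 1) = -1 - j by ring, show -1 - (j - 1) = -1 - j + 1 by ring,
    show j + 2 - 1 = j - 1 + 2 by ring]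
  have h := congrArg (Finsupp.single (j - 1 + 2)) (LinearMap.congr_fun
    (psiMode_xMode_exchange hq0 hq1 hr ((m + j) / 2) (-1 - j)) f)
  simp only [LinearMap.sub_apply, LinearMap.smul_apply, Module.End.mul_apply,
    Finsupp.single_sub, ← Finsupp.smul_single, show -1 - j - 1 = -2 - j by ring] at h
  have h' := congrArg (fun x => (q * s ^ (-j)) • x) h
  rw [smul_sub, smul_sub, smul_smul] at h'
  have e : q * s ^ (-j) * (q ^ 2)⁻¹ = q⁻¹ * s ^ (-j) := by field_simp
  rw [e] at h'
  have e2 : q ^ 2 * q⁻¹ = q := by field_simp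
  have e3 : q ^ 2 * -(q⁻¹ * s ^ (-j)) = -(q * s ^ (-j)) := by rw [← e2]; field_simp
  rw [smul_smul, e3, smul_sub, smul_smul, smul_smul, ← h']
  module

/-- The `q`-Serre relation `Ψ₊(z) (x₀⁺)² - (q + q⁻¹) x₀⁺ Ψ₊(z) x₀⁺ + (x₀⁺)² Ψ₊(z) = 0`. -/
theorem psiPlus_serre (hq0 : q ≠ 0) (hq1 : ‖q‖ < 1) (hr : r ^ 2 = q) (hs : s ^ 2 = -q) (m : ℤ) :
    psiPlus q r s m * (xPlusZero q r * xPlusZero q r) -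
      (q + q⁻¹) • (xPlusZero q r * (psiPlus q r s m * xPlusZero q r)) +
      xPlusZero q r * (xPlusZero q r * psiPlus q r s m) = 0 := by
  have hs0 : s ≠ 0 := fun h => hq0 (by rw [← neg_eq_zero, ← hs, h]; ring)
  refine linearMap_ext_single fun j f => ?_
  simp only [LinearMap.sub_apply, LinearMap.add_apply, LinearMap.smul_apply, LinearMap.zero_apply,
    Module.End.mul_apply, xPlusZero_single]
  by_cases hm : Even (m + j)
  swap
  · rw [psiPlus_single_of_not_even hm,
      psiPlus_single_of_not_even (by intro h; apply hm; rw [Int.even_iff] at h ⊢; omega),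
      psiPlus_single_of_not_even (by intro h; apply hm; rw [Int.even_iff] at h ⊢; omega)]
    simp
  rw [psiPlus_single_of_even hm,
    psiPlus_single_of_even (j := j + 2 + 2) (by rw [Int.even_iff] at hm ⊢; omega),
    psiPlus_single_of_even (j := j + 2) (by rw [Int.even_iff] at hm ⊢; omega)]
  simp only [map_smul, xPlusZero_single, zpow_neg_add_two hs hs0,
    show (m + (j + 2 + 2)) / 2 = (m + j) / 2 + 2 by omega,
    show (m + (j + 2)) / 2 = (m + j) / 2 + 1 by omega,
    show -1 - (j + 2) = -1 - j - 2 by ring, show -1 - (j + 2 - 1) = -1 - j - 1 by ring,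
    show -1 - (j - 1 + 2) = -1 - j - 1 by ring, show -1 - (j - 1) = -1 - j + 1 by ring,
    show j + 2 + 2 - 1 = j + 3 by ring, show j + 2 - 1 + 2 = j + 3 by ring,
    show j - 1 + 2 + 2 = j + 3 by ring]
  have h := congrArg (fun x => s ^ (-j) • Finsupp.single (j + 3) x) (LinearMap.congr_fun
    (serre_fock hq0 hq1 hr ((m + j) / 2) (-1 - j)) f)
  simp only [LinearMap.add_apply, LinearMap.smul_apply, Module.End.mul_apply, LinearMap.zero_apply,
    Finsupp.single_add, ← Finsupp.smul_single, Finsupp.single_zero, smul_zero, smul_add,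
    smul_smul] at h
  rw [smul_smul, ← h]
  have e1 : -(q⁻¹ * -(q⁻¹ * s ^ (-j))) = s ^ (-j) * (q ^ 2)⁻¹ := by field_simp
  have e2 : (q + q⁻¹) * -(q⁻¹ * s ^ (-j)) = -(s ^ (-j) * (1 + (q ^ 2)⁻¹)) := by field_simp
  rw [e1, e2]
  module

/-! ### The delta function -/

/-- The series `(w - q² z) z^(-1/2) α_ψ(w/z) Ψ₊(z) x₀⁺ Ψ₊(w)` expressed through products in which
the two fields `Ψ₊` are adjacent: its coefficient of `z ^ (m/2) w ^ (n/2)`. -/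
def psiPairBracket (q r s : ℂ) (m n : ℤ) : Module.End ℂ VTotal :=
  q • (xPlusOne q r * psiPair q r s m n) - q⁻¹ • (psiPair q r s m n * xPlusOne q r) -
    q • (xPlusZero q r * psiPair q r s (m - 2) n) + q • (psiPair q r s m (n - 2) * xPlusZero q r)

/-- The sum of `hasFinsum_psiPairBracket` on a vector of a single summand. -/
theorem hasFinsum_psiPairBracket_single (hq0 : q ≠ 0) (hq1 : ‖q‖ < 1) (hr : r ^ 2 = q)
    (hs : s ^ 2 = -q) (m n j : ℤ) (f : Fock) :
    HasFinsum (fun k : ℤ => q ^ (2 * k) •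
        psiPairBracket q r s (m - 2 * k) (n + 2 + 2 * k) (Finsupp.single j f))
      (if m + n = -2 ∧ Even (m + j) then
        (s * q ^ (m + 1) * (-1) ^ j) • Finsupp.single j f else 0) := by
  have hs0 : s ≠ 0 := fun h => hq0 (by rw [← neg_eq_zero, ← hs, h]; ring)
  by_cases hmn : Even (m + j) ∧ Even (n + j)
  swap
  · rw [if_neg (by rintro ⟨h1, h2⟩; apply hmn; rw [Int.even_iff, Int.even_iff]
                   rw [Int.even_iff] at h2; omega)]
    have h : ∀ k : ℤ, q ^ (2 * k) •
        psiPairBracket q r s (m - 2 * k) (n + 2 + 2 * k) (Finsupp.single j f) = 0 := by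
      intro k
      rw [Int.even_iff, Int.even_iff] at hmn
      simp only [psiPairBracket, LinearMap.sub_apply, LinearMap.add_apply, LinearMap.smul_apply,
        Module.End.mul_apply, xPlusZero_single, xPlusOne_single]
      rw [psiPair_single_of_not_even (by rw [Int.even_iff, Int.even_iff]; omega),
        psiPair_single_of_not_even (by rw [Int.even_iff, Int.even_iff]; omega),
        psiPair_single_of_not_even (by rw [Int.even_iff, Int.even_iff]; omega),
        psiPair_single_of_not_even (by rw [Int.even_iff, Int.even_iff]; omega)]
      simp
    simp only [h]
    exact HasFinsum.zero
  obtain ⟨hm, hn⟩ := hmn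
  obtain ⟨M, hM⟩ : ∃ M, m = 2 * M - j := ⟨(m + j) / 2, by rw [Int.even_iff] at hm; omega⟩
  obtain ⟨N, hN⟩ : ∃ N, n = 2 * N - j := ⟨(n + j) / 2, by rw [Int.even_iff] at hn; omega⟩
  subst hM hN
  have key : ∀ k : ℤ, q ^ (2 * k) • psiPairBracket q r s (2 * M - j - 2 * k)
      (2 * N - j + 2 + 2 * k) (Finsupp.single j f) =
      Finsupp.lsingle (R := ℂ) j (
        (q * s ^ (1 - 2 * j)) • xMode q r (-j)
          (q ^ (2 * k) • psiPsi q r (M - k) (N + 1 + k) f) -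
        (q⁻¹ * s ^ (1 - 2 * (j + 2))) •
          (q ^ (2 * k) • psiPsi q r (M + 1 - k) (N + 2 + k) (xMode q r (-2 - j) f)) -
        (q * s ^ (1 - 2 * j)) • xMode q r (-j + 1)
          (q ^ (2 * k) • psiPsi q r (M - 1 - k) (N + 1 + k) f) +
        (q * s ^ (1 - 2 * (j + 2))) •
          (q ^ (2 * k) • psiPsi q r (M + 1 - k) (N + 1 + k) (xMode q r (-1 - j) f))) := by
    intro k
    simp only [psiPairBracket, LinearMap.sub_apply, LinearMap.add_apply, LinearMap.smul_apply,
      Module.End.mul_apply, xPlusZero_single, xPlusOne_single]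
    rw [psiPair_single_of_even (by rw [Int.even_iff]; omega) (by rw [Int.even_iff]; omega),
      psiPair_single_of_even (by rw [Int.even_iff]; omega) (by rw [Int.even_iff]; omega),
      psiPair_single_of_even (by rw [Int.even_iff]; omega) (by rw [Int.even_iff]; omega),
      psiPair_single_of_even (by rw [Int.even_iff]; omega) (by rw [Int.even_iff]; omega)]
    simp only [map_smul, xPlusZero_single, xPlusOne_single, map_sub, map_add,
      Finsupp.lsingle_apply,
      show (2 * M - j - 2 * k + j) / 2 = M - k by omega,
      show (2 * N - j + 2 + 2 * k + j) / 2 = N + 1 + k by omega,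
      show (2 * M - j - 2 * k + (j + 2)) / 2 = M + 1 - k by omega,
      show (2 * N - j + 2 + 2 * k + (j + 2)) / 2 = N + 2 + k by omega,
      show (2 * M - j - 2 * k - 2 + j) / 2 = M - 1 - k by omega,
      show (2 * N - j + 2 + 2 * k - 2 + (j + 2)) / 2 = N + 1 + k by omega,
      show -2 - (j - 2) = -j by ring, show -1 - (j - 2) = -j + 1 by ring,
      show j + 2 - 2 = j by ring, show j - 2 + 2 = j by ring]
    module
  simp only [key]
  have H := fun M N f => hasFinsum_psiPsi hq0 hq1 hr M N f
  have h := ((((((H M (N + 1) f).map (xMode q r (-j))).smul (q * s ^ (1 - 2 * j))).sub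
    ((H (M + 1) (N + 2) (xMode q r (-2 - j) f)).smul (q⁻¹ * s ^ (1 - 2 * (j + 2))))).sub
    (((H (M - 1) (N + 1) f).map (xMode q r (-j + 1))).smul (q * s ^ (1 - 2 * j)))).add
    ((H (M + 1) (N + 1) (xMode q r (-1 - j) f)).smul (q * s ^ (1 - 2 * (j + 2))))).map
    (Finsupp.lsingle (R := ℂ) j)
  convert h using 1
  have hres := xMode_xInvMode_residue hq0 hq1 hr (-j) (M + N + 1) f
  have e1 : s ^ (1 - 2 * (j + 2)) = (q ^ 2)⁻¹ * s ^ (1 - 2 * j) := by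
    rw [show 1 - 2 * (j + 2) = 1 - 2 * j + (-4 : ℤ) by ring, zpow_add₀ hs0, mul_comm]
    congr 1
    rw [zpow_neg, show s ^ (4 : ℤ) = (s ^ 2) ^ 2 by rw [← pow_mul]; norm_cast, hs, neg_sq]
  have e2 : q ^ (2 * (M + 1)) = q ^ 2 * q ^ (2 * M) := by
    rw [show 2 * (M + 1) = 2 + 2 * M by ring, zpow_add₀ hq0]; norm_cast
  have e3 : q ^ (2 * (M - 1)) = (q ^ 2)⁻¹ * q ^ (2 * M) := by
    rw [show 2 * (M - 1) = -2 + 2 * M by ring, zpow_add₀ hq0, zpow_neg]; norm_cast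
  have e4 : q * s ^ (1 - 2 * j) * q ^ (2 * M) = s * q ^ (2 * M - j + 1) * (-1) ^ j := by
    have h2 : s ^ (1 - 2 * j) = s * ((-1) ^ j * q ^ (-j)) := by
      rw [show 1 - 2 * j = 1 + 2 * (-j) by ring, zpow_add₀ hs0, zpow_one, zpow_mul,
        show s ^ (2 : ℤ) = -1 * q by rw [neg_one_mul, ← hs]; norm_cast, mul_zpow]
      congr 2
      rw [zpow_neg, ← inv_zpow]
      norm_num
    rw [h2, show 2 * M - j + 1 = 2 * M + (-j) + 1 by ring, zpow_add₀ hq0, zpow_add₀ hq0, zpow_one]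
    ring
  have e5 : (if 2 * M - j + (2 * N - j) = -2 ∧ Even (2 * M - j + j) then
      (s * q ^ (2 * M - j + 1) * (-1) ^ j) • Finsupp.single j f else 0) =
      Finsupp.lsingle (R := ℂ) j ((q * s ^ (1 - 2 * j) * q ^ (2 * M)) •
        if M + N + 1 + -j = 0 then f else 0) := by
    rw [e4]
    by_cases hj : M + N + 1 + -j = 0
    · rw [if_pos hj, if_pos ⟨by omega, hm⟩, map_smul, Finsupp.lsingle_apply]
    · rw [if_neg hj, if_neg (by omega), smul_zero, map_zero]
  rw [e5, ← hres, e1, e2, e3]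
  congr 1
  simp only [map_smul, show M + 1 + (N + 2) = M + N + 1 + 2 by ring,
    show M + 1 + (N + 1) = M + N + 1 + 1 by ring, show M - 1 + (N + 1) = M + N + 1 - 1 by ring,
    show M + (N + 1) = M + N + 1 by ring, show -2 - j = -j - 2 by ring,
    show -1 - j = -j - 1 by ring, smul_add, smul_sub, smul_smul]
  have c1 : q⁻¹ * ((q ^ 2)⁻¹ * s ^ (1 - 2 * j)) * (q ^ 2 * q ^ (2 * M)) =
      q * s ^ (1 - 2 * j) * q ^ (2 * M) * (q ^ 2)⁻¹ := by field_simp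
  have c2 : q * ((q ^ 2)⁻¹ * s ^ (1 - 2 * j)) * (q ^ 2 * q ^ (2 * M)) =
      q * s ^ (1 - 2 * j) * q ^ (2 * M) := by field_simp
  rw [c1, c2]
  module

end Lift

/-! ### Series bounded below in `z` as a module over power series in `z/w` -/

/-- The series in which the powers of `z` are bounded from below. -/
def zSeries : AddSubgroup Series2 where
  carrier := {T | ∃ N : ℤ, ∀ m n, m < N → T m n = 0}
  zero_mem' := ⟨0, fun _ _ _ => rfl⟩
  add_mem' := by
    rintro S T ⟨N, hN⟩ ⟨M, hM⟩
    refine ⟨min N M, fun m n h => ?_⟩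
    rw [Pi.add_apply, Pi.add_apply, hN m n (by omega), hM m n (by omega), add_zero]
  neg_mem' := by
    rintro T ⟨N, hN⟩
    refine ⟨N, fun m n h => ?_⟩
    rw [Pi.neg_apply, Pi.neg_apply, hN m n h, neg_zero]

/-- On `zSeries`, the coefficients of `g(z/w) T` with a given power of `z` are sums over one and the
same finite range. -/
theorem exists_mulZW_eq_sum (T : zSeries) (m : ℤ) : ∃ K₀ : ℕ,
    (∀ k ≥ K₀, ∀ n, T.1 (m - 2 * k) n = 0) ∧
    ∀ g n, ∀ K ≥ K₀, mulZW g T.1 m n =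
      ∑ k ∈ Finset.range K, PowerSeries.coeff k g • T.1 (m - 2 * k) (n + 2 * k) := by
  obtain ⟨N, hN⟩ := T.2
  have h0 : ∀ k ≥ (m - N).toNat + 1, ∀ n, T.1 (m - 2 * k) n = 0 :=
    fun k hk n => hN _ _ (by omega)
  refine ⟨(m - N).toNat + 1, h0, fun g n K hK => ?_⟩
  refine finsum_eq_sum_of_support_subset _ fun k hk => ?_
  rw [Finset.coe_range, Set.mem_Iio]
  by_contra hlt
  exact hk (by simp only [h0 k (by omega), smul_zero])

/-- The power series `g` acts as multiplication by `g(z/w)`. -/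
instance : SMul (PowerSeries ℂ) zSeries where
  smul g T := ⟨mulZW g T.1, by
    obtain ⟨N, hN⟩ := T.2
    exact ⟨N, (mulZW_wellDefined g T.1 N hN).2⟩⟩

theorem coe_powerSeries_smul (g : PowerSeries ℂ) (T : zSeries) : (g • T).1 = mulZW g T.1 := rfl

theorem mulZW_mul (g g' : PowerSeries ℂ) (T : zSeries) :
    mulZW (g * g') T.1 = mulZW g (mulZW g' T.1) := by
  funext m n
  obtain ⟨K, h0, h1⟩ := exists_mulZW_eq_sum T m
  obtain ⟨K', -, h2⟩ := exists_mulZW_eq_sum (g' • T) m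
  rw [h1 _ n (max K K') (le_max_left _ _), ← coe_powerSeries_smul g' T,
    h2 g n (max K K') (le_max_right _ _)]
  set L := max K K'
  have e : ∀ i : ℕ, (g' • T).1 (m - 2 * i) (n + 2 * i) =
      ∑ j ∈ Finset.range (L - i), PowerSeries.coeff j g' •
        T.1 (m - 2 * (i + j : ℕ)) (n + 2 * (i + j : ℕ)) := by
    intro i
    refine finsum_eq_sum_of_support_subset _ (fun j hj => ?_) |>.trans
      (Finset.sum_congr rfl fun j _ => ?_)
    · rw [Finset.coe_range, Set.mem_Iio]
      by_contra hlt
      refine hj ?_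
      simp only [show m - 2 * (i : ℤ) - 2 * j = m - 2 * (i + j : ℕ) by push_cast; ring]
      rw [h0 (i + j) (by omega), smul_zero]
    · rw [show m - 2 * (i : ℤ) - 2 * j = m - 2 * (i + j : ℕ) by push_cast; ring,
        show n + 2 * (i : ℤ) + 2 * j = n + 2 * (i + j : ℕ) by push_cast; ring]
  simp only [e, Finset.smul_sum, smul_smul]
  rw [← Finset.sum_range_diag_flip L fun i j => (PowerSeries.coeff i g * PowerSeries.coeff j g') •
        T.1 (m - 2 * (i + j : ℕ)) (n + 2 * (i + j : ℕ))]
  refine Finset.sum_congr rfl fun k _ => ?_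
  rw [PowerSeries.coeff_mul, Finset.Nat.sum_antidiagonal_eq_sum_range_succ_mk, Finset.sum_smul]
  refine Finset.sum_congr rfl fun i hi => ?_
  rw [show i + (k - i) = k by rw [Finset.mem_range] at hi; omega]

theorem mulZW_C (c : ℂ) (T : Series2) : mulZW (C c) T = c • T := by
  funext m n
  rw [mulZW, finsum_eq_single _ 0 fun k hk => by rw [PowerSeries.coeff_C, if_neg hk, zero_smul]]
  simp

instance : Module (PowerSeries ℂ) zSeries where
  one_smul T := Subtype.ext (by
    rw [coe_powerSeries_smul, ← map_one C, mulZW_C, one_smul])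
  mul_smul g g' T := Subtype.ext (mulZW_mul g g' T)
  smul_zero g := Subtype.ext (by
    funext m n
    simp only [coe_powerSeries_smul, mulZW, AddSubgroup.coe_zero, Pi.zero_apply, smul_zero,
      finsum_zero])
  zero_smul T := Subtype.ext (by
    rw [coe_powerSeries_smul, ← map_zero C, mulZW_C, zero_smul]
    rfl)
  smul_add g S T := Subtype.ext (by
    funext m n
    obtain ⟨K, -, h⟩ := exists_mulZW_eq_sum S m
    obtain ⟨K', -, h'⟩ := exists_mulZW_eq_sum T m
    obtain ⟨K'', -, h''⟩ := exists_mulZW_eq_sum (S + T) m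
    have hK := h g n (K + K' + K'') (by omega)
    have hK' := h' g n (K + K' + K'') (by omega)
    have hK'' := h'' g n (K + K' + K'') (by omega)
    change mulZW g (S + T).1 m n = mulZW g S.1 m n + mulZW g T.1 m n
    rw [hK, hK', hK'', ← Finset.sum_add_distrib]
    exact Finset.sum_congr rfl fun k _ => smul_add _ _ _)
  add_smul g g' T := Subtype.ext (by
    funext m n
    obtain ⟨K, -, h⟩ := exists_mulZW_eq_sum T m
    change mulZW (g + g') T.1 m n = mulZW g T.1 m n + mulZW g' T.1 m n
    rw [h _ n K le_rfl, h _ n K le_rfl, h _ n K le_rfl, ← Finset.sum_add_distrib]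
    exact Finset.sum_congr rfl fun k _ => by rw [map_add, add_smul])

theorem C_smul_apply (c : ℂ) (T : zSeries) (m n : ℤ) : (C c • T).1 m n = c • T.1 m n := by
  rw [coe_powerSeries_smul, mulZW_C]
  rfl

theorem X_smul_apply (T : zSeries) (m n : ℤ) :
    ((X : PowerSeries ℂ) • T).1 m n = T.1 (m - 2) (n + 2) := by
  rw [coe_powerSeries_smul, mulZW, finsum_eq_single _ 1 fun k hk => by
    rw [PowerSeries.coeff_X, if_neg hk, zero_smul]]
  simp

/-- Multiplication by `w ^ (-1/2)` on series bounded below in `z`. -/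
def wInvSqrtLM : zSeries →ₗ[PowerSeries ℂ] zSeries where
  toFun T := ⟨wInvSqrt T.1, by
    obtain ⟨N, hN⟩ := T.2
    exact ⟨N, fun m n h => hN _ _ h⟩⟩
  map_add' _ _ := rfl
  map_smul' g T := Subtype.ext (by
    funext m n
    refine finsum_congr fun k => ?_
    rw [show n + 1 + 2 * (k : ℤ) = n + 2 * k + 1 by ring]
    rfl)

/-! ### Products of two vertex operators -/

section Exchange

variable {q r s : ℂ}

/-- The series `L Ψ₊(w) L' Ψ₊(z) u`. -/
def psiProd (q r s : ℂ) (L L' : Module.End ℂ VTotal) (u : VTotal) : zSeries :=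
  ⟨fun m n => L (psiPlus q r s n (L' (psiPlus q r s m u))), by
    obtain ⟨N, hN⟩ := psiPlus_bddBelow q r s u
    exact ⟨N, fun m n h => by simp only [hN m h, map_zero]⟩⟩

/-- Multiplication by `w ^ (-1/2) α_ψ(z/w)` on series bounded below in `z`. -/
def alphaMul (q : ℂ) : zSeries →ₗ[PowerSeries ℂ] zSeries :=
  wInvSqrtLM ∘ₗ LinearMap.lsmul (PowerSeries ℂ) zSeries (alphaPsi q)

theorem alphaMul_apply (T : zSeries) (m n : ℤ) :
    (alphaMul q T).1 m n = mulZW (alphaPsi q) T.1 m (n + 1) := rfl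

theorem exists_alphaMul_psiProd_eq_sum (L L' : Module.End ℂ VTotal) (u : VTotal) (m n : ℤ) :
    ∃ K₀ : ℕ, ∀ K ≥ K₀, (alphaMul q (psiProd q r s L L' u)).1 m n =
      ∑ k ∈ Finset.range K, PowerSeries.coeff k (alphaPsi q) •
        L (psiPlus q r s (n + 2 * k + 1) (L' (psiPlus q r s (m - 2 * k) u))) := by
  obtain ⟨K, -, h⟩ := exists_mulZW_eq_sum (psiProd q r s L L' u) m
  refine ⟨K, fun K' hK' => ?_⟩
  rw [alphaMul_apply, h _ _ K' hK']
  refine Finset.sum_congr rfl fun k _ => ?_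
  rw [show n + 1 + 2 * (k : ℤ) = n + 2 * k + 1 by ring]
  rfl

/-- Adjacent fields `Ψ₊` give the symmetric product. -/
theorem alphaMul_psiProd_one (hq0 : q ≠ 0) (hq1 : ‖q‖ < 1) (hr : r ^ 2 = q) (hs0 : s ≠ 0)
    (L : Module.End ℂ VTotal) (u : VTotal) (m n : ℤ) :
    (alphaMul q (psiProd q r s L 1 u)).1 m n = L (psiPair q r s m n u) := by
  obtain ⟨K, hK⟩ := exists_alphaMul_psiProd_eq_sum (q := q) (r := r) (s := s) L 1 u m n
  obtain ⟨K', hK'⟩ := sum_alphaPsi_psiPlus hq0 hq1 hr hs0 n m u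
  rw [hK _ (le_max_left K K'), psiPair_comm, ← hK' _ (le_max_right K K'), map_sum]
  exact Finset.sum_congr rfl fun k _ => (map_smul _ _ _).symm

/-- The exchange relation used for both factors: the coefficients of
`(w - q² z) Ψ₊(z) x₀⁺ Ψ₊(w)`. -/
theorem psiPlus_xPlusZero_psiPlus_bracket (hq0 : q ≠ 0) (hq1 : ‖q‖ < 1) (hr : r ^ 2 = q)
    (hs : s ^ 2 = -q) (m n : ℤ) (u : VTotal) :
    psiPlus q r s m (xPlusZero q r (psiPlus q r s (n - 2) u)) -
        q ^ 2 • psiPlus q r s (m - 2) (xPlusZero q r (psiPlus q r s n u)) =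
      q • xPlusOne q r (psiPlus q r s m (psiPlus q r s n u)) -
        q⁻¹ • psiPlus q r s m (psiPlus q r s n (xPlusOne q r u)) -
        q • xPlusZero q r (psiPlus q r s (m - 2) (psiPlus q r s n u)) +
        q • psiPlus q r s m (psiPlus q r s (n - 2) (xPlusZero q r u)) := by
  have h1 := LinearMap.congr_fun (psiPlus_exchange hq0 hq1 hr hs m) (psiPlus q r s n u)
  have h2 := congrArg (psiPlus q r s m)
    (LinearMap.congr_fun (psiPlus_exchange hq0 hq1 hr hs n) u)
  simp only [LinearMap.sub_apply, LinearMap.smul_apply, Module.End.mul_apply, map_sub,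
    map_smul] at h1 h2
  have e : q⁻¹ * q = 1 := inv_mul_cancel₀ hq0
  have e2 : q⁻¹ * q ^ 2 = q := by field_simp
  have h3 := congrArg (fun y => q⁻¹ • y) h2
  simp only [smul_sub, smul_smul, e, e2, one_smul] at h3
  linear_combination (norm := module) h1 + h3

/-- Two fields `Ψ₊` separated by `x₀⁺`, multiplied by `z - q² w`, reduce to adjacent fields. -/
theorem alphaMul_psiProd_xPlusZero_bracket (hq0 : q ≠ 0) (hq1 : ‖q‖ < 1) (hr : r ^ 2 = q)
    (hs : s ^ 2 = -q) (u : VTotal) (m n : ℤ) :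
    (alphaMul q (psiProd q r s 1 (xPlusZero q r) u)).1 (m - 2) n -
        q ^ 2 • (alphaMul q (psiProd q r s 1 (xPlusZero q r) u)).1 m (n - 2) =
      psiPairBracket q r s n m u := by
  have hs0 : s ≠ 0 := fun h => hq0 (by rw [← neg_eq_zero, ← hs, h]; ring)
  obtain ⟨K₁, h₁⟩ := exists_alphaMul_psiProd_eq_sum (q := q) (r := r) (s := s) 1 (xPlusZero q r)
    u (m - 2) n
  obtain ⟨K₂, h₂⟩ := exists_alphaMul_psiProd_eq_sum (q := q) (r := r) (s := s) 1 (xPlusZero q r)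
    u m (n - 2)
  obtain ⟨K₃, h₃⟩ := sum_alphaPsi_psiPlus hq0 hq1 hr hs0 n m u
  obtain ⟨K₄, h₄⟩ := sum_alphaPsi_psiPlus hq0 hq1 hr hs0 n m (xPlusOne q r u)
  obtain ⟨K₅, h₅⟩ := sum_alphaPsi_psiPlus hq0 hq1 hr hs0 (n - 2) m u
  obtain ⟨K₆, h₆⟩ := sum_alphaPsi_psiPlus hq0 hq1 hr hs0 n (m - 2) (xPlusZero q r u)
  have hK := fun i (hi : i ≤ K₁ + K₂ + K₃ + K₄ + K₅ + K₆) => hi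
  simp only [psiPairBracket, LinearMap.sub_apply, LinearMap.add_apply, LinearMap.smul_apply,
    Module.End.mul_apply]
  rw [h₁ _ (hK K₁ (by omega)), h₂ _ (hK K₂ (by omega)), ← h₃ _ (hK K₃ (by omega)),
    ← h₄ _ (hK K₄ (by omega)), ← h₅ _ (hK K₅ (by omega)), ← h₆ _ (hK K₆ (by omega))]
  simp only [map_sum, map_smul, Finset.smul_sum]
  rw [← Finset.sum_sub_distrib, ← Finset.sum_sub_distrib, ← Finset.sum_sub_distrib,
    ← Finset.sum_add_distrib]
  refine Finset.sum_congr rfl fun k _ => ?_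
  have h := psiPlus_xPlusZero_psiPlus_bracket hq0 hq1 hr hs (n + 2 * k + 1) (m - 2 * k) u
  have h' := congrArg (fun y => PowerSeries.coeff k (alphaPsi q) • y) h
  simp only [Module.End.one_apply, smul_sub, smul_add, smul_comm (PowerSeries.coeff k (alphaPsi q))]
    at h' ⊢
  rw [show m - 2 - 2 * (k : ℤ) = m - 2 * k - 2 by ring,
    show n - 2 + 2 * (k : ℤ) + 1 = n + 2 * k + 1 - 2 by ring]
  exact h'

theorem coeff_inv_one_sub_C_mul_X (a : ℂ) (k : ℕ) :
    PowerSeries.coeff k ((1 - C a * X : PowerSeries ℂ)⁻¹) = a ^ k := by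
  have h : (1 - C a * X : PowerSeries ℂ)⁻¹ = mk fun k => a ^ k := by
    rw [PowerSeries.inv_eq_iff_mul_eq_one (by simp), mul_comm, sub_mul, one_mul]
    ext k
    rw [map_sub, mul_assoc, PowerSeries.coeff_C_mul, PowerSeries.coeff_mk, PowerSeries.coeff_one]
    cases k with
    | zero => simp
    | succ k => rw [PowerSeries.coeff_succ_X_mul, PowerSeries.coeff_mk]; simp [pow_succ']
  rw [h, PowerSeries.coeff_mk]

theorem inv_one_sub_C_mul_X_mul_cancel (a : ℂ) :
    (1 - C a * X : PowerSeries ℂ)⁻¹ * (1 - C a * X) = 1 :=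
  PowerSeries.inv_mul_cancel _ (by simp)

/-- Evaluation of the bracket at `w = q² z`, that is, the sum over all coefficients on a line with
weights `q ^ (2 k)`.  There the normally ordered product of the two fields `Ψ₊` becomes the inverse
of `X⁺`, and its bracket with `X⁺` is a delta function. -/
theorem hasFinsum_psiPairBracket (hq0 : q ≠ 0) (hq1 : ‖q‖ < 1) (hr : r ^ 2 = q)
    (hs : s ^ 2 = -q) (i : Fin 2) {v : VTotal} (hv : v ∈ VLambda i) (m n : ℤ) :
    HasFinsum (fun k : ℤ => q ^ (2 * k) • psiPairBracket q r s (m - 2 * k) (n + 2 + 2 * k) v)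
      (if m + n = -2 ∧ m ≡ ((i : ℕ) : ℤ) [ZMOD 2] then (s * q ^ (m + 1)) • negOnePowDel v
        else 0) := by
  have h := HasFinsum.sum v.support fun j _ =>
    hasFinsum_psiPairBracket_single hq0 hq1 hr hs m n j (v j)
  have hv' : v = ∑ j ∈ v.support, Finsupp.single j (v j) := v.sum_single.symm
  convert h using 1
  · funext k
    conv_lhs => rw [hv', map_sum, Finset.smul_sum]
  · have hj : ∀ j ∈ v.support, (Even (m + j) ↔ m ≡ ((i : ℕ) : ℤ) [ZMOD 2]) := by
      intro j hj
      have : j ≡ ((i : ℕ) : ℤ) [ZMOD 2] := (Finsupp.mem_supported ℂ v).1 hv hj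
      rw [Int.even_iff]
      unfold Int.ModEq at this ⊢
      omega
    have e : ∀ j ∈ v.support, (if m + n = -2 ∧ Even (m + j) then
        (s * q ^ (m + 1) * (-1) ^ j) • Finsupp.single j (v j) else 0) =
        if m + n = -2 ∧ m ≡ ((i : ℕ) : ℤ) [ZMOD 2] then
          (s * q ^ (m + 1) * (-1) ^ j) • Finsupp.single j (v j) else 0 := fun j h => by
      simp only [hj j h]
    rw [Finset.sum_congr rfl e]
    split_ifs
    · conv_lhs => rw [hv', map_sum, Finset.smul_sum]
      refine Finset.sum_congr rfl fun j _ => ?_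
      rw [negOnePowDel, Finsupp.lsum_single, LinearMap.smul_apply, smul_smul]
      rfl
    · rw [Finset.sum_const_zero]

end Exchange

/-! ### The commutation relations -/

section LinearAlgebra

variable {R M : Type*} [CommRing R] [AddCommGroup M] [Module R M]

theorem sub_smul_add_mul_one_sub_smul (x c q : R) (Q U V : M) :
    (x - c) • Q + (q * (1 - x)) • (U + V) =
      x • Q - c • Q + q • (U + V - (x • U + x • V)) := by
  module

theorem eq_smul_sub_of_mul_eq_one {x c J : R} (h : J * (1 - c * x) = 1) (E : M) :
    E = J • E - c • (x • (J • E)) := by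
  linear_combination (norm := module) -(h • E)

/-- The rational function identities behind the column `v_+ ⊗ v_-` of the R-matrix. -/
theorem rMatrix_combination_left {x c q J : R} (hc : c = q ^ 2) (h : J * (1 - c * x) = 1)
    (Q U V : M) :
    J • ((x - c) • Q + (q * (1 - x)) • (U + V)) - q • U =
      ((1 - x) * q * J) • (V - q • Q) + ((1 - c) * x * J) • (Q - q • U) := by
  subst hc
  linear_combination (norm := module) q • (h • U)

/-- The rational function identities behind the column `v_- ⊗ v_+` of the R-matrix. -/
theorem rMatrix_combination_right {x c q J : R} (hc : c = q ^ 2) (h : J * (1 - c * x) = 1)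
    (Q U V : M) :
    V - q • J • ((x - c) • Q + (q * (1 - x)) • (U + V)) =
      ((1 - c) * J) • (V - q • Q) + ((1 - x) * q * J) • (Q - q • U) := by
  subst hc
  linear_combination (norm := module) -(h • V)

end LinearAlgebra

section Commutation

variable {q r s : ℂ}

/-- Exchange of `z` and `w` in `w ^ (-1/2) α_ψ(z/w) Ψ₊(w) x₀⁺ Ψ₊(z) v`.  The difference of the two
sides is annihilated by `1 - q² z/w`, and it vanishes where the power of `w` is very negative,
because there the expansion of `(1 - q² z/w)⁻¹` becomes a sum over all integers. -/
theorem alphaMul_psiProd_xPlusZero_swap (hq0 : q ≠ 0) (hq1 : ‖q‖ < 1) (hr : r ^ 2 = q)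
    (hs : s ^ 2 = -q) (i : Fin 2) {v : VTotal} (hv : v ∈ VLambda i) (m n : ℤ) :
    (alphaMul q (psiProd q r s 1 (xPlusZero q r) v)).1 n m =
      ((1 - C (q ^ 2) * X : PowerSeries ℂ)⁻¹ •
        ((X - C (q ^ 2) : PowerSeries ℂ) • alphaMul q (psiProd q r s 1 (xPlusZero q r) v) +
          (C q * (1 - X) : PowerSeries ℂ) • (alphaMul q (psiProd q r s (xPlusZero q r) 1 v) +
            alphaMul q (psiProd q r s 1 1 (xPlusZero q r v))))).1 m n -
      if m + n = -2 ∧ m ≡ ((i : ℕ) : ℤ) [ZMOD 2] then (s * q ^ (m + 1)) • negOnePowDel v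
        else 0 := by
  have hs0 : s ≠ 0 := fun h => hq0 (by rw [← neg_eq_zero, ← hs, h]; ring)
  set Q := alphaMul q (psiProd q r s 1 (xPlusZero q r) v) with hQ
  set U := alphaMul q (psiProd q r s (xPlusZero q r) 1 v) with hU
  set V := alphaMul q (psiProd q r s 1 1 (xPlusZero q r v)) with hV
  set J : PowerSeries ℂ := (1 - C (q ^ 2) * X)⁻¹ with hJ
  set E := (X - C (q ^ 2) : PowerSeries ℂ) • Q + (C q * (1 - X) : PowerSeries ℂ) • (U + V) with hE
  have hbr : ∀ m n, Q.1 (m - 2) n - q ^ 2 • Q.1 m (n - 2) = psiPairBracket q r s n m v :=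
    alphaMul_psiProd_xPlusZero_bracket hq0 hq1 hr hs v
  have hEv : ∀ m n, E.1 m n = psiPairBracket q r s m (n + 2) v := by
    intro m n
    have h := hbr m (n + 2)
    have e : E = (X : PowerSeries ℂ) • Q - C (q ^ 2) • Q +
        C q • (U + V - ((X : PowerSeries ℂ) • U + (X : PowerSeries ℂ) • V)) := by
      rw [hE]
      exact sub_smul_add_mul_one_sub_smul _ _ _ _ _ _
    rw [show n + 2 - 2 = n by ring] at h
    rw [e]
    change ((X : PowerSeries ℂ) • Q).1 m n - (C (q ^ 2) • Q).1 m n +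
      (C q • (U + V - ((X : PowerSeries ℂ) • U + (X : PowerSeries ℂ) • V))).1 m n = _
    rw [C_smul_apply, C_smul_apply, X_smul_apply, h]
    change _ + q • (U.1 m n + V.1 m n - (((X : PowerSeries ℂ) • U).1 m n +
      ((X : PowerSeries ℂ) • V).1 m n)) = _
    rw [X_smul_apply, X_smul_apply, hU, hV]
    simp only [alphaMul_psiProd_one hq0 hq1 hr hs0, psiPairBracket, LinearMap.sub_apply,
      LinearMap.add_apply, LinearMap.smul_apply, Module.End.mul_apply, Module.End.one_apply,
      show n + 2 - 2 = n by ring]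
    rw [psiPair_comm (n + 2) m, psiPair_comm n m, psiPair_comm (n + 2) (m - 2)]
    module
  have hstepE : ∀ m n, (J • E).1 m n - q ^ 2 • (J • E).1 (m - 2) (n + 2) = E.1 m n := by
    intro m n
    have h := eq_smul_sub_of_mul_eq_one (inv_one_sub_C_mul_X_mul_cancel (q ^ 2)) E
    rw [← hJ] at h
    conv_rhs => rw [h]
    change _ = (J • E).1 m n - (C (q ^ 2) • ((X : PowerSeries ℂ) • (J • E))).1 m n
    rw [C_smul_apply, X_smul_apply]
  let Δ : Series2 := fun m n =>
    if m + n = -2 ∧ m ≡ ((i : ℕ) : ℤ) [ZMOD 2] then (s * q ^ (m + 1)) • negOnePowDel v else 0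
  have hstepΔ : ∀ m n, Δ m n = q ^ 2 • Δ (m - 2) (n + 2) := by
    intro m n
    by_cases h : m + n = -2 ∧ m ≡ ((i : ℕ) : ℤ) [ZMOD 2]
    · have h' : m - 2 + (n + 2) = -2 ∧ m - 2 ≡ ((i : ℕ) : ℤ) [ZMOD 2] := by
        unfold Int.ModEq at h ⊢
        omega
      simp only [Δ, if_pos h, if_pos h', smul_smul]
      rw [show m + 1 = m - 2 + 1 + 2 by ring, zpow_add₀ hq0]
      congr 1
      norm_cast
      ring
    · have h' : ¬(m - 2 + (n + 2) = -2 ∧ m - 2 ≡ ((i : ℕ) : ℤ) [ZMOD 2]) := by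
        unfold Int.ModEq at h ⊢
        omega
      simp only [Δ, if_neg h, if_neg h', smul_zero]
  -- `Φ` is the difference of both sides; it satisfies `(1 - q² z/w) Φ = 0`
  let Φ : Series2 := fun m n => Q.1 n m - (J • E).1 m n + Δ m n
  have hstep : ∀ m n, Φ m n = q ^ 2 • Φ (m - 2) (n + 2) := by
    intro m n
    have h1 := hbr (n + 2) m
    rw [← hEv, ← hstepE, show n + 2 - 2 = n by ring] at h1
    have h2 := hstepΔ m n
    simp only [Φ]
    linear_combination (norm := module) h1 + h2
  obtain ⟨N, hN⟩ := Q.2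
  have hbr0 : ∀ m n, n < N → psiPairBracket q r s m n v = 0 := fun m n h => by
    rw [← hbr, hN _ _ (by omega), hN _ _ h, smul_zero, sub_zero]
  have hvanish : ∀ m n, n < N → Φ m n = 0 := by
    intro m n hn
    obtain ⟨K, -, hK⟩ := exists_mulZW_eq_sum E m
    obtain ⟨K', hK'⟩ := (hasFinsum_psiPairBracket hq0 hq1 hr hs i hv m n).sum_range
    -- for `n < N` the terms of the two-sided sum with negative index vanish
    have h1 : (J • E).1 m n = Δ m n := by
      rw [coe_powerSeries_smul, hK J n _ (le_max_left K K')]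
      refine Eq.trans (Finset.sum_congr rfl fun k _ => ?_) (hK' _ (le_max_right K K'))
      rw [hbr0 _ (n + 2 + 2 * (-1 - (k : ℤ))) (by omega), smul_zero, add_zero, hJ,
        coeff_inv_one_sub_C_mul_X, hEv, show n + 2 * (k : ℤ) + 2 = n + 2 + 2 * k by ring,
        ← pow_mul]
      norm_cast
    simp only [Φ, h1, hN n m hn, zero_sub, neg_add_cancel]
  have hΦ : Φ m n = 0 := by
    have h := eq_zero_of_step (u := (q ^ 2)⁻¹) (N := (n - N).toNat + 1)
      (F := fun k : ℕ => Φ (m + 2 * k) (n - 2 * k)) (fun k => by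
        rw [hstep (m + 2 * (k + 1 : ℕ)), smul_smul, inv_mul_cancel₀ (pow_ne_zero 2 hq0), one_smul]
        congr 1 <;> push_cast <;> ring)
      (fun k hk => hvanish _ _ (by omega))
    simpa using h
  change Q.1 n m = (J • E).1 m n - Δ m n
  simp only [Φ] at hΦ
  linear_combination (norm := module) hΦ

/-- The modes of `Ψ_{-ε}(z)`, where `ε` is `true` for `+` and `false` for `-`; its value at `q² z`
is `Ψ^*_ε(z)`. -/
def psiNegSign (q r s : ℂ) (ε : Bool) : FormalField := fun m =>
  if ε then psiMinus q r s m else psiPlus q r s m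

/-- The series `Ψ_{-ε₂}(w) Ψ_{-ε₁}(z) v`. -/
def psiSeries (q r s : ℂ) (v : VTotal) (ε : Bool × Bool) : zSeries :=
  ⟨fun m n => psiNegSign q r s ε.2 n (psiNegSign q r s ε.1 m v), by
    obtain ⟨N, hN⟩ := psiPlus_bddBelow q r s v
    obtain ⟨M, hM⟩ := psiPlus_bddBelow q r s (xPlusZero q r v)
    refine ⟨min N M, fun m n h => ?_⟩
    have : psiNegSign q r s ε.1 m v = 0 := by
      unfold psiNegSign psiMinus
      split_ifs
      · simp [hN m (by omega), hM m (by omega)]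
      · exact hN m (by omega)
    simp only [this, map_zero]⟩

theorem zSeries_ext {S T : zSeries} (h : ∀ m n, S.1 m n = T.1 m n) : S = T :=
  Subtype.ext (funext fun m => funext fun n => h m n)

theorem zSeries_add_apply (S T : zSeries) (m n : ℤ) : (S + T).1 m n = S.1 m n + T.1 m n := rfl

theorem zSeries_sub_apply (S T : zSeries) (m n : ℤ) : (S - T).1 m n = S.1 m n - T.1 m n := rfl

theorem psiSeries_false_false (v : VTotal) :
    psiSeries q r s v (false, false) = psiProd q r s 1 1 v := rfl

theorem psiSeries_true_false (v : VTotal) : psiSeries q r s v (true, false) =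
    psiProd q r s 1 1 (xPlusZero q r v) - C q • psiProd q r s 1 (xPlusZero q r) v := by
  refine zSeries_ext fun m n => ?_
  rw [zSeries_sub_apply, C_smul_apply]
  simp [psiSeries, psiNegSign, psiMinus, psiProd]

theorem psiSeries_false_true (v : VTotal) : psiSeries q r s v (false, true) =
    psiProd q r s 1 (xPlusZero q r) v - C q • psiProd q r s (xPlusZero q r) 1 v := by
  refine zSeries_ext fun m n => ?_
  rw [zSeries_sub_apply, C_smul_apply]
  simp [psiSeries, psiNegSign, psiMinus, psiProd]

/-- By the `q`-Serre relation for both factors, `Ψ₋(w) Ψ₋(z)` involves only products in which the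
two fields `Ψ₊` are adjacent. -/
theorem psiSeries_true_true (hq0 : q ≠ 0) (hq1 : ‖q‖ < 1) (hr : r ^ 2 = q) (hs : s ^ 2 = -q)
    (v : VTotal) : psiSeries q r s v (true, true) =
    C (q + q⁻¹)⁻¹ • (psiProd q r s 1 1 (xPlusZero q r (xPlusZero q r v)) +
      C (q ^ 2) • psiProd q r s (xPlusZero q r * xPlusZero q r) 1 v) -
    C q • psiProd q r s (xPlusZero q r) 1 (xPlusZero q r v) := by
  refine zSeries_ext fun m n => ?_
  rw [zSeries_sub_apply, C_smul_apply, zSeries_add_apply, C_smul_apply, C_smul_apply]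
  have h1 := congrArg (psiPlus q r s n)
    (LinearMap.congr_fun (psiPlus_serre hq0 hq1 hr hs m) v)
  have h2 := LinearMap.congr_fun (psiPlus_serre hq0 hq1 hr hs n) (psiPlus q r s m v)
  simp only [LinearMap.sub_apply, LinearMap.add_apply, LinearMap.smul_apply, Module.End.mul_apply,
    LinearMap.zero_apply, map_sub, map_add, map_smul, map_zero] at h1 h2
  simp only [psiSeries, psiNegSign, psiMinus, psiProd, if_true, LinearMap.sub_apply,
    LinearMap.smul_apply, Module.End.mul_apply, Module.End.one_apply, map_sub, map_smul]
  have hq : q + q⁻¹ ≠ 0 := by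
    have h := one_add_pow_ne_zero hq1 (two_ne_zero)
    rw [show q + q⁻¹ = q⁻¹ * (1 + q ^ 2) by field_simp; ring]
    exact mul_ne_zero (inv_ne_zero hq0) h
  have e1 : (q + q⁻¹)⁻¹ * (q + q⁻¹) = 1 := inv_mul_cancel₀ hq
  have e2 : (q + q⁻¹)⁻¹ * (1 + q ^ 2) = q := by
    rw [inv_mul_eq_iff_eq_mul₀ hq]
    field_simp
    ring
  linear_combination (norm := skip) -((q + q⁻¹)⁻¹ • h1) - ((q + q⁻¹)⁻¹ * q ^ 2) • h2
  match_scalars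
  all_goals first
    | ring1
    | linear_combination -e1
    | linear_combination e2
    | linear_combination -q ^ 2 * e1

theorem alphaMul_psiSeries_true_true_swap (hq0 : q ≠ 0) (hq1 : ‖q‖ < 1) (hr : r ^ 2 = q)
    (hs : s ^ 2 = -q) (v : VTotal) (m n : ℤ) :
    (alphaMul q (psiSeries q r s v (true, true))).1 n m =
      (alphaMul q (psiSeries q r s v (true, true))).1 m n := by
  have hs0 : s ≠ 0 := fun h => hq0 (by rw [← neg_eq_zero, ← hs, h]; ring)
  rw [psiSeries_true_true hq0 hq1 hr hs]
  simp only [map_sub, map_smul, map_add, zSeries_sub_apply, zSeries_add_apply, C_smul_apply,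
    alphaMul_psiProd_one hq0 hq1 hr hs0, psiPair_comm n m]

theorem sum_rMatrix_smul (q : ℂ) (F : Bool × Bool → zSeries) (ε : Bool × Bool) :
    ∑ ε' : Bool × Bool, Rmatrix q ε' ε • F ε' = match ε with
      | (true, true) => F (true, true)
      | (true, false) => ((1 - X) * C q * (1 - C (q ^ 2) * X : PowerSeries ℂ)⁻¹) • F (true, false) +
          (C (1 - q ^ 2) * X * (1 - C (q ^ 2) * X : PowerSeries ℂ)⁻¹) • F (false, true)
      | (false, true) => (C (1 - q ^ 2) * (1 - C (q ^ 2) * X : PowerSeries ℂ)⁻¹) • F (true, false) +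
          ((1 - X) * C q * (1 - C (q ^ 2) * X : PowerSeries ℂ)⁻¹) • F (false, true)
      | (false, false) => F (false, false) := by
  have h0 : ∀ T : zSeries, (0 : PowerSeries ℂ) • T = 0 := fun T =>
    zero_smul (PowerSeries ℂ) T
  have h1 : ∀ T : zSeries, (1 : PowerSeries ℂ) • T = T := fun T =>
    one_smul (PowerSeries ℂ) T
  rw [Fintype.sum_prod_type]
  simp only [Fintype.sum_bool]
  obtain ⟨_ | _, _ | _⟩ := ε <;>
    simp only [Rmatrix, Matrix.of_apply, h0, h1, zero_add, add_zero]

/-- The commutation relations of the vertex operators `Ψ_±(z)`: the left hand side is the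
coefficient of `z ^ (m/2) w ^ (n/2)` in `z ^ (-1/2) α_ψ(w/z) Ψ_{-ε₁}(z) Ψ_{-ε₂}(w) v`. -/
theorem alphaMul_psiSeries_swap (hq0 : q ≠ 0) (hq1 : ‖q‖ < 1) (hr : r ^ 2 = q)
    (hs : s ^ 2 = -q) (i : Fin 2) {v : VTotal} (hv : v ∈ VLambda i) (ε : Bool × Bool) (m n : ℤ) :
    (alphaMul q (psiSeries q r s v ε.swap)).1 n m =
      (∑ ε' : Bool × Bool, Rmatrix q ε' ε • alphaMul q (psiSeries q r s v ε')).1 m n +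
      if m + n = -2 ∧ m ≡ ((i : ℕ) : ℤ) [ZMOD 2] then
        (s * q ^ (m + 1) * (q • tensor (vStar false) (vStar true)
          - tensor (vStar true) (vStar false)) ε) • negOnePowDel v
      else 0 := by
  have hs0 : s ≠ 0 := fun h => hq0 (by rw [← neg_eq_zero, ← hs, h]; ring)
  have hswap := alphaMul_psiProd_xPlusZero_swap hq0 hq1 hr hs i hv m n
  have hsymm : ∀ L u, (alphaMul q (psiProd q r s L 1 u)).1 n m =
      (alphaMul q (psiProd q r s L 1 u)).1 m n := fun L u => by
    simp only [alphaMul_psiProd_one hq0 hq1 hr hs0, psiPair_comm n m]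
  have hJ := inv_one_sub_C_mul_X_mul_cancel (q ^ 2)
  rw [sum_rMatrix_smul]
  obtain ⟨_ | _, _ | _⟩ := ε
  · simp [tensor, vStar, psiSeries_false_false, hsymm]
  · have h := rMatrix_combination_right (map_pow C q 2) hJ
      (alphaMul q (psiProd q r s 1 (xPlusZero q r) v))
      (alphaMul q (psiProd q r s (xPlusZero q r) 1 v))
      (alphaMul q (psiProd q r s 1 1 (xPlusZero q r v)))
    simp only [psiSeries_true_false, psiSeries_false_true, Prod.swap_prod_mk, map_sub, map_smul,
      map_one]
    refine Eq.trans ?_ (congrArg (fun T : zSeries => T.1 m n + _) h)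
    have ht : (q • tensor (vStar false) (vStar true) -
        tensor (vStar true) (vStar false)) (false, true) = q := by simp [tensor, vStar]
    simp only [zSeries_sub_apply, C_smul_apply, hswap, hsymm, ht]
    split_ifs <;> module
  · have h := rMatrix_combination_left (map_pow C q 2) hJ
      (alphaMul q (psiProd q r s 1 (xPlusZero q r) v))
      (alphaMul q (psiProd q r s (xPlusZero q r) 1 v))
      (alphaMul q (psiProd q r s 1 1 (xPlusZero q r v)))
    simp only [psiSeries_true_false, psiSeries_false_true, Prod.swap_prod_mk, map_sub, map_smul,
      map_one]
    refine Eq.trans ?_ (congrArg (fun T : zSeries => T.1 m n + _) h)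
    have ht : (q • tensor (vStar false) (vStar true) -
        tensor (vStar true) (vStar false)) (true, false) = -1 := by simp [tensor, vStar]
    simp only [zSeries_sub_apply, C_smul_apply, hswap, hsymm, ht]
    split_ifs <;> module
  · simp [tensor, vStar, alphaMul_psiSeries_true_true_swap hq0 hq1 hr hs v m n]

end Commutation

/-! ### The dual vertex operators -/

section Dual

variable {q r s : ℂ}

theorem mulZW_zpow_smul (q : ℂ) (g : PowerSeries ℂ) (T : Series2) :
    mulZW g (fun m n => q ^ (m + n) • T m n) = fun m n => q ^ (m + n) • mulZW g T m n := by
  funext m n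
  rw [mulZW, mulZW, smul_finsum]
  refine finsum_congr fun k => ?_
  rw [smul_comm, show m - 2 * (k : ℤ) + (n + 2 * k) = m + n by ring]

theorem psiStar_eq_smul_psiNegSign (ε : Bool) (m : ℤ) :
    psiStar q r s ε m = q ^ m • psiNegSign q r s ε m := rfl

theorem psiStar_psiStar (hq0 : q ≠ 0) (v : VTotal) (ε : Bool × Bool) (m n : ℤ) :
    psiStar q r s ε.2 n (psiStar q r s ε.1 m v) =
      q ^ (m + n) • (psiSeries q r s v ε).1 m n := by
  rw [psiStar_eq_smul_psiNegSign, psiStar_eq_smul_psiNegSign, LinearMap.smul_apply,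
    LinearMap.smul_apply, map_smul, smul_smul, add_comm, zpow_add₀ hq0]
  rfl

theorem zInvSqrt_mulWZ_psiStar12 (hq0 : q ≠ 0) (v : VTotal) (ε : Bool × Bool) (m n : ℤ) :
    zInvSqrt (mulWZ (alphaPsi q) (psiStar12 q r s v ε)) m n =
      q ^ (m + n + 1) • (alphaMul q (psiSeries q r s v ε.swap)).1 n m := by
  have h := congrFun (congrFun (mulZW_zpow_smul q (alphaPsi q)
    (psiSeries q r s v ε.swap).1) n) (m + 1)
  rw [alphaMul_apply, show m + n + 1 = n + (m + 1) by ring]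
  refine Eq.trans (finsum_congr fun k => ?_) h
  exact congrArg _ (psiStar_psiStar hq0 v ε.swap _ _)

theorem rowMul_psiStar21 (hq0 : q ≠ 0) (v : VTotal) (ε : Bool × Bool)
    (M : Matrix (Bool × Bool) (Bool × Bool) (PowerSeries ℂ)) :
    rowMul (psiStar21 q r s v) M ε =
      fun m n => q ^ (m + n) • (∑ ε', M ε' ε • psiSeries q r s v ε').1 m n := by
  funext m n
  have h : (∑ ε', M ε' ε • psiSeries q r s v ε').1 =
      ∑ ε', mulZW (M ε' ε) (psiSeries q r s v ε').1 :=
    map_sum zSeries.subtype (fun ε' => M ε' ε • psiSeries q r s v ε') Finset.univ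
  rw [h, rowMul]
  simp only [Finset.sum_apply, Finset.smul_sum]
  refine Finset.sum_congr rfl fun ε' _ => ?_
  have e : psiStar21 q r s v ε' = fun m n => q ^ (m + n) • (psiSeries q r s v ε').1 m n :=
    funext fun m => funext fun n => psiStar_psiStar hq0 v ε' m n
  rw [e, mulZW_zpow_smul q]

theorem wInvSqrt_mulZW_rowMul_psiStar21 (hq0 : q ≠ 0) (v : VTotal) (ε : Bool × Bool)
    (M : Matrix (Bool × Bool) (Bool × Bool) (PowerSeries ℂ)) (m n : ℤ) :
    wInvSqrt (mulZW (alphaPsi q) (rowMul (psiStar21 q r s v) M ε)) m n =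
      q ^ (m + n + 1) • (∑ ε', M ε' ε • alphaMul q (psiSeries q r s v ε')).1 m n := by
  have h : ∑ ε', M ε' ε • alphaMul q (psiSeries q r s v ε') =
      alphaMul q (∑ ε', M ε' ε • psiSeries q r s v ε') := by
    rw [map_sum]
    exact Finset.sum_congr rfl fun ε' _ => (map_smul _ _ _).symm
  rw [h, alphaMul_apply, rowMul_psiStar21 hq0, wInvSqrt, mulZW_zpow_smul q, add_assoc]

end Dual

end AffineSl2

end

theorem mainTheorem4 (q r s : ℂ) (hq0 : q ≠ 0) (hq1 : ‖q‖ < 1) (hr : r ^ 2 = q) (hs : s ^ 2 = -q)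
    (i : Fin 2) (v : VTotal) (hv : v ∈ VLambda i) (ε : Bool × Bool) :
    zInvSqrt (mulWZ (alphaPsi q) (psiStar12 q r s v ε)) =
      wInvSqrt (mulZW (alphaPsi q) (rowMul (psiStar21 q r s v) (Rmatrix q) ε)) +
        delta q i ((s * (q • tensor (vStar false) (vStar true)
          - tensor (vStar true) (vStar false)) ε) • negOnePowDel v) := by
  funext m n
  rw [Pi.add_apply, Pi.add_apply, zInvSqrt_mulWZ_psiStar12 hq0,
    wInvSqrt_mulZW_rowMul_psiStar21 hq0, alphaMul_psiSeries_swap hq0 hq1 hr hs i hv, smul_add,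
    delta]
  congr 1
  split_ifs with h
  · rw [smul_smul, smul_smul, show m + n + 1 = -1 by omega, zpow_add₀ hq0, zpow_neg_one, zpow_one]
    congr 1
    field_simp
  · rw [smul_zero]
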